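/- **Setting.** Consider $\min_{x\in\mathbb R^p}\Phi(x):=f(x,y^*(x))$ with $y^*(x)=\arg\min_{y\in\mathbb R^q} g(x,y)$, where $f(x,y)=\mathbb E_\xi F(x,y;\xi)$, $g(x,y)=\mathbb E_\zeta G(x,y;\zeta)$, and $\Phi$ is bounded below. Let $0<\mu\le L$, let $M,\tau,\rho\ge 0$, and put $\kappa=L/\mu$. Write $d=\|x-x'\|+\|y-y'\|$ for the distance of $(x,y)$ and $(x',y')$; norms of matrices are operator norms. Assume that for every sample: $F(\cdot,\cdot;\xi)$ is $C^1$ and $G(\cdot,\cdot;\zeta)$ is $C^2$; $G(x,\cdot;\zeta)$ is $\mu$-strongly convex; $|F(x,y;\xi)-F(x',y';\xi)|\le Md$; each of $\nabla_xF,\nabla_yF,\nabla_yG$ changes by at most $Ld$, $\nabla_x\nabla_yG$ by at most $\tau d$, and $\nabla_y^2G$ by at most $\rho d$. Assume also that at every point $(x,y)$ the variances $\mathbb E\|\nabla_xF-\nabla_xf\|^2$ and $\mathbb E\|\nabla_yF-\nabla_yf\|^2$ are at most $\sigma_f^2$, $\mathbb E\|\nabla_yG-\nabla_yg\|^2\le\sigma_g^2$,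 $\mathbb E\|\nabla_x\nabla_yG-\nabla_x\nabla_yg\|^2\le\sigma_{g,1}^2$, and $\mathbb E\|\nabla_y^2G-\nabla_y^2g\|^2\le\sigma_{g,2}^2$. **Algorithm (SSGD).** Start from $(x^0,y^0,v^0)$, deterministic or random and independent of the samples, with $\|v^0\|\le M/\mu$ and $\Phi(x^0)$, $\|y^0-y^*(x^0)\|^2$ integrable. For $k=0,1,\dots$: set $x^{k+1}=x^k-\alpha h_f^k$ with $h_f^k=\nabla_xF(x^k,y^k;\mathcal D_F)-\nabla_x\nabla_yG(x^k,y^k;\mathcal D_G)v^k$; make $T$ steps $y\leftarrow y-\beta\nabla_yG(x^{k+1},y;\mathcal S_t)$ starting at $y^k$, which gives $y^{k+1}$; make $J$ steps $v\leftarrow(I-\eta\nabla_y^2G(x^{k+1},y^{k+1};\mathcal B_j))v+\eta\nabla_yF(x^{k+1},y^{k+1};\mathcal D_{F,j})$ starting at $v^k$, which gives $v^{k+1}$. Here a derivative at a batch is the average over the batch, all samples are mutually independent with the laws of $\xi$ and $\zeta$, and the batches have positive sizes $|\mathcal D_F|=|\mathcal D_{F,j}|=D_f$, $|\mathcal D_G|=D_g$,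 $|\mathcal S_t|=S$, $|\mathcal B_j|=D$. **Parameters.** Let $r_v=r_w=1$, $\beta=\frac1{2L}$, $0<\eta<\frac1L$, $C_1=\frac{M\rho}{\mu^2}+\frac L\mu$, $\bar C_1=L+\frac{M\tau}{\mu}$, $C_{22}=2\bigl(2+\frac{8L^2}{\mu^2}\bigr)C_1^2$, $C_{23}=12C_1^2$, $C_{24}=34C_1^2$, and $L_\Phi=L+\frac{2L^2+\tau M}{\mu}+\frac{\rho LM+L^3+\tau ML}{\mu^2}+\frac{\rho L^2M}{\mu^3}$. For a fixed $b>0$ let $\rho_2=b\kappa^{-3}$, $\rho_1=4\rho_2C_{23}$, $L_{31}=\frac{L_\Phi}{2}+\frac{\rho_1}{2}\frac{L^2}{\mu^2}+4\rho_2C_{22}$, $$\alpha=\min\Bigl\{\frac1{2L_{31}},\ \frac{\rho_2C_{23}}{\bar C_1^2},\ \frac{\rho_2}{4L^2}\Bigr\},\qquad T\ge\frac{\log\frac{\rho_1}{8(\rho_1+C_{24}\rho_2)}}{\log\frac{L}{\mu+L}},\qquad J\ge\frac{\log\frac1{16}}{\log(1-\eta\mu)}.$$ Put $H^0=\Phi(x^0)+\rho_1\|y^0-y^*(x^0)\|^2+\rho_2\|v^0-v^*(x^0)\|^2$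 with $v^*(x)=[\nabla_y^2g(x,y^*(x))]^{-1}\nabla_yf(x,y^*(x))$, and $\Delta_0=\mathbb E[H^0]-\inf\Phi$. **Theorem 2.** (i) $\Phi$ is differentiable, and for every $K\ge1$ the quantity $A_K:=\frac1K\sum_{k=0}^{K-1}\mathbb E\|\nabla\Phi(x^k)\|^2$ (whose expectations are finite) satisfies $$A_K\le\frac{2\Delta_0}{K\alpha}+\frac2\alpha\Bigl(\frac\alpha2+\frac{2\rho_2\eta}{\mu}\Bigr)\frac{\sigma_f^2}{D_f}+\frac{2M^2}{\mu^2}\frac{\sigma_{g,1}^2}{D_g}+\frac{(\rho_1+C_{24}\rho_2)(\mu+L)\beta}{\alpha\mu L}\frac{\sigma_g^2}{S}+\frac{4\rho_2\eta M^2}{\alpha\mu^3}\frac{\sigma_{g,2}^2}{D}$$ and $$A_K\le C\Bigl(\frac{\kappa^3}{K}\Delta_0+\kappa\frac{\sigma_f^2}{D_f}+\kappa^2\frac{\sigma_{g,1}^2}{D_g}+\kappa^5\frac{\sigma_g^2}{S}+\kappa^3\frac{\sigma_{g,2}^2}{D}\Bigr),$$ where $C>0$ depends only on $L,M,\tau,\rho,b$.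 (ii) Fix also $\theta\in(0,1)$, $\Delta\in\mathbb R$ and the $\sigma$'s. There is $C>0$, depending only on these and on $L,M,\tau,\rho,b$, such that for all $\mu\in(0,L]$ and $\varepsilon\in(0,1]$, with $\eta=\theta/L$, there are positive integers $K,D,S,D_f,D_g$ and integers $T,J$ obeying the lower bounds above, with $K\le C\kappa^3\varepsilon^{-1}$, $D_f\le C\kappa\varepsilon^{-1}$, $D_g\le C\kappa^2\varepsilon^{-1}$, $S\le C\kappa^5\varepsilon^{-1}$, $D\le C\kappa^3\varepsilon^{-1}$, $T\le C\kappa$, $J\le C\kappa$, for which on every such problem with $\Delta_0\le\Delta$ a point $\bar x$ drawn uniformly from $x^0,\dots,x^{K-1}$ (independently of the run) satisfies $\mathbb E\|\nabla\Phi(\bar x)\|^2\le\varepsilon$, while $K$ outer iterations use at most $C\kappa^5\varepsilon^{-2}$ sample gradients of $F$, $C\kappa^9\varepsilon^{-2}$ sample gradients of $G$, $C\kappa^5\varepsilon^{-2}$ Jacobian-vector products and $C\kappa^7\varepsilon^{-2}$ Hessian-vector products of $G$, and at most $C\kappa^9\varepsilon^{-2}$ such evaluations in total. -/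

import Mathlib

open MeasureTheory ProbabilityTheory

noncomputable section

/-- `ℝⁿ` with the Euclidean norm. -/
abbrev Euc (n : ℕ) : Type := EuclideanSpace ℝ (Fin n)

/-! ### Partial derivatives of a function of two vector variables -/

section Derivatives

variable {p q : ℕ}

/-- `∇ₓ φ(x, y)`. -/
def gradX (φ : Euc p → Euc q → ℝ) (x : Euc p) (y : Euc q) : Euc p :=
  gradient (fun x' => φ x' y) x

/-- `∇_y φ(x, y)`. -/
def gradY (φ : Euc p → Euc q → ℝ) (x : Euc p) (y : Euc q) : Euc q :=
  gradient (fun y' => φ x y') y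

/-- `∇ₓ∇_y φ(x, y)`, the `p × q` matrix of mixed derivatives `∂²φ / ∂xᵢ∂yⱼ`, as a linear map
`ℝ^q → ℝ^p`: the transpose of the `x`-Jacobian of `∇_y φ`. -/
def jacXY (φ : Euc p → Euc q → ℝ) (x : Euc p) (y : Euc q) : Euc q →L[ℝ] Euc p :=
  ContinuousLinearMap.adjoint (fderiv ℝ (fun x' => gradY φ x' y) x)

/-- `∇²_y φ(x, y)`, the Hessian in `y`. -/
def hessYY (φ : Euc p → Euc q → ℝ) (x : Euc p) (y : Euc q) : Euc q →L[ℝ] Euc q :=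
  fderiv ℝ (fun y' => gradY φ x y') y

end Derivatives

/-! ### The stochastic bilevel problem -/

/-- Data of the problem `min_x Φ(x) = f(x, y*(x))`, `y*(x) = argmin_y g(x, y)` with
`f(x, y) = 𝔼_ξ F(x, y; ξ)`, `g(x, y) = 𝔼_ζ G(x, y; ζ)`, where `ξ ∼ PF` and `ζ ∼ PG`. -/
structure Bilevel (p q : ℕ) (ΞF ΞG : Type*) [MeasurableSpace ΞF] [MeasurableSpace ΞG] where
  F : ΞF → Euc p → Euc q → ℝ
  G : ΞG → Euc p → Euc q → ℝ
  PF : Measure ΞF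
  PG : Measure ΞG

namespace Bilevel

variable {p q : ℕ} {ΞF ΞG : Type*} [MeasurableSpace ΞF] [MeasurableSpace ΞG]

/-- Upper-level objective. -/
def f (B : Bilevel p q ΞF ΞG) (x : Euc p) (y : Euc q) : ℝ := ∫ ξ, B.F ξ x y ∂B.PF

/-- Lower-level objective. -/
def g (B : Bilevel p q ΞF ΞG) (x : Euc p) (y : Euc q) : ℝ := ∫ ζ, B.G ζ x y ∂B.PG

/-- `y*(x)`, the minimizer of `g(x, ·)`. -/
def yStar (B : Bilevel p q ΞF ΞG) (x : Euc p) : Euc q :=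
  Classical.epsilon fun y => ∀ y', B.g x y ≤ B.g x y'

/-- `Φ(x) = f(x, y*(x))`. -/
def Phi (B : Bilevel p q ΞF ΞG) (x : Euc p) : ℝ := B.f x (B.yStar x)

/-- `v(x, y) = [∇²_y g(x, y)]⁻¹ ∇_y f(x, y)`. -/
def vSol (B : Bilevel p q ΞF ΞG) (x : Euc p) (y : Euc q) : Euc q :=
  (hessYY B.g x y).inverse (gradY B.f x y)

/-- The Lyapunov function `Φ(x) + ρ₁ ‖y - y*(x)‖² + ρ₂ ‖v - v(x, y*(x))‖²`. -/
def lyapunov (B : Bilevel p q ΞF ΞG) (ρ₁ ρ₂ : ℝ) (x : Euc p) (y v : Euc q) : ℝ :=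
  B.Phi x + ρ₁ * ‖y - B.yStar x‖ ^ 2 + ρ₂ * ‖v - B.vSol x (B.yStar x)‖ ^ 2

end Bilevel

/-! ### Problem constants and assumptions -/

/-- Strong convexity constant `μ`, Lipschitz constants `L` (gradients), `M` (upper-level function),
`τ` (mixed derivatives of `G`), `ρ` (Hessian in `y` of `G`). -/
structure Consts where
  μ : ℝ
  L : ℝ
  M : ℝ
  τ : ℝ
  ρ : ℝ

/-- Standard deviations of the stochastic gradients of `F`, the stochastic `y`-gradients of `G`,
its stochastic mixed derivatives, and its stochastic Hessians. -/
structure Noise where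
  σf : ℝ
  σg : ℝ
  σg1 : ℝ
  σg2 : ℝ

/-- `𝔼‖Z‖² ≤ σ²`. -/
def SecondMomentLE {Ξ V : Type*} [MeasurableSpace Ξ] [NormedAddCommGroup V]
    (P : Measure Ξ) (Z : Ξ → V) (σ : ℝ) : Prop :=
  MemLp Z 2 P ∧ ∫ ξ, ‖Z ξ‖ ^ 2 ∂P ≤ σ ^ 2

/-- The standing assumptions: regularity, strong convexity and Lipschitz continuity of each sample
function, and bounded variances. Norms of matrices are operator norms. -/
structure Bilevel.Assumptions {p q : ℕ} {ΞF ΞG : Type*} [MeasurableSpace ΞF] [MeasurableSpace ΞG]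
    (B : Bilevel p q ΞF ΞG) (c : Consts) (s : Noise) : Prop where
  probF : IsProbabilityMeasure B.PF
  probG : IsProbabilityMeasure B.PG
  measF : ∀ x y, Measurable fun ξ => B.F ξ x y
  measG : ∀ x y, Measurable fun ζ => B.G ζ x y
  intF : ∀ x y, Integrable (fun ξ => B.F ξ x y) B.PF
  intG : ∀ x y, Integrable (fun ζ => B.G ζ x y) B.PG
  smoothF : ∀ ξ, ContDiff ℝ 1 fun z : Euc p × Euc q => B.F ξ z.1 z.2
  smoothG : ∀ ζ, ContDiff ℝ 2 fun z : Euc p × Euc q => B.G ζ z.1 z.2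
  strong : ∀ ζ x, StrongConvexOn Set.univ c.μ (B.G ζ x)
  lipF : ∀ ξ x x' y y', |B.F ξ x y - B.F ξ x' y'| ≤ c.M * (‖x - x'‖ + ‖y - y'‖)
  lipGradXF : ∀ ξ x x' y y',
    ‖gradX (B.F ξ) x y - gradX (B.F ξ) x' y'‖ ≤ c.L * (‖x - x'‖ + ‖y - y'‖)
  lipGradYF : ∀ ξ x x' y y',
    ‖gradY (B.F ξ) x y - gradY (B.F ξ) x' y'‖ ≤ c.L * (‖x - x'‖ + ‖y - y'‖)
  lipGradYG : ∀ ζ x x' y y',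
    ‖gradY (B.G ζ) x y - gradY (B.G ζ) x' y'‖ ≤ c.L * (‖x - x'‖ + ‖y - y'‖)
  lipJacG : ∀ ζ x x' y y',
    ‖jacXY (B.G ζ) x y - jacXY (B.G ζ) x' y'‖ ≤ c.τ * (‖x - x'‖ + ‖y - y'‖)
  lipHessG : ∀ ζ x x' y y',
    ‖hessYY (B.G ζ) x y - hessYY (B.G ζ) x' y'‖ ≤ c.ρ * (‖x - x'‖ + ‖y - y'‖)
  varGradXF : ∀ x y, SecondMomentLE B.PF (fun ξ => gradX (B.F ξ) x y - gradX B.f x y) s.σf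
  varGradYF : ∀ x y, SecondMomentLE B.PF (fun ξ => gradY (B.F ξ) x y - gradY B.f x y) s.σf
  varGradYG : ∀ x y, SecondMomentLE B.PG (fun ζ => gradY (B.G ζ) x y - gradY B.g x y) s.σg
  varJacG : ∀ x y, SecondMomentLE B.PG (fun ζ => jacXY (B.G ζ) x y - jacXY B.g x y) s.σg1
  varHessG : ∀ x y, SecondMomentLE B.PG (fun ζ => hessYY (B.G ζ) x y - hessYY B.g x y) s.σg2

/-! ### The algorithm SSGD -/

/-- Step sizes, inner iteration counts, and batch sizes of SSGD: `Df` for `𝒟_F` and `𝒟_{F,j}`,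
`Dg` for `𝒟_G`, `S` for `𝒮_t`, `D` for `ℬ_j`. -/
structure Params where
  α : ℝ
  β : ℝ
  η : ℝ
  T : ℕ
  J : ℕ
  Df : ℕ
  Dg : ℕ
  S : ℕ
  D : ℕ

/-- Labels of the samples of `ξ`: the `i`-th sample of `𝒟_F` in outer iteration `k`, and the
`i`-th sample of `𝒟_{F,j}` in outer iteration `k`. -/
inductive FIdx where
  | outer (k i : ℕ)
  | inner (k j i : ℕ)

/-- Labels of the samples of `ζ`: the `i`-th sample of `𝒟_G`, of `𝒮_t`, of `ℬ_j` in outer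
iteration `k`. -/
inductive GIdx where
  | jac (k i : ℕ)
  | lower (k t i : ℕ)
  | hess (k j i : ℕ)

/-- Numbers of evaluations made so far, one for each single sample: gradients of `F`, gradients
of `G`, Jacobian-vector products of `G`, Hessian-vector products of `G`. -/
structure Calls where
  gradF : ℕ
  gradG : ℕ
  jvG : ℕ
  hvG : ℕ

/-- Total number of evaluations. -/
def Calls.total (n : Calls) : ℕ := n.gradF + n.gradG + n.jvG + n.hvG

/-- Current iterates, with the evaluation counters. -/
structure State (p q : ℕ) where
  x : Euc p
  y : Euc q
  v : Euc q
  calls : Calls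

/-- Average over a batch of size `n`. -/
def batchMean {V : Type*} [AddCommGroup V] [Module ℝ V] (n : ℕ) (u : ℕ → V) : V :=
  (n : ℝ)⁻¹ • ∑ i ∈ Finset.range n, u i

namespace Bilevel

variable {p q : ℕ} {ΞF ΞG : Type*} [MeasurableSpace ΞF] [MeasurableSpace ΞG]

/-- The hypergradient estimate
`h = ∇ₓF(x, y; 𝒟_F) - ∇ₓ∇_yG(x, y; 𝒟_G) v` at the `k`-th iterate. -/
def hyperGrad (B : Bilevel p q ΞF ΞG) (a : Params) (ξ : FIdx → ΞF) (ζ : GIdx → ΞG) (k : ℕ)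
    (s : State p q) : Euc p :=
  batchMean a.Df (fun i => gradX (B.F (ξ (.outer k i))) s.x s.y)
    - batchMean a.Dg (fun i => jacXY (B.G (ζ (.jac k i))) s.x s.y s.v)

/-- Upper-level step `x ← x - α h`. -/
def stepX (B : Bilevel p q ΞF ΞG) (a : Params) (ξ : FIdx → ΞF) (ζ : GIdx → ΞG) (k : ℕ)
    (s : State p q) : State p q :=
  { s with
    x := s.x - a.α • B.hyperGrad a ξ ζ k s
    calls := { s.calls with gradF := s.calls.gradF + a.Df, jvG := s.calls.jvG + a.Dg } }

/-- Lower-level step `y ← y - β ∇_yG(x, y; 𝒮_t)`. -/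
def stepY (B : Bilevel p q ΞF ΞG) (a : Params) (ζ : GIdx → ΞG) (k t : ℕ)
    (s : State p q) : State p q :=
  { s with
    y := s.y - a.β • batchMean a.S (fun i => gradY (B.G (ζ (.lower k t i))) s.x s.y)
    calls := { s.calls with gradG := s.calls.gradG + a.S } }

/-- Linear-system step `v ← (I - η ∇²_yG(x, y; ℬ_j)) v + η ∇_yF(x, y; 𝒟_{F,j})`. -/
def stepV (B : Bilevel p q ΞF ΞG) (a : Params) (ξ : FIdx → ΞF) (ζ : GIdx → ΞG) (k j : ℕ)
    (s : State p q) : State p q :=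
  { s with
    v := s.v - a.η • batchMean a.D (fun i => hessYY (B.G (ζ (.hess k j i))) s.x s.y s.v)
      + a.η • batchMean a.Df (fun i => gradY (B.F (ξ (.inner k j i))) s.x s.y)
    calls := { s.calls with gradF := s.calls.gradF + a.Df, hvG := s.calls.hvG + a.D } }

/-- `t` lower-level steps. -/
def loopY (B : Bilevel p q ΞF ΞG) (a : Params) (ζ : GIdx → ΞG) (k : ℕ) (s : State p q) :
    ℕ → State p q
  | 0 => s
  | t + 1 => B.stepY a ζ k t (B.loopY a ζ k s t)

/-- `j` linear-system steps. -/
def loopV (B : Bilevel p q ΞF ΞG) (a : Params) (ξ : FIdx → ΞF) (ζ : GIdx → ΞG) (k : ℕ)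
    (s : State p q) : ℕ → State p q
  | 0 => s
  | j + 1 => B.stepV a ξ ζ k j (B.loopV a ξ ζ k s j)

/-- The state `(xᵏ, yᵏ, vᵏ)` of SSGD after `k` outer iterations from `(x⁰, y⁰, v⁰)`. Each outer
iteration makes one upper-level step, then `T` lower-level steps starting at `yᵏ`, then `J` steps
for the linear system starting at `vᵏ`. -/
def ssgd (B : Bilevel p q ΞF ΞG) (a : Params) (x₀ : Euc p) (y₀ v₀ : Euc q)
    (ξ : FIdx → ΞF) (ζ : GIdx → ΞG) : ℕ → State p q
  | 0 => ⟨x₀, y₀, v₀, ⟨0, 0, 0, 0⟩⟩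
  | k + 1 =>
    B.loopV a ξ ζ k
      (B.loopY a ζ k (B.stepX a ξ ζ k (B.ssgd a x₀ y₀ v₀ ξ ζ k)) a.T) a.J

end Bilevel

/-! ### Randomness -/

/-- Initial point and samples, as random variables on `Ω`. -/
structure Draws (p q : ℕ) (ΞF ΞG Ω : Type*) where
  x₀ : Ω → Euc p
  y₀ : Ω → Euc q
  v₀ : Ω → Euc q
  ξ : FIdx → Ω → ΞF
  ζ : GIdx → Ω → ΞG

namespace Draws

variable {p q : ℕ} {ΞF ΞG Ω : Type*} [MeasurableSpace ΞF] [MeasurableSpace ΞG]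

/-- The σ-algebras generated by the initial point, by each sample `ξ`, by each sample `ζ`. -/
abbrev sigma (R : Draws p q ΞF ΞG Ω) : Unit ⊕ FIdx ⊕ GIdx → MeasurableSpace Ω
  | .inl _ => MeasurableSpace.comap (fun ω => (R.x₀ ω, R.y₀ ω, R.v₀ ω)) inferInstance
  | .inr (.inl i) => MeasurableSpace.comap (R.ξ i) inferInstance
  | .inr (.inr i) => MeasurableSpace.comap (R.ζ i) inferInstance

/-- Samples have the laws of the problem, everything is mutually independent, `‖v⁰‖ ≤ M/μ`, and
the Lyapunov function at the initial point is integrable. -/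
structure Valid [MeasurableSpace Ω] (R : Draws p q ΞF ΞG Ω) (B : Bilevel p q ΞF ΞG) (c : Consts)
    (P : Measure Ω) : Prop where
  meas_init : Measurable fun ω => (R.x₀ ω, R.y₀ ω, R.v₀ ω)
  meas_ξ : ∀ i, Measurable (R.ξ i)
  meas_ζ : ∀ i, Measurable (R.ζ i)
  law_ξ : ∀ i, P.map (R.ξ i) = B.PF
  law_ζ : ∀ i, P.map (R.ζ i) = B.PG
  indep : iIndep R.sigma P
  bound_v₀ : ∀ᵐ ω ∂P, ‖R.v₀ ω‖ ≤ c.M / c.μ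
  int_Phi : Integrable (fun ω => B.Phi (R.x₀ ω)) P
  int_y₀ : Integrable (fun ω => ‖R.y₀ ω - B.yStar (R.x₀ ω)‖ ^ 2) P

/-- The (random) state of SSGD after `k` outer iterations. -/
def run (R : Draws p q ΞF ΞG Ω) (B : Bilevel p q ΞF ΞG) (a : Params) (k : ℕ) (ω : Ω) :
    State p q :=
  B.ssgd a (R.x₀ ω) (R.y₀ ω) (R.v₀ ω) (fun i => R.ξ i ω) (fun i => R.ζ i ω) k

/-- `𝔼[H⁰] - inf Φ` for the Lyapunov function with weights `ρ₁`, `ρ₂`. -/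
def initialGap [MeasurableSpace Ω] (R : Draws p q ΞF ΞG Ω) (B : Bilevel p q ΞF ΞG) (ρ₁ ρ₂ : ℝ)
    (P : Measure Ω) : ℝ :=
  (∫ ω, B.lyapunov ρ₁ ρ₂ (R.x₀ ω) (R.y₀ ω) (R.v₀ ω) ∂P) - ⨅ x, B.Phi x

end Draws

/-! ### Explicit constants (with `rw` denoting the parameter `r_w`) -/

namespace Consts

/-- The condition number `L / μ`. -/
def κ (c : Consts) : ℝ := c.L / c.μ

/-- `C₁ = Mρ/μ² + L/μ`. -/
def C1 (c : Consts) : ℝ := c.M * c.ρ / c.μ ^ 2 + c.L / c.μ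

/-- `C̄₁ = L + Mτ/μ`. -/
def C1bar (c : Consts) : ℝ := c.L + c.M * c.τ / c.μ

/-- `L_Φ`, the Lipschitz constant of `∇Φ`. -/
def LPhi (c : Consts) : ℝ :=
  c.L + (2 * c.L ^ 2 + c.τ * c.M) / c.μ
    + (c.ρ * c.L * c.M + c.L ^ 3 + c.τ * c.M * c.L) / c.μ ^ 2
    + c.ρ * c.L ^ 2 * c.M / c.μ ^ 3

def C22 (c : Consts) (rw : ℝ) : ℝ := (1 + 1 / rw) * (2 + 8 * c.L ^ 2 / c.μ ^ 2) * c.C1 ^ 2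

def C23 (c : Consts) (rw : ℝ) : ℝ := (1 + 1 / rw) * c.C1 ^ 2 * (5 + rw)

def C24 (c : Consts) (rw : ℝ) : ℝ := (1 + 1 / rw) * (9 + 8 * rw) * c.C1 ^ 2

/-- `ρ₁ = 2 ρ₂ (1 + r_w) C₂₃`. -/
def rho1 (c : Consts) (rw ρ₂ : ℝ) : ℝ := 2 * ρ₂ * (1 + rw) * c.C23 rw

/-- `L₃₁ = L_Φ/2 + (ρ₁/2) L²/μ² + 2 ρ₂ (1 + r_w) C₂₂`. -/
def L31 (c : Consts) (rw ρ₂ : ℝ) : ℝ :=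
  c.LPhi / 2 + c.rho1 rw ρ₂ / 2 * (c.L ^ 2 / c.μ ^ 2) + 2 * ρ₂ * (1 + rw) * c.C22 rw

/-- The step size
`α = min {1/(2 L₃₁), ρ₂ (1 + r_w) C₂₃ / (2 C̄₁²), ρ₂ / (4 L²)}`. -/
def alpha (c : Consts) (rw ρ₂ : ℝ) : ℝ :=
  min (1 / (2 * c.L31 rw ρ₂))
    (min (ρ₂ * (1 + rw) * c.C23 rw / (2 * c.C1bar ^ 2)) (ρ₂ / (4 * c.L ^ 2)))

/-- The lower bound on `T`. -/
def Tmin (c : Consts) (rw ρ₂ : ℝ) : ℝ :=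
  Real.log (c.rho1 rw ρ₂ / (8 * (c.rho1 rw ρ₂ + c.C24 rw * ρ₂))) / Real.log (c.L / (c.μ + c.L))

/-- The lower bound on `J`. -/
def Jmin (c : Consts) (rw η : ℝ) : ℝ :=
  Real.log (1 / (4 * (1 + rw) ^ 2)) / Real.log (1 - η * c.μ)

end Consts

end

/-! The proof follows one Lyapunov function: `Φ(x)` plus `ρ₁` times the squared error of `y` against
`y*(x)` plus `ρ₂` times the squared error of `v` against `v*(x)`.

Differentiating the optimality condition `∇_y g(x, y*(x)) = 0` gives `∇Φ(x) = ∇ₓf - ∇ₓ∇_y g · v*(x)`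
at `y*(x)` (`hasGradientAt_Phi`), and this gradient is `L_Φ`-Lipschitz. The upper-level step is
therefore a stochastic gradient step on `Φ` whose bias is at most `C̄₁‖y - y*‖ + L‖v - v*‖`. The
descent lemma (`integral_descent_le`) gains `α/2 ‖∇Φ‖²`, pays for bias and variance, and for small
`α` also leaves room for a multiple of `‖x⁺ - x‖²`.

Moving `x` displaces the targets `y*` and `v*` by at most a Lipschitz constant times `‖x⁺ - x‖`,
which that multiple covers. The inner loops then contract: a mean gradient step on `g(x, ·)` shrinks
the `y`-error, and a mean linear-system step shrinks the `v`-error, each up to a noise floor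
(`integral_runY_le`, `integral_runV_le`). `T` and `J` are large enough for the surviving errors to
fit into the Lyapunov weights; this bookkeeping is `lyapunov_decrease`. Telescoping
(`sum_gradient_Phi_le`) gives the explicit rate.

Two facts make the expectations legitimate. Each iterate is measurable for the draws made so far,
hence independent of the next batch, and Tonelli allows integrating over the batch with the iterate
frozen. Moreover `v` stays in the ball of radius `M/μ` on almost every path (`norm_updV_le`, with
the assumed bound on `v⁰`), so Jacobian and Hessian noise has bounded variance.

The powers of `κ` come from `C₁ = O(κ²)`: with `ρ₂ = bκ⁻³` one has `ρ₂C₁² = O(κ)`, hence `L₃₁ =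
O(κ³)` and `1/α = O(κ³)` (`exists_alpha_const`). For the complexity, `K` and the batch sizes make
each of the five terms of the rate at most `ε/5`. -/

noncomputable section

/-! ### Monotone operators, the descent lemma and implicit differentiation in inner product spaces.
-/

section Analysis

open scoped RealInnerProductSpace

variable {V W : Type*} [NormedAddCommGroup V] [InnerProductSpace ℝ V]
  [NormedAddCommGroup W] [InnerProductSpace ℝ W]

/-- A symmetric operator with `0 ≤ ⟪A u, u⟫ ≤ c ‖u‖²` has norm at most `c`. -/
lemma norm_apply_le_of_inner_le {A : V →L[ℝ] V} {c : ℝ} (hc : 0 ≤ c)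
    (hsymm : ∀ u w, ⟪A u, w⟫ = ⟪u, A w⟫) (hpos : ∀ u, 0 ≤ ⟪A u, u⟫)
    (hle : ∀ u, ⟪A u, u⟫ ≤ c * ‖u‖ ^ 2) (u : V) : ‖A u‖ ≤ c * ‖u‖ := by
  rcases eq_or_ne u 0 with rfl | hu
  · simp
  rcases eq_or_ne (A u) 0 with h0 | h0
  · rw [h0, norm_zero]; positivity
  have hu' := norm_pos_iff.2 hu
  have h0' := norm_pos_iff.2 h0
  -- `A u` rescaled to the length of `u`: polarization gives `4⟪A u, w⟫ = 4‖u‖‖A u‖` as a difference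
  -- of two values of the quadratic form, and the parallelogram law bounds `‖u + w‖²` by `4‖u‖²`.
  set w := (‖u‖ / ‖A u‖) • A u with hw
  have hnw : ‖w‖ = ‖u‖ := by
    rw [hw, norm_smul, Real.norm_of_nonneg (by positivity)]; field_simp
  have h1 := hle (u + w)
  have h2 := hpos (u - w)
  have h3 : ‖u + w‖ ^ 2 + ‖u - w‖ ^ 2 = 4 * ‖u‖ ^ 2 := by
    have := parallelogram_law_with_norm ℝ u w
    rw [hnw] at this; nlinarith
  have h4 : ⟪A u, w⟫ = ‖u‖ * ‖A u‖ := by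
    rw [hw, inner_smul_right, real_inner_self_eq_norm_sq]; field_simp
  have h5 : ⟪A w, u⟫ = ⟪A u, w⟫ := by rw [hsymm, real_inner_comm]
  have h6 : ⟪A (u + w), u + w⟫ - ⟪A (u - w), u - w⟫ = 4 * (‖u‖ * ‖A u‖) := by
    simp only [map_add, map_sub, inner_add_left, inner_add_right, inner_sub_left, inner_sub_right,
      h5, h4]; ring
  have h7 : 4 * (‖u‖ * ‖A u‖) ≤ c * (4 * ‖u‖ ^ 2) := by
    have : c * ‖u + w‖ ^ 2 ≤ c * (4 * ‖u‖ ^ 2) := by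
      gcongr; nlinarith [sq_nonneg ‖u - w‖]
    linarith
  have : ‖u‖ * ‖A u‖ ≤ ‖u‖ * (c * ‖u‖) := by nlinarith
  exact le_of_mul_le_mul_left this hu'

/-- The gradient step map of a quadratic form with spectrum in `[μ, L]` contracts. -/
lemma norm_sub_smul_apply_le {H : V →L[ℝ] V} {μ L η : ℝ} (hμL : μ ≤ L) (hη : 0 ≤ η)
    (hηL : η * L ≤ 1) (hsymm : ∀ u w, ⟪H u, w⟫ = ⟪u, H w⟫)
    (hlow : ∀ u, μ * ‖u‖ ^ 2 ≤ ⟪H u, u⟫) (hup : ∀ u, ‖H u‖ ≤ L * ‖u‖) (u : V) :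
    ‖u - η • H u‖ ≤ (1 - η * μ) * ‖u‖ := by
  have hηm : η * μ ≤ 1 := (mul_le_mul_of_nonneg_left hμL hη).trans hηL
  -- The quadratic form of `I - ηH` lies between `0` (by `ηL ≤ 1`) and `1 - ημ` (by coercivity).
  have := norm_apply_le_of_inner_le (A := ContinuousLinearMap.id ℝ V - η • H) (c := 1 - η * μ)
    (by linarith) (fun u w => ?_) (fun u => ?_) (fun u => ?_) u
  · simpa using this
  · simp [inner_sub_left, inner_sub_right, inner_smul_left, inner_smul_right, hsymm]
  · simp only [sub_apply, smul_apply,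
      ContinuousLinearMap.id_apply, inner_sub_left, inner_smul_left, real_inner_self_eq_norm_sq]
    have h1 : ⟪H u, u⟫ ≤ L * ‖u‖ ^ 2 := by
      calc ⟪H u, u⟫ ≤ ‖H u‖ * ‖u‖ := real_inner_le_norm _ _
        _ ≤ L * ‖u‖ * ‖u‖ := by gcongr; exact hup u
        _ = _ := by ring
    have h2 : η * ⟪H u, u⟫ ≤ η * (L * ‖u‖ ^ 2) := by gcongr
    have h3 : η * L * ‖u‖ ^ 2 ≤ 1 * ‖u‖ ^ 2 := by gcongr
    simp only [conj_trivial]; linarith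
  · simp only [sub_apply, smul_apply,
      ContinuousLinearMap.id_apply, inner_sub_left, inner_smul_left, real_inner_self_eq_norm_sq]
    have h2 : η * (μ * ‖u‖ ^ 2) ≤ η * ⟪H u, u⟫ := by gcongr; exact hlow u
    simp only [conj_trivial]; linarith

lemma hasDerivAt_comp_line {φ : V → W} {φ' : V →L[ℝ] W} (y w : V) (t : ℝ)
    (h : HasFDerivAt φ φ' (y + t • w)) :
    HasDerivAt (fun s : ℝ => φ (y + s • w)) (φ' w) t := by
  have h1 : HasDerivAt (fun s : ℝ => y + s • w) w t := by
    simpa using ((hasDerivAt_id t).smul_const w).const_add y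
  exact h.comp_hasDerivAt t h1

/-- The gradient of a strongly convex function is strongly monotone. -/
lemma StrongConvexOn.le_inner_gradient_sub [CompleteSpace V] {φ : V → ℝ} {μ : ℝ}
    (h : StrongConvexOn Set.univ μ φ) (hd : Differentiable ℝ φ) (y y' : V) :
    μ * ‖y' - y‖ ^ 2 ≤ ⟪gradient φ y' - gradient φ y, y' - y⟫ := by
  rw [strongConvexOn_iff_convex] at h
  set w := y' - y
  -- Subtracting `μ/2 ‖·‖²` leaves a convex function; on the segment its derivative is monotone, and
  -- comparing the ends `0` and `1` gives the claim.
  set ψ : ℝ → ℝ := fun t => φ (y + t • w) - μ / 2 * ‖y + t • w‖ ^ 2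
  have hconv : ConvexOn ℝ Set.univ ψ := by
    have := h.comp_affineMap (AffineMap.lineMap y y' : ℝ →ᵃ[ℝ] V)
    refine this.congr ?_
    intro t _
    simp [ψ, w, AffineMap.lineMap_apply, add_comm]
  have hder : ∀ t, HasDerivAt ψ (⟪gradient φ (y + t • w), w⟫ - μ * ⟪y + t • w, w⟫) t := by
    intro t
    have h1 := hasDerivAt_comp_line y w t (hd _).hasFDerivAt
    have h2 := hasDerivAt_comp_line y w t
      ((contDiff_norm_sq ℝ (n := 1) (E := V)).differentiable one_ne_zero (y + t • w)).hasFDerivAt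
    have h3 := h1.sub (h2.const_mul (μ / 2))
    refine h3.congr_deriv ?_
    rw [inner_gradient_left, fderiv_norm_sq_apply, smul_apply, innerSL_apply_apply]
    simp only [nsmul_eq_mul]; push_cast; ring
  have hm := hconv.monotoneOn_deriv (fun t _ => (hder t).differentiableAt)
    (Set.mem_univ 0) (Set.mem_univ 1) zero_le_one
  rw [(hder 0).deriv, (hder 1).deriv] at hm
  have e1 : y + (1 : ℝ) • w = y' := by simp [w]
  have e0 : y + (0 : ℝ) • w = y := by simp
  rw [e1, e0] at hm
  rw [inner_sub_left, ← real_inner_self_eq_norm_sq]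
  have : ⟪w, w⟫ = ⟪y', w⟫ - ⟪y, w⟫ := by rw [← inner_sub_left]
  rw [this]; linarith

/-- The derivative of a strongly monotone field is coercive. -/
lemma le_inner_of_hasFDerivAt_of_monotone {ψ : V → V} {H : V →L[ℝ] V} {μ : ℝ} {y : V}
    (hmono : ∀ y', μ * ‖y' - y‖ ^ 2 ≤ ⟪ψ y' - ψ y, y' - y⟫) (hH : HasFDerivAt ψ H y) (u : V) :
    μ * ‖u‖ ^ 2 ≤ ⟪H u, u⟫ := by
  have h1 : HasDerivAt (fun s : ℝ => ψ (y + s • u)) (H u) 0 :=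
    hasDerivAt_comp_line y u 0 (by simpa using hH)
  have h2 := h1.tendsto_slope_zero_right
  have h3 := h2.inner (𝕜 := ℝ) (tendsto_const_nhds (x := u))
  refine ge_of_tendsto h3 ?_
  filter_upwards [self_mem_nhdsWithin] with t ht
  have ht : 0 < t := ht
  have h4 := hmono (y + t • u)
  simp only [add_sub_cancel_left, norm_smul, Real.norm_of_nonneg ht.le, inner_smul_right] at h4
  simp only [zero_add, zero_smul, add_zero, inner_smul_left, conj_trivial]
  rw [inv_mul_eq_div, le_div_iff₀ ht]
  have : t * (μ * ‖u‖ ^ 2 * t) ≤ t * ⟪ψ (y + t • u) - ψ y, u⟫ := by nlinarith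
  exact le_of_mul_le_mul_left this ht

/-- The descent lemma. -/
lemma le_add_inner_gradient_add_of_lipschitz [CompleteSpace V] {φ : V → ℝ} {K : ℝ}
    (hd : Differentiable ℝ φ)
    (hK : ∀ x x', ‖gradient φ x - gradient φ x'‖ ≤ K * ‖x - x'‖) (x d : V) :
    φ (x + d) ≤ φ x + ⟪gradient φ x, d⟫ + K / 2 * ‖d‖ ^ 2 := by
  -- The gap to the quadratic model along the segment; its derivative is nonpositive on `[0, 1]` by
  -- the Lipschitz bound on the gradient.
  set h : ℝ → ℝ := fun t => φ (x + t • d) - t * ⟪gradient φ x, d⟫ - K / 2 * ‖d‖ ^ 2 * t ^ 2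
  have hder : ∀ t, HasDerivAt h
      (⟪gradient φ (x + t • d), d⟫ - ⟪gradient φ x, d⟫ - K * ‖d‖ ^ 2 * t) t := by
    intro t
    have h1 := hasDerivAt_comp_line x d t (hd _).hasFDerivAt
    have h2 := (h1.sub ((hasDerivAt_id t).mul_const ⟪gradient φ x, d⟫)).sub
      ((hasDerivAt_pow 2 t).const_mul (K / 2 * ‖d‖ ^ 2))
    refine h2.congr_deriv ?_
    rw [inner_gradient_left]; simp; ring
  have hanti : AntitoneOn h (Set.Icc 0 1) := by
    refine antitoneOn_of_deriv_nonpos (convex_Icc 0 1)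
      (fun t _ => (hder t).continuousAt.continuousWithinAt)
      (fun t _ => (hder t).differentiableAt.differentiableWithinAt) ?_
    intro t ht
    rw [interior_Icc] at ht
    rw [(hder t).deriv, ← inner_sub_left]
    have h1 : ⟪gradient φ (x + t • d) - gradient φ x, d⟫ ≤ K * ‖d‖ ^ 2 * t :=
      calc _ ≤ ‖gradient φ (x + t • d) - gradient φ x‖ * ‖d‖ := real_inner_le_norm _ _
        _ ≤ K * ‖x + t • d - x‖ * ‖d‖ := by gcongr; exact hK _ _
        _ = _ := by
          rw [add_sub_cancel_left, norm_smul, Real.norm_of_nonneg ht.1.le]; ring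
    linarith
  have := hanti (by simp) (by simp) zero_le_one
  simp only [h, one_smul, zero_smul, add_zero] at this
  linarith

lemma norm_le_of_le_inner {H : V →L[ℝ] V} {μ : ℝ}
    (hlow : ∀ u, μ * ‖u‖ ^ 2 ≤ ⟪H u, u⟫) (u : V) : μ * ‖u‖ ≤ ‖H u‖ := by
  rcases eq_or_ne u 0 with rfl | hu
  · simp
  have := (hlow u).trans (real_inner_le_norm _ _)
  refine le_of_mul_le_mul_right (a := ‖u‖) ?_ (norm_pos_iff.2 hu)
  linarith [sq ‖u‖]

/-- A coercive operator on a finite-dimensional space is invertible. -/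
lemma apply_inverse_of_le_inner [FiniteDimensional ℝ V] {H : V →L[ℝ] V} {μ : ℝ} (hμ : 0 < μ)
    (hlow : ∀ u, μ * ‖u‖ ^ 2 ≤ ⟪H u, u⟫) (w : V) : H (H.inverse w) = w := by
  have hinj : Function.Injective (H : V →ₗ[ℝ] V) := by
    rw [← LinearMap.ker_eq_bot, LinearMap.ker_eq_bot']
    intro u hu
    have h1 := norm_le_of_le_inner hlow u
    rw [show H u = 0 from hu, norm_zero] at h1
    exact norm_le_zero_iff.1 (by nlinarith [norm_nonneg u])
  set e := (LinearEquiv.ofInjectiveEndo (H : V →ₗ[ℝ] V) hinj).toContinuousLinearEquiv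
  have he : (e : V →L[ℝ] V) = H := by ext u; rfl
  rw [← he, ContinuousLinearMap.inverse_equiv]
  simp

/-- Differentiability of the solution of `ψ (x, Y x) = 0`, when it is Lipschitz and the partial
derivative of `ψ` in the second variable is bounded below. -/
lemma hasFDerivAt_of_implicit {ψ : W × V → V} {A : W →L[ℝ] V} {H : V →L[ℝ] V} {B : W →L[ℝ] V}
    {Y : W → V} {x : W} {μ K : ℝ} (hμ : 0 < μ)
    (hψ : HasFDerivAt ψ (A.comp (ContinuousLinearMap.fst ℝ W V)
      + H.comp (ContinuousLinearMap.snd ℝ W V)) (x, Y x))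
    (hY : ∀ x', ‖Y x' - Y x‖ ≤ K * ‖x' - x‖) (hzero : ∀ x', ψ (x', Y x') = 0)
    (hlow : ∀ u, μ * ‖u‖ ≤ ‖H u‖) (hB : ∀ u, H (B u) = - A u) : HasFDerivAt Y B x := by
  have hcont : Filter.Tendsto (fun x' => (x', Y x')) (nhds x) (nhds (x, Y x)) := by
    refine Filter.Tendsto.prodMk_nhds Filter.tendsto_id ?_
    rw [tendsto_iff_norm_sub_tendsto_zero]
    refine squeeze_zero (fun _ => norm_nonneg _) hY ?_
    have : Filter.Tendsto (fun x' => K * ‖x' - x‖) (nhds x) (nhds (K * ‖x - x‖)) := by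
      refine Continuous.tendsto ?_ x; fun_prop
    simpa using this
  have h1 := (hasFDerivAt_iff_isLittleO.1 hψ).comp_tendsto hcont
  have hO : (fun x' => ((x', Y x') : W × V) - (x, Y x)) =O[nhds x] fun x' => x' - x := by
    refine Asymptotics.IsBigO.of_bound (max 1 K) (Filter.Eventually.of_forall fun x' => ?_)
    rw [Prod.mk_sub_mk, Prod.norm_mk, max_mul_of_nonneg _ _ (norm_nonneg _), one_mul]
    exact max_le_max le_rfl (hY x')
  have h2 := h1.trans_isBigO hO
  refine hasFDerivAt_iff_isLittleO.2 ?_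
  refine Asymptotics.IsBigO.trans_isLittleO (Asymptotics.IsBigO.of_bound μ⁻¹
    (Filter.Eventually.of_forall fun x' => ?_)) h2
  simp only [Function.comp_def, hzero, Prod.mk_sub_mk, add_apply,
    ContinuousLinearMap.comp_apply, ContinuousLinearMap.coe_fst', ContinuousLinearMap.coe_snd',
    sub_zero, zero_sub, norm_neg]
  -- Since `H ∘ B = -A`, the linear part of `ψ` at the displacement equals `H` applied to the error
  -- of the linearization of `Y`. The lower bound on `H` thus transfers the `o(‖x' - x‖)` from `ψ`
  -- to `Y`.
  rw [inv_mul_eq_div, le_div_iff₀ hμ, mul_comm]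
  refine (hlow _).trans (le_of_eq ?_)
  congr 1
  rw [map_sub, hB]; abel

end Analysis

/-! ### Averaging over a batch independent of the current iterate. -/

section Probability

open scoped RealInnerProductSpace

variable {Ω : Type*} [MeasurableSpace Ω] {P : Measure Ω}

/-- If `X` and `S` are independent and the conditional mean of `φ (X, S) ≥ 0` given `X` is at most
`w (X)`, then the mean of `φ (X, S)` is finite and at most that of `w (X)`. -/
lemma ProbabilityTheory.IndepFun.integral_le [IsProbabilityMeasure P] {Z E : Type*}
    [MeasurableSpace Z] [MeasurableSpace E] {X : Ω → Z} {S : Ω → E} (h : IndepFun X S P)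
    (hX : Measurable X) (hS : Measurable S) {φ : Z × E → ℝ} (hφ : Measurable φ)
    (hφ0 : ∀ z, 0 ≤ φ z) {w : Ω → ℝ} (hw : Integrable w P)
    (hle : ∀ᵐ ω ∂P, Integrable (fun ω' => φ (X ω, S ω')) P ∧
      ∫ ω', φ (X ω, S ω') ∂P ≤ w ω) :
    Integrable (fun ω => φ (X ω, S ω)) P ∧ ∫ ω, φ (X ω, S ω) ∂P ≤ ∫ ω, w ω ∂P := by
  have hw0 : 0 ≤ᵐ[P] w := by
    filter_upwards [hle] with ω hω
    exact (integral_nonneg fun _ => hφ0 _).trans hω.2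
  -- Tonelli for nonnegative functions presupposes no integrability, so integrability of `φ (X, S)`
  -- comes out as a conclusion.
  have key : ∫⁻ ω, ENNReal.ofReal (φ (X ω, S ω)) ∂P ≤ ∫⁻ ω, ENNReal.ofReal (w ω) ∂P := by
    have e1 : ∫⁻ ω, ENNReal.ofReal (φ (X ω, S ω)) ∂P
        = ∫⁻ z, ENNReal.ofReal (φ z) ∂(P.map fun ω => (X ω, S ω)) := by
      rw [lintegral_map hφ.ennreal_ofReal (hX.prodMk hS)]
    have : IsProbabilityMeasure (P.map S) := Measure.isProbabilityMeasure_map hS.aemeasurable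
    rw [e1, h.map_prod_eq_prod_map_map hX.aemeasurable hS.aemeasurable,
      lintegral_prod _ hφ.ennreal_ofReal.aemeasurable,
      lintegral_map (Measurable.lintegral_prod_right' hφ.ennreal_ofReal) hX]
    refine lintegral_mono_ae ?_
    filter_upwards [hle] with ω hω
    rw [lintegral_map (f := fun y => ENNReal.ofReal (φ (X ω, y)))
        (hφ.comp measurable_prodMk_left).ennreal_ofReal hS,
      ← ofReal_integral_eq_lintegral_ofReal hω.1 (Filter.Eventually.of_forall fun _ => hφ0 _)]
    exact ENNReal.ofReal_le_ofReal hω.2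
  have hm : AEStronglyMeasurable (fun ω => φ (X ω, S ω)) P :=
    (hφ.comp (hX.prodMk hS)).aestronglyMeasurable
  have h0 : 0 ≤ᵐ[P] fun ω => φ (X ω, S ω) := Filter.Eventually.of_forall fun _ => hφ0 _
  have hint : Integrable (fun ω => φ (X ω, S ω)) P := by
    refine ⟨hm, ?_⟩
    rw [hasFiniteIntegral_iff_ofReal h0]
    exact key.trans_lt ((hasFiniteIntegral_iff_ofReal hw0).1 hw.2)
  refine ⟨hint, ?_⟩
  rw [← ofReal_integral_eq_lintegral_ofReal hint h0,
    ← ofReal_integral_eq_lintegral_ofReal hw hw0] at key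
  exact (ENNReal.ofReal_le_ofReal_iff (integral_nonneg_of_ae hw0)).1 key

variable {V : Type*} [NormedAddCommGroup V] [InnerProductSpace ℝ V]

/-- A centered square-integrable random vector with second moment at most `v`. -/
structure IsNoise (P : Measure Ω) (Z : Ω → V) (v : ℝ) : Prop where
  memLp : MemLp Z 2 P
  mean : ∫ ω, Z ω ∂P = 0
  var : ∫ ω, ‖Z ω‖ ^ 2 ∂P ≤ v

namespace IsNoise

variable {Z Z' : Ω → V} {v v' : ℝ}

lemma integrable [IsFiniteMeasure P] (h : IsNoise P Z v) : Integrable Z P :=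
  h.memLp.integrable one_le_two

lemma integrable_norm_sq (h : IsNoise P Z v) : Integrable (fun ω => ‖Z ω‖ ^ 2) P :=
  h.memLp.integrable_norm_pow two_ne_zero

lemma const_smul (h : IsNoise P Z v) (r : ℝ) : IsNoise P (fun ω => r • Z ω) (r ^ 2 * v) := by
  refine ⟨h.memLp.const_smul r, ?_, ?_⟩
  · rw [integral_smul, h.mean, smul_zero]
  · simp only [norm_smul, mul_pow, Real.norm_eq_abs, sq_abs]
    rw [integral_const_mul]
    gcongr
    exact h.var

lemma mono (h : IsNoise P Z v) (hv : v ≤ v') : IsNoise P Z v' := ⟨h.memLp, h.mean, h.var.trans hv⟩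

/-- Independent centered vectors are orthogonal in mean, so variances add without the factor `2` of
a crude estimate. -/
lemma add [IsFiniteMeasure P] [CompleteSpace V] [MeasurableSpace V] [BorelSpace V]
    (h : IsNoise P Z v) (h' : IsNoise P Z' v') (hind : IndepFun Z Z' P) :
    IsNoise P (fun ω => Z ω + Z' ω) (v + v') := by
  refine ⟨h.memLp.add h'.memLp, ?_, ?_⟩
  · rw [integral_add h.integrable h'.integrable, h.mean, h'.mean, add_zero]
  · have hcross : ∫ ω, ⟪Z ω, Z' ω⟫ ∂P = 0 := by
      have := hind.integral_bilin h.integrable h'.integrable (innerSL ℝ)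
      rw [h.mean] at this
      exact this.trans (inner_zero_left _)
    have hci : Integrable (fun ω => ⟪Z ω, Z' ω⟫) P :=
      hind.integrable_bilin h.integrable h'.integrable (innerSL ℝ)
    have hi : Integrable (fun ω => ‖Z ω‖ ^ 2 + 2 * ⟪Z ω, Z' ω⟫) P :=
      h.integrable_norm_sq.add (hci.const_mul 2)
    simp only [norm_add_sq_real]
    rw [integral_add hi h'.integrable_norm_sq,
      integral_add h.integrable_norm_sq (hci.const_mul 2), integral_const_mul, hcross]
    linarith [h.var, h'.var]

lemma integrable_const_add_norm_sq [IsFiniteMeasure P] (h : IsNoise P Z v) (a : V) :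
    Integrable (fun ω => ‖a + Z ω‖ ^ 2) P :=
  ((memLp_const a).add h.memLp).integrable_norm_pow two_ne_zero

lemma integral_const_add_norm_sq_le [IsProbabilityMeasure P] [CompleteSpace V]
    (h : IsNoise P Z v) (a : V) : ∫ ω, ‖a + Z ω‖ ^ 2 ∂P ≤ ‖a‖ ^ 2 + v := by
  have hci : Integrable (fun ω => ⟪a, Z ω⟫) P := h.integrable.const_inner a
  have hi : Integrable (fun ω => ‖a‖ ^ 2 + 2 * ⟪a, Z ω⟫) P :=
    (integrable_const _).add (hci.const_mul 2)
  simp only [norm_add_sq_real]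
  rw [integral_add hi h.integrable_norm_sq,
    integral_add (integrable_const _) (hci.const_mul 2), integral_const_mul,
    integral_inner h.integrable, h.mean]
  simpa using h.var

/-- Bias-variance split about the mean `m`. The one-step bounds for `y` and `v` are read off from it
with `w` the target of the step. -/
lemma norm_sub_sq_le [IsProbabilityMeasure P] [CompleteSpace V] {Y : Ω → V} {m : V}
    (h : IsNoise P (fun ω => Y ω - m) v) (w : V) :
    Integrable (fun ω => ‖Y ω - w‖ ^ 2) P ∧ ∫ ω, ‖Y ω - w‖ ^ 2 ∂P ≤ ‖m - w‖ ^ 2 + v := by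
  have e : ∀ ω, Y ω - w = (m - w) + (Y ω - m) := fun ω => by abel
  simp only [e]
  exact ⟨h.integrable_const_add_norm_sq _, h.integral_const_add_norm_sq_le _⟩

/-- Expected descent of a step `x - α h` with an unbiased estimate `h` of `hbar`, on a function
with the quadratic upper bound of a smooth function. -/
lemma integral_descent_le [IsProbabilityMeasure P] [CompleteSpace V] [MeasurableSpace V]
    [BorelSpace V] [SecondCountableTopology V] {Φ : V → ℝ} {x gr hbar : V} {K m c₀ α : ℝ}
    {h : Ω → V} (hN : IsNoise P (fun ω => h ω - hbar) v) (hh : Measurable h)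
    (hΦ : ∀ d, Φ (x + d) ≤ Φ x + ⟪gr, d⟫ + K / 2 * ‖d‖ ^ 2) (hΦm : Measurable Φ)
    (hm : ∀ x, m ≤ Φ x) (hc₀ : 0 ≤ c₀) (hα : 0 ≤ α) (hα' : (K / 2 + c₀) * α ≤ 1 / 2) :
    Integrable (fun ω => Φ (x - α • h ω) - m + c₀ * ‖α • h ω‖ ^ 2) P ∧
    ∫ ω, (Φ (x - α • h ω) - m + c₀ * ‖α • h ω‖ ^ 2) ∂P
      ≤ Φ x - m - α / 2 * ‖gr‖ ^ 2 + α / 2 * ‖gr - hbar‖ ^ 2 + α / 2 * v := by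
  have hhi : Integrable h P := by
    refine (hN.integrable.add (integrable_const hbar)).congr
      (Filter.Eventually.of_forall fun ω => ?_)
    simp
  have hhmean : ∫ ω, h ω ∂P = hbar := by
    have := hN.mean
    rw [integral_sub hhi (integrable_const _)] at this
    simpa [sub_eq_zero] using this
  obtain ⟨hsq, hsqle⟩ := hN.norm_sub_sq_le 0
  simp only [sub_zero] at hsq hsqle
  have hin : Integrable (fun ω => ⟪gr, h ω⟫) P := hhi.const_inner gr
  have hpt : ∀ ω, Φ (x - α • h ω) - m + c₀ * ‖α • h ω‖ ^ 2
      ≤ Φ x - m + (-α * ⟪gr, h ω⟫ + (K / 2 + c₀) * α ^ 2 * ‖h ω‖ ^ 2) := by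
    intro ω
    have h1 := hΦ (-(α • h ω))
    rw [← sub_eq_add_neg, norm_neg, inner_neg_right, inner_smul_right] at h1
    have h2 : ‖α • h ω‖ ^ 2 = α ^ 2 * ‖h ω‖ ^ 2 := by
      rw [norm_smul, mul_pow, Real.norm_eq_abs, sq_abs]
    rw [h2] at h1 ⊢
    linarith
  have hub1 : Integrable (fun ω => -α * ⟪gr, h ω⟫ + (K / 2 + c₀) * α ^ 2 * ‖h ω‖ ^ 2) P :=
    (hin.const_mul _).add (hsq.const_mul _)
  have hub : Integrable (fun ω => Φ x - m
      + (-α * ⟪gr, h ω⟫ + (K / 2 + c₀) * α ^ 2 * ‖h ω‖ ^ 2)) P :=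
    (integrable_const _).add hub1
  -- Subtracting the lower bound `m` makes the integrand nonnegative, so the pointwise upper bound
  -- alone yields integrability.
  have hnn : ∀ ω, 0 ≤ Φ (x - α • h ω) - m + c₀ * ‖α • h ω‖ ^ 2 := fun ω =>
    add_nonneg (sub_nonneg.2 (hm _)) (by positivity)
  have hhα : Measurable fun ω => α • h ω := hh.const_smul α
  have hint : Integrable (fun ω => Φ (x - α • h ω) - m + c₀ * ‖α • h ω‖ ^ 2) P := by
    refine hub.mono' ?_ (Filter.Eventually.of_forall fun ω => ?_)
    · exact (((hΦm.comp (measurable_const.sub hhα)).sub_const m).add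
        ((hhα.norm.pow_const 2).const_mul c₀)).aestronglyMeasurable
    · rw [Real.norm_of_nonneg (hnn ω)]; exact hpt ω
  refine ⟨hint, (integral_mono hint hub hpt).trans ?_⟩
  rw [integral_add (integrable_const _) hub1, integral_add (hin.const_mul _) (hsq.const_mul _),
    integral_const_mul, integral_const_mul, integral_inner hhi, hhmean]
  have h2 : ‖gr - hbar‖ ^ 2 = ‖gr‖ ^ 2 - 2 * ⟪gr, hbar⟫ + ‖hbar‖ ^ 2 := norm_sub_sq_real _ _
  -- The step-size condition turns the whole quadratic term, `c₀` included, into `α/2 (‖hbar‖² +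
  -- v)`. Completing the square with `-α⟪gr, hbar⟫` then leaves `α/2 ‖gr - hbar‖² - α/2 ‖gr‖²`.
  have h3 : (K / 2 + c₀) * α ^ 2 * ∫ ω, ‖h ω‖ ^ 2 ∂P ≤ α / 2 * (‖hbar‖ ^ 2 + v) := by
    have h0 : 0 ≤ ∫ ω, ‖h ω‖ ^ 2 ∂P := integral_nonneg fun ω => sq_nonneg ‖h ω‖
    calc _ = (K / 2 + c₀) * α * (α * ∫ ω, ‖h ω‖ ^ 2 ∂P) := by ring
      _ ≤ 1 / 2 * (α * ∫ ω, ‖h ω‖ ^ 2 ∂P) := by gcongr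
      _ ≤ 1 / 2 * (α * (‖hbar‖ ^ 2 + v)) := by gcongr
      _ = _ := by ring
  simp only [integral_const, probReal_univ, one_smul]
  rw [h2]
  linarith

lemma comp {Ξ : Type*} [MeasurableSpace Ξ] {Q : Measure Ξ} {u : Ξ → V} (h : IsNoise Q u v)
    {ξ : Ω → Ξ} (hξ : Measurable ξ) (hlaw : P.map ξ = Q) :
    IsNoise P (fun ω => u (ξ ω)) v := by
  subst hlaw
  refine ⟨h.memLp.comp_measurePreserving ⟨hξ, rfl⟩, ?_, ?_⟩
  · rw [← integral_map hξ.aemeasurable h.memLp.1, h.mean]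
  · rw [← integral_map (f := fun z => ‖u z‖ ^ 2) hξ.aemeasurable (h.memLp.1.norm.pow 2)]
    exact h.var

lemma sum_range [IsProbabilityMeasure P] [CompleteSpace V] [MeasurableSpace V] [BorelSpace V]
    [SecondCountableTopology V] {X : ℕ → Ω → V} (h : ∀ i, IsNoise P (X i) v)
    (hm : ∀ i, Measurable (X i)) (hind : iIndepFun X P) (n : ℕ) :
    IsNoise P (fun ω => ∑ i ∈ Finset.range n, X i ω) (n * v) := by
  induction n with
  | zero => exact ⟨by simp, by simp, by simp⟩
  | succ n ih =>
    have h1 := ih.add (h n) (by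
      have := hind.indepFun_finsetSum_of_notMem hm (s := Finset.range n) (i := n) (by simp)
      convert this using 1
      ext ω; simp)
    simp only [Finset.sum_range_succ]
    refine h1.mono (le_of_eq ?_)
    push_cast; ring

/-- The mean of a batch of independent samples. -/
lemma batchMean_sub [IsProbabilityMeasure P] [CompleteSpace V] [MeasurableSpace V] [BorelSpace V]
    [SecondCountableTopology V] {Ξ : Type*} [MeasurableSpace Ξ] {Q : Measure Ξ} {u : Ξ → V} {m : V}
    (h : IsNoise Q (fun z => u z - m) v) (hu : Measurable u) {ξ : ℕ → Ω → Ξ}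
    (hξ : ∀ i, Measurable (ξ i)) (hlaw : ∀ i, P.map (ξ i) = Q) (hind : iIndepFun ξ P)
    {n : ℕ} (hn : 0 < n) :
    IsNoise P (fun ω => batchMean n (fun i => u (ξ i ω)) - m) (v / n) := by
  have h1 := (sum_range (X := fun i ω => u (ξ i ω) - m) (fun i => h.comp (hξ i) (hlaw i))
    (fun i => (hu.comp (hξ i)).sub_const m)
    (hind.comp (fun _ z => u z - m) fun _ => hu.sub_const m) n).const_smul (n : ℝ)⁻¹
  have hn' : (n : ℝ) ≠ 0 := by positivity
  have e : (fun ω => batchMean n (fun i => u (ξ i ω)) - m)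
      = fun ω => (n : ℝ)⁻¹ • ∑ i ∈ Finset.range n, (u (ξ i ω) - m) := by
    ext1 ω
    rw [Finset.sum_sub_distrib, smul_sub, batchMean]
    simp [← Nat.cast_smul_eq_nsmul ℝ, smul_smul, hn']
  rw [e]
  refine h1.mono (le_of_eq ?_)
  field_simp

end IsNoise

lemma measurable_batchMean {Z : Type*} [MeasurableSpace Z] [MeasurableSpace V] [BorelSpace V]
    [SecondCountableTopology V] (n : ℕ) {u : ℕ → Z → V} (h : ∀ i, Measurable (u i)) :
    Measurable fun z => batchMean n fun i => u i z := by
  unfold batchMean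
  exact (Finset.measurable_sum _ fun i _ => h i).const_smul _

end Probability

/-! ### Partial gradients, mixed derivatives and Hessians as blocks of joint derivatives. -/

section PartialDerivatives

open scoped RealInnerProductSpace

variable {p q : ℕ} {φ : Euc p → Euc q → ℝ}

lemma inner_gradX_of_hasFDerivAt {D : Euc p × Euc q →L[ℝ] ℝ} {x : Euc p} {y : Euc q}
    (h : HasFDerivAt (fun z : Euc p × Euc q => φ z.1 z.2) D (x, y)) (u : Euc p) :
    ⟪gradX φ x y, u⟫ = D (u, 0) := by
  have h1 : HasFDerivAt (fun x' => φ x' y) (D.comp (ContinuousLinearMap.inl ℝ _ _)) x :=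
    h.comp (f := fun x' => (x', y)) x (hasFDerivAt_prodMk_left x y)
  rw [gradX, inner_gradient_left, h1.fderiv]
  simp

lemma inner_gradY_of_hasFDerivAt {D : Euc p × Euc q →L[ℝ] ℝ} {x : Euc p} {y : Euc q}
    (h : HasFDerivAt (fun z : Euc p × Euc q => φ z.1 z.2) D (x, y)) (u : Euc q) :
    ⟪gradY φ x y, u⟫ = D (0, u) := by
  have h1 : HasFDerivAt (fun y' => φ x y') (D.comp (ContinuousLinearMap.inr ℝ _ _)) y :=
    h.comp (f := fun y' => (x, y')) y (hasFDerivAt_prodMk_right x y)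
  rw [gradY, inner_gradient_left, h1.fderiv]
  simp

lemma apply_eq_inner_gradX_add_inner_gradY {D : Euc p × Euc q →L[ℝ] ℝ} {x : Euc p} {y : Euc q}
    (h : HasFDerivAt (fun z : Euc p × Euc q => φ z.1 z.2) D (x, y)) (u : Euc p × Euc q) :
    D u = ⟪gradX φ x y, u.1⟫ + ⟪gradY φ x y, u.2⟫ := by
  rw [inner_gradX_of_hasFDerivAt h, inner_gradY_of_hasFDerivAt h, ← map_add]
  simp

lemma adjoint_jacXY (x : Euc p) (y : Euc q) :
    ContinuousLinearMap.adjoint (jacXY φ x y) = fderiv ℝ (fun x' => gradY φ x' y) x := by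
  rw [jacXY, ContinuousLinearMap.adjoint_adjoint]

/-- The partial gradient is the Riesz image of the joint derivative restricted to the
`y`-directions, hence a continuous linear function of that derivative. -/
lemma contDiff_gradY (h : ContDiff ℝ 2 fun z : Euc p × Euc q => φ z.1 z.2) :
    ContDiff ℝ 1 fun z : Euc p × Euc q => gradY φ z.1 z.2 := by
  have h1 : ContDiff ℝ 1 (fderiv ℝ fun z : Euc p × Euc q => φ z.1 z.2) :=
    h.fderiv_right (by norm_num)
  have h2 : (fun z : Euc p × Euc q => gradY φ z.1 z.2) = fun z =>
      (InnerProductSpace.toDual ℝ (Euc q)).symm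
        ((fderiv ℝ (fun z : Euc p × Euc q => φ z.1 z.2) z).comp
          (ContinuousLinearMap.inr ℝ (Euc p) (Euc q))) := by
    ext1 z
    refine ext_inner_right ℝ fun u => ?_
    rw [inner_gradY_of_hasFDerivAt ((h.differentiable two_ne_zero) _).hasFDerivAt]
    simp
  rw [h2]
  exact (InnerProductSpace.toDual ℝ (Euc q)).symm.contDiff.comp (h1.clm_comp contDiff_const)

/-- Any joint derivative is determined by its two blocks; the adjoint undoes the transpose in
`jacXY`. Applied to the derivative obtained under the integral, it identifies `jacXY B.g` and
`hessYY B.g` as means of sample matrices. -/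
lemma hasFDerivAt_gradY {ψ' : Euc p × Euc q →L[ℝ] Euc q} {x : Euc p} {y : Euc q}
    (h : HasFDerivAt (fun z : Euc p × Euc q => gradY φ z.1 z.2) ψ' (x, y)) :
    ψ' = (ContinuousLinearMap.adjoint (jacXY φ x y)).comp (ContinuousLinearMap.fst ℝ _ _)
      + (hessYY φ x y).comp (ContinuousLinearMap.snd ℝ _ _) := by
  have h1 : HasFDerivAt (fun x' => gradY φ x' y) (ψ'.comp (ContinuousLinearMap.inl ℝ _ _)) x :=
    h.comp (f := fun x' => (x', y)) x (hasFDerivAt_prodMk_left x y)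
  have h2 : HasFDerivAt (fun y' => gradY φ x y') (ψ'.comp (ContinuousLinearMap.inr ℝ _ _)) y :=
    h.comp (f := fun y' => (x, y')) y (hasFDerivAt_prodMk_right x y)
  rw [adjoint_jacXY, hessYY, h1.fderiv, h2.fderiv]
  ext u
  all_goals simp [show ((0 : Euc p), (0 : Euc q)) = 0 from rfl]

/-- Symmetry of the second derivative, transported through the Riesz isometry. -/
lemma hessYY_symm (h : ContDiff ℝ 2 fun z : Euc p × Euc q => φ z.1 z.2) (x : Euc p) (y : Euc q)
    (u w : Euc q) : ⟪hessYY φ x y u, w⟫ = ⟪u, hessYY φ x y w⟫ := by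
  have h0 : ContDiff ℝ 2 (φ x) := h.comp (contDiff_prodMk_right x)
  have hsym := h0.contDiffAt.isSymmSndFDerivAt (x := y) (by simp)
  have hd : DifferentiableAt ℝ (fderiv ℝ (φ x)) y :=
    ((h0.fderiv_right (m := 1) (by norm_num)).differentiable one_ne_zero) y
  have key : ∀ u w, ⟪hessYY φ x y u, w⟫ = fderiv ℝ (fderiv ℝ (φ x)) y u w := by
    intro u w
    have h1 : HasFDerivAt (fun y' => gradY φ x y')
        ((InnerProductSpace.toDual ℝ (Euc q)).symm.toContinuousLinearEquiv.toContinuousLinearMap.comp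
          (fderiv ℝ (fderiv ℝ (φ x)) y)) y :=
      ((InnerProductSpace.toDual ℝ (Euc q)).symm.toContinuousLinearEquiv.toContinuousLinearMap.hasFDerivAt).comp
        y hd.hasFDerivAt
    rw [hessYY, h1.fderiv]
    simp
  rw [key, real_inner_comm, key, hsym]

lemma norm_jacXY_le {x : Euc p} {y : Euc q} {K : ℝ} (hK : 0 ≤ K)
    (h : ∀ x', ‖gradY φ x' y - gradY φ x y‖ ≤ K * ‖x' - x‖) : ‖jacXY φ x y‖ ≤ K := by
  rw [jacXY, LinearIsometryEquiv.norm_map]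
  exact norm_fderiv_le_of_lip' ℝ hK (Filter.Eventually.of_forall h)

lemma norm_hessYY_le {x : Euc p} {y : Euc q} {K : ℝ} (hK : 0 ≤ K)
    (h : ∀ y', ‖gradY φ x y' - gradY φ x y‖ ≤ K * ‖y' - y‖) : ‖hessYY φ x y‖ ≤ K :=
  norm_fderiv_le_of_lip' ℝ hK (Filter.Eventually.of_forall h)

lemma norm_gradX_le {x : Euc p} {y : Euc q} {K : ℝ} (hK : 0 ≤ K)
    (h : ∀ x', ‖φ x' y - φ x y‖ ≤ K * ‖x' - x‖) : ‖gradX φ x y‖ ≤ K := by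
  rw [gradX, gradient, LinearIsometryEquiv.norm_map]
  exact norm_fderiv_le_of_lip' ℝ hK (Filter.Eventually.of_forall h)

lemma norm_gradY_le {x : Euc p} {y : Euc q} {K : ℝ} (hK : 0 ≤ K)
    (h : ∀ y', ‖φ x y' - φ x y‖ ≤ K * ‖y' - y‖) : ‖gradY φ x y‖ ≤ K := by
  rw [gradY, gradient, LinearIsometryEquiv.norm_map]
  exact norm_fderiv_le_of_lip' ℝ hK (Filter.Eventually.of_forall h)

end PartialDerivatives

/-! ### Integrability and Lipschitz bounds for expected derivatives. -/

section Integrals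

lemma MeasureTheory.AEStronglyMeasurable.comp_fst_add_comp_snd {Ξ U V W : Type*}
    [MeasurableSpace Ξ] [NormedAddCommGroup U] [NormedSpace ℝ U] [NormedAddCommGroup V]
    [NormedSpace ℝ V] [NormedAddCommGroup W] [NormedSpace ℝ W] {Q : Measure Ξ}
    {a : Ξ → U →L[ℝ] W} {b : Ξ → V →L[ℝ] W} (ha : AEStronglyMeasurable a Q)
    (hb : AEStronglyMeasurable b Q) :
    AEStronglyMeasurable (fun ξ => (a ξ).comp (ContinuousLinearMap.fst ℝ U V)
      + (b ξ).comp (ContinuousLinearMap.snd ℝ U V)) Q := by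
  have h1 : Continuous fun T : U →L[ℝ] W => T.comp (ContinuousLinearMap.fst ℝ U V) := by fun_prop
  have h2 : Continuous fun T : V →L[ℝ] W => T.comp (ContinuousLinearMap.snd ℝ U V) := by fun_prop
  exact (h1.comp_aestronglyMeasurable ha).add (h2.comp_aestronglyMeasurable hb)

lemma norm_integral_sub_integral_le {Ξ V : Type*} [MeasurableSpace Ξ] [NormedAddCommGroup V]
    [NormedSpace ℝ V] {Q : Measure Ξ} [IsProbabilityMeasure Q] {u w : Ξ → V} {C : ℝ}
    (hu : Integrable u Q) (hw : Integrable w Q) (h : ∀ ξ, ‖u ξ - w ξ‖ ≤ C) :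
    ‖∫ ξ, u ξ ∂Q - ∫ ξ, w ξ ∂Q‖ ≤ C := by
  rw [← integral_sub hu hw]
  simpa using norm_integral_le_of_norm_le_const (Filter.Eventually.of_forall h) (μ := Q)

lemma SecondMomentLE.integrable {Ξ V : Type*} [MeasurableSpace Ξ] [NormedAddCommGroup V]
    {Q : Measure Ξ} [IsProbabilityMeasure Q] {u : Ξ → V} {m : V} {σ : ℝ}
    (h : SecondMomentLE Q (fun ξ => u ξ - m) σ) : Integrable u Q := by
  have := (h.1.integrable one_le_two).add (integrable_const m)
  refine this.congr (Filter.Eventually.of_forall fun ξ => ?_)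
  simp

end Integrals

/-- Admissible problem constants: `0 < μ ≤ L` and `0 ≤ M, τ, ρ`. -/
structure Consts.Admissible (c : Consts) : Prop where
  μ_pos : 0 < c.μ
  μ_le : c.μ ≤ c.L
  M_nonneg : 0 ≤ c.M
  τ_nonneg : 0 ≤ c.τ
  ρ_nonneg : 0 ≤ c.ρ

lemma Consts.Admissible.L_pos {c : Consts} (hc : c.Admissible) : 0 < c.L :=
  hc.μ_pos.trans_le hc.μ_le

namespace Bilevel.Assumptions

open scoped RealInnerProductSpace

variable {p q : ℕ} {ΞF ΞG : Type*} [MeasurableSpace ΞF] [MeasurableSpace ΞG]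
  {B : Bilevel p q ΞF ΞG} {c : Consts} {s : Noise}

/-! ### Expected gradients -/

lemma integrable_gradX_F (hB : B.Assumptions c s) (x : Euc p) (y : Euc q) :
    Integrable (fun ξ => gradX (B.F ξ) x y) B.PF :=
  have := hB.probF; (hB.varGradXF x y).integrable

lemma integrable_gradY_F (hB : B.Assumptions c s) (x : Euc p) (y : Euc q) :
    Integrable (fun ξ => gradY (B.F ξ) x y) B.PF :=
  have := hB.probF; (hB.varGradYF x y).integrable

lemma integrable_gradY_G (hB : B.Assumptions c s) (x : Euc p) (y : Euc q) :
    Integrable (fun ζ => gradY (B.G ζ) x y) B.PG :=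
  have := hB.probG; (hB.varGradYG x y).integrable

lemma integrable_jacXY_G (hB : B.Assumptions c s) (x : Euc p) (y : Euc q) :
    Integrable (fun ζ => jacXY (B.G ζ) x y) B.PG :=
  have := hB.probG; (hB.varJacG x y).integrable

lemma integrable_hessYY_G (hB : B.Assumptions c s) (x : Euc p) (y : Euc q) :
    Integrable (fun ζ => hessYY (B.G ζ) x y) B.PG :=
  have := hB.probG; (hB.varHessG x y).integrable

lemma hasFDerivAt_F (hB : B.Assumptions c s) (ξ : ΞF) (z : Euc p × Euc q) :
    HasFDerivAt (fun z : Euc p × Euc q => B.F ξ z.1 z.2)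
      ((innerSL ℝ (gradX (B.F ξ) z.1 z.2)).comp (ContinuousLinearMap.fst ℝ _ _)
        + (innerSL ℝ (gradY (B.F ξ) z.1 z.2)).comp (ContinuousLinearMap.snd ℝ _ _)) z := by
  have h := ((hB.smoothF ξ).differentiable one_ne_zero z).hasFDerivAt
  refine h.congr_fderiv ?_
  ext u
  · simpa using apply_eq_inner_gradX_add_inner_gradY h (u, 0)
  · simpa using apply_eq_inner_gradX_add_inner_gradY h (0, u)

/-- The product type carries the sup norm while the assumptions use the sum. The factor `2` enters
only domination and continuity arguments, never the constants of the rate. -/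
lemma norm_sub_add_norm_sub_le (z z' : Euc p × Euc q) :
    ‖z.1 - z'.1‖ + ‖z.2 - z'.2‖ ≤ 2 * ‖z - z'‖ := by
  have h1 := norm_fst_le (z - z')
  have h2 := norm_snd_le (z - z')
  simp only [Prod.fst_sub, Prod.snd_sub] at h1 h2
  linarith

/-- Differentiation under the integral, dominated by the Lipschitz constant of the samples. The
joint derivative is needed for the chain rule along `x ↦ (x, y*(x))`. -/
lemma integrable_and_hasFDerivAt_f (hB : B.Assumptions c s) (hc : c.Admissible)
    (z : Euc p × Euc q) :
    Integrable (fun ξ => (innerSL ℝ (gradX (B.F ξ) z.1 z.2)).comp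
        (ContinuousLinearMap.fst ℝ (Euc p) (Euc q))
      + (innerSL ℝ (gradY (B.F ξ) z.1 z.2)).comp
        (ContinuousLinearMap.snd ℝ (Euc p) (Euc q))) B.PF ∧
    HasFDerivAt (fun z : Euc p × Euc q => B.f z.1 z.2)
      (∫ ξ, ((innerSL ℝ (gradX (B.F ξ) z.1 z.2)).comp
        (ContinuousLinearMap.fst ℝ (Euc p) (Euc q))
      + (innerSL ℝ (gradY (B.F ξ) z.1 z.2)).comp
        (ContinuousLinearMap.snd ℝ (Euc p) (Euc q))) ∂B.PF) z := by
  have := hB.probF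
  refine hasFDerivAt_integral_of_dominated_loc_of_lip' (s := Set.univ)
    (bound := fun _ => 2 * c.M) (F := fun (z : Euc p × Euc q) ξ => B.F ξ z.1 z.2) Filter.univ_mem
    (fun z _ => (hB.measF z.1 z.2).aestronglyMeasurable) (hB.intF _ _) ?_ ?_ (integrable_const _)
    (Filter.Eventually.of_forall fun ξ => hB.hasFDerivAt_F ξ z)
  · exact ((innerSL ℝ).continuous.comp_aestronglyMeasurable
      (hB.integrable_gradX_F z.1 z.2).1).comp_fst_add_comp_snd
      ((innerSL ℝ).continuous.comp_aestronglyMeasurable (hB.integrable_gradY_F z.1 z.2).1)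
  · refine Filter.Eventually.of_forall fun ξ z' _ => ?_
    calc ‖B.F ξ z'.1 z'.2 - B.F ξ z.1 z.2‖ ≤ c.M * (‖z'.1 - z.1‖ + ‖z'.2 - z.2‖) :=
          hB.lipF ξ _ _ _ _
      _ ≤ c.M * (2 * ‖z' - z‖) :=
          mul_le_mul_of_nonneg_left (norm_sub_add_norm_sub_le _ _) hc.M_nonneg
      _ = _ := by ring

lemma gradX_f (hB : B.Assumptions c s) (hc : c.Admissible) (x : Euc p) (y : Euc q) :
    gradX B.f x y = ∫ ξ, gradX (B.F ξ) x y ∂B.PF := by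
  obtain ⟨hi, hd⟩ := hB.integrable_and_hasFDerivAt_f hc (x, y)
  refine ext_inner_right ℝ fun u => ?_
  rw [inner_gradX_of_hasFDerivAt hd, ContinuousLinearMap.integral_apply hi, real_inner_comm,
    ← integral_inner (hB.integrable_gradX_F x y)]
  refine integral_congr_ae (Filter.Eventually.of_forall fun ξ => ?_)
  simp [real_inner_comm]

lemma gradY_f (hB : B.Assumptions c s) (hc : c.Admissible) (x : Euc p) (y : Euc q) :
    gradY B.f x y = ∫ ξ, gradY (B.F ξ) x y ∂B.PF := by
  obtain ⟨hi, hd⟩ := hB.integrable_and_hasFDerivAt_f hc (x, y)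
  refine ext_inner_right ℝ fun u => ?_
  rw [inner_gradY_of_hasFDerivAt hd, ContinuousLinearMap.integral_apply hi, real_inner_comm,
    ← integral_inner (hB.integrable_gradY_F x y)]
  refine integral_congr_ae (Filter.Eventually.of_forall fun ξ => ?_)
  simp [real_inner_comm]

lemma lipGradXf (hB : B.Assumptions c s) (hc : c.Admissible) (x x' : Euc p) (y y' : Euc q) :
    ‖gradX B.f x y - gradX B.f x' y'‖ ≤ c.L * (‖x - x'‖ + ‖y - y'‖) := by
  have := hB.probF
  rw [hB.gradX_f hc, hB.gradX_f hc]
  exact norm_integral_sub_integral_le (hB.integrable_gradX_F x y) (hB.integrable_gradX_F x' y')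
    fun ξ => hB.lipGradXF ξ x x' y y'

lemma lipGradYf (hB : B.Assumptions c s) (hc : c.Admissible) (x x' : Euc p) (y y' : Euc q) :
    ‖gradY B.f x y - gradY B.f x' y'‖ ≤ c.L * (‖x - x'‖ + ‖y - y'‖) := by
  have := hB.probF
  rw [hB.gradY_f hc, hB.gradY_f hc]
  exact norm_integral_sub_integral_le (hB.integrable_gradY_F x y) (hB.integrable_gradY_F x' y')
    fun ξ => hB.lipGradYF ξ x x' y y'

lemma norm_gradX_F_le (hB : B.Assumptions c s) (hc : c.Admissible) (ξ : ΞF) (x : Euc p)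
    (y : Euc q) : ‖gradX (B.F ξ) x y‖ ≤ c.M :=
  norm_gradX_le hc.M_nonneg fun x' => by simpa using hB.lipF ξ x' x y y

lemma norm_gradY_F_le (hB : B.Assumptions c s) (hc : c.Admissible) (ξ : ΞF) (x : Euc p)
    (y : Euc q) : ‖gradY (B.F ξ) x y‖ ≤ c.M :=
  norm_gradY_le hc.M_nonneg fun y' => by simpa using hB.lipF ξ x x y' y

lemma norm_gradX_f_le (hB : B.Assumptions c s) (hc : c.Admissible) (x : Euc p) (y : Euc q) :
    ‖gradX B.f x y‖ ≤ c.M := by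
  have := hB.probF
  rw [hB.gradX_f hc]
  simpa using norm_integral_le_of_norm_le_const (μ := B.PF)
    (Filter.Eventually.of_forall fun ξ => hB.norm_gradX_F_le hc ξ x y)

lemma norm_gradY_f_le (hB : B.Assumptions c s) (hc : c.Admissible) (x : Euc p) (y : Euc q) :
    ‖gradY B.f x y‖ ≤ c.M := by
  have := hB.probF
  rw [hB.gradY_f hc]
  simpa using norm_integral_le_of_norm_le_const (μ := B.PF)
    (Filter.Eventually.of_forall fun ξ => hB.norm_gradY_F_le hc ξ x y)

/-! ### The lower-level objective -/

lemma differentiable_G (hB : B.Assumptions c s) (ζ : ΞG) (x : Euc p) :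
    Differentiable ℝ (B.G ζ x) :=
  ((hB.smoothG ζ).comp (contDiff_prodMk_right x)).differentiable two_ne_zero

lemma hasGradientAt_g (hB : B.Assumptions c s) (hc : c.Admissible) (x : Euc p) (y : Euc q) :
    HasGradientAt (B.g x) (∫ ζ, gradY (B.G ζ) x y ∂B.PG) y := by
  have := hB.probG
  have hi := hB.integrable_gradY_G x y
  -- `G` need not be globally Lipschitz in `y`; on the unit ball its gradient is at most its value
  -- at the center plus `L`, which is integrable.
  have key := hasFDerivAt_integral_of_dominated_loc_of_lip' (s := Metric.ball y 1)
    (bound := fun ζ => ‖gradY (B.G ζ) x y‖ + c.L) (F := fun y ζ => B.G ζ x y)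
    (F' := fun ζ => InnerProductSpace.toDual ℝ (Euc q) (gradY (B.G ζ) x y)) (μ := B.PG)
    (Metric.ball_mem_nhds y one_pos)
    (fun y _ => (hB.measG x y).aestronglyMeasurable) (hB.intG x y) ?_ ?_
    (hi.norm.add (integrable_const _))
    (Filter.Eventually.of_forall fun ζ => (hB.differentiable_G ζ x y).hasGradientAt.hasFDerivAt)
  · refine HasFDerivAt.congr_fderiv key.2 ?_
    exact ContinuousLinearMap.integral_comp_comm
      (InnerProductSpace.toDual ℝ (Euc q)).toContinuousLinearEquiv.toContinuousLinearMap hi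
  · exact (InnerProductSpace.toDual ℝ (Euc q)).continuous.comp_aestronglyMeasurable hi.1
  · refine Filter.Eventually.of_forall fun ζ y' hy' => ?_
    refine (convex_ball y 1).norm_image_sub_le_of_norm_fderiv_le (𝕜 := ℝ)
      (fun w _ => hB.differentiable_G ζ x w) (fun w hw => ?_) (Metric.mem_ball_self one_pos) hy'
    have h1 : ‖fderiv ℝ (B.G ζ x) w‖ = ‖gradY (B.G ζ) x w‖ := by
      rw [gradY, gradient, LinearIsometryEquiv.norm_map]
    have h2 := hB.lipGradYG ζ x x w y
    have h3 := norm_le_insert' (gradY (B.G ζ) x w) (gradY (B.G ζ) x y)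
    have h4 : c.L * ‖w - y‖ ≤ c.L * 1 := by
      have := hc.L_pos.le
      gcongr
      rw [← dist_eq_norm]; exact (Metric.mem_ball.1 hw).le
    simp only [sub_self, norm_zero, zero_add] at h2
    rw [h1]; linarith

lemma gradY_g (hB : B.Assumptions c s) (hc : c.Admissible) (x : Euc p) (y : Euc q) :
    gradY B.g x y = ∫ ζ, gradY (B.G ζ) x y ∂B.PG :=
  (hB.hasGradientAt_g hc x y).gradient

lemma differentiable_g (hB : B.Assumptions c s) (hc : c.Admissible) (x : Euc p) :
    Differentiable ℝ (B.g x) := fun y => (hB.hasGradientAt_g hc x y).differentiableAt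

lemma lipGradYg (hB : B.Assumptions c s) (hc : c.Admissible) (x x' : Euc p) (y y' : Euc q) :
    ‖gradY B.g x y - gradY B.g x' y'‖ ≤ c.L * (‖x - x'‖ + ‖y - y'‖) := by
  have := hB.probG
  rw [hB.gradY_g hc, hB.gradY_g hc]
  exact norm_integral_sub_integral_le (hB.integrable_gradY_G x y) (hB.integrable_gradY_G x' y')
    fun ξ => hB.lipGradYG ξ x x' y y'

lemma hasFDerivAt_gradY_G (hB : B.Assumptions c s) (ζ : ΞG) (z : Euc p × Euc q) :
    HasFDerivAt (fun z : Euc p × Euc q => gradY (B.G ζ) z.1 z.2)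
      ((ContinuousLinearMap.adjoint (jacXY (B.G ζ) z.1 z.2)).comp (ContinuousLinearMap.fst ℝ _ _)
        + (hessYY (B.G ζ) z.1 z.2).comp (ContinuousLinearMap.snd ℝ _ _)) z := by
  have h := ((contDiff_gradY (hB.smoothG ζ)).differentiable one_ne_zero z).hasFDerivAt
  exact h.congr_fderiv (hasFDerivAt_gradY h)

/-- Second differentiation under the integral. The sample gradients are globally Lipschitz, so here
a constant dominates. -/
lemma integrable_and_hasFDerivAt_gradY_g (hB : B.Assumptions c s) (hc : c.Admissible)
    (z : Euc p × Euc q) :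
    Integrable (fun ζ => (ContinuousLinearMap.adjoint (jacXY (B.G ζ) z.1 z.2)).comp
        (ContinuousLinearMap.fst ℝ (Euc p) (Euc q))
      + (hessYY (B.G ζ) z.1 z.2).comp (ContinuousLinearMap.snd ℝ (Euc p) (Euc q))) B.PG ∧
    HasFDerivAt (fun z : Euc p × Euc q => gradY B.g z.1 z.2)
      (∫ ζ, ((ContinuousLinearMap.adjoint (jacXY (B.G ζ) z.1 z.2)).comp
        (ContinuousLinearMap.fst ℝ (Euc p) (Euc q))
      + (hessYY (B.G ζ) z.1 z.2).comp (ContinuousLinearMap.snd ℝ (Euc p) (Euc q))) ∂B.PG) z := by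
  have := hB.probG
  have e : (fun z : Euc p × Euc q => gradY B.g z.1 z.2)
      = fun z => ∫ ζ, gradY (B.G ζ) z.1 z.2 ∂B.PG := by
    ext1 z; exact hB.gradY_g hc _ _
  rw [e]
  refine hasFDerivAt_integral_of_dominated_loc_of_lip' (s := Set.univ)
    (bound := fun _ => 2 * c.L) (F := fun (z : Euc p × Euc q) ζ => gradY (B.G ζ) z.1 z.2) Filter.univ_mem
    (fun z _ => (hB.integrable_gradY_G z.1 z.2).1) (hB.integrable_gradY_G _ _) ?_ ?_
    (integrable_const _) (Filter.Eventually.of_forall fun ζ => hB.hasFDerivAt_gradY_G ζ z)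
  · exact ((LinearIsometryEquiv.continuous _).comp_aestronglyMeasurable
      (hB.integrable_jacXY_G z.1 z.2).1).comp_fst_add_comp_snd (hB.integrable_hessYY_G z.1 z.2).1
  · refine Filter.Eventually.of_forall fun ζ z' _ => ?_
    calc ‖gradY (B.G ζ) z'.1 z'.2 - gradY (B.G ζ) z.1 z.2‖
        ≤ c.L * (‖z'.1 - z.1‖ + ‖z'.2 - z.2‖) := hB.lipGradYG ζ _ _ _ _
      _ ≤ c.L * (2 * ‖z' - z‖) :=
          mul_le_mul_of_nonneg_left (norm_sub_add_norm_sub_le _ _) hc.L_pos.le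
      _ = _ := by ring

lemma hasFDerivAt_gradY_g (hB : B.Assumptions c s) (hc : c.Admissible) (z : Euc p × Euc q) :
    HasFDerivAt (fun z : Euc p × Euc q => gradY B.g z.1 z.2)
      ((ContinuousLinearMap.adjoint (jacXY B.g z.1 z.2)).comp (ContinuousLinearMap.fst ℝ _ _)
        + (hessYY B.g z.1 z.2).comp (ContinuousLinearMap.snd ℝ _ _)) z := by
  have h := (hB.integrable_and_hasFDerivAt_gradY_g hc z).2
  exact h.congr_fderiv (hasFDerivAt_gradY h)

lemma jacXY_g (hB : B.Assumptions c s) (hc : c.Admissible) (x : Euc p) (y : Euc q) :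
    jacXY B.g x y = ∫ ζ, jacXY (B.G ζ) x y ∂B.PG := by
  obtain ⟨hi, hd⟩ := hB.integrable_and_hasFDerivAt_gradY_g hc (x, y)
  have hJ := hB.integrable_jacXY_G x y
  refine ContinuousLinearMap.ext fun v => ext_inner_right ℝ fun u => ?_
  have h1 : ContinuousLinearMap.adjoint (jacXY B.g x y) u
      = ∫ ζ, ContinuousLinearMap.adjoint (jacXY (B.G ζ) x y) u ∂B.PG := by
    have := congrArg (fun T => T (u, 0)) (hasFDerivAt_gradY hd)
    simp only [add_apply, ContinuousLinearMap.comp_apply, ContinuousLinearMap.coe_fst',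
      ContinuousLinearMap.coe_snd', map_zero, add_zero] at this
    rw [← this, ContinuousLinearMap.integral_apply hi]
    simp
  have h2 : Integrable (fun ζ => ContinuousLinearMap.adjoint (jacXY (B.G ζ) x y) u) B.PG := by
    have := hi.apply_continuousLinearMap (u, 0)
    simpa using this
  rw [← ContinuousLinearMap.adjoint_inner_right, h1, ← integral_inner h2,
    ContinuousLinearMap.integral_apply hJ, real_inner_comm,
    ← integral_inner (hJ.apply_continuousLinearMap v)]
  refine integral_congr_ae (Filter.Eventually.of_forall fun ζ => ?_)
  simp only [ContinuousLinearMap.adjoint_inner_right, real_inner_comm]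

lemma hessYY_g (hB : B.Assumptions c s) (hc : c.Admissible) (x : Euc p) (y : Euc q) :
    hessYY B.g x y = ∫ ζ, hessYY (B.G ζ) x y ∂B.PG := by
  obtain ⟨hi, hd⟩ := hB.integrable_and_hasFDerivAt_gradY_g hc (x, y)
  have hH := hB.integrable_hessYY_G x y
  refine ContinuousLinearMap.ext fun u => ?_
  have := congrArg (fun T => T (0, u)) (hasFDerivAt_gradY hd)
  simp only [add_apply, ContinuousLinearMap.comp_apply, ContinuousLinearMap.coe_fst',
    ContinuousLinearMap.coe_snd', map_zero, zero_add] at this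
  rw [← this, ContinuousLinearMap.integral_apply hi, ContinuousLinearMap.integral_apply hH]
  simp

lemma lipJacg (hB : B.Assumptions c s) (hc : c.Admissible) (x x' : Euc p) (y y' : Euc q) :
    ‖jacXY B.g x y - jacXY B.g x' y'‖ ≤ c.τ * (‖x - x'‖ + ‖y - y'‖) := by
  have := hB.probG
  rw [hB.jacXY_g hc, hB.jacXY_g hc]
  exact norm_integral_sub_integral_le (hB.integrable_jacXY_G x y) (hB.integrable_jacXY_G x' y')
    fun ξ => hB.lipJacG ξ x x' y y'

lemma lipHessg (hB : B.Assumptions c s) (hc : c.Admissible) (x x' : Euc p) (y y' : Euc q) :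
    ‖hessYY B.g x y - hessYY B.g x' y'‖ ≤ c.ρ * (‖x - x'‖ + ‖y - y'‖) := by
  have := hB.probG
  rw [hB.hessYY_g hc, hB.hessYY_g hc]
  exact norm_integral_sub_integral_le (hB.integrable_hessYY_G x y) (hB.integrable_hessYY_G x' y')
    fun ξ => hB.lipHessG ξ x x' y y'

lemma norm_jacXY_g_le (hB : B.Assumptions c s) (hc : c.Admissible) (x : Euc p)
    (y : Euc q) : ‖jacXY B.g x y‖ ≤ c.L :=
  norm_jacXY_le hc.L_pos.le fun x' => by simpa using hB.lipGradYg hc x' x y y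

lemma norm_hessYY_G_le (hB : B.Assumptions c s) (hc : c.Admissible) (ζ : ΞG) (x : Euc p)
    (y : Euc q) : ‖hessYY (B.G ζ) x y‖ ≤ c.L :=
  norm_hessYY_le hc.L_pos.le fun y' => by simpa using hB.lipGradYG ζ x x y' y

lemma norm_hessYY_g_le (hB : B.Assumptions c s) (hc : c.Admissible) (x : Euc p)
    (y : Euc q) : ‖hessYY B.g x y‖ ≤ c.L :=
  norm_hessYY_le hc.L_pos.le fun y' => by simpa using hB.lipGradYg hc x x y' y

lemma le_inner_gradY_G (hB : B.Assumptions c s) (ζ : ΞG) (x : Euc p) (y y' : Euc q) :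
    c.μ * ‖y' - y‖ ^ 2 ≤ ⟪gradY (B.G ζ) x y' - gradY (B.G ζ) x y, y' - y⟫ :=
  (hB.strong ζ x).le_inner_gradient_sub (hB.differentiable_G ζ x) y y'

lemma le_inner_gradY_g (hB : B.Assumptions c s) (hc : c.Admissible) (x : Euc p) (y y' : Euc q) :
    c.μ * ‖y' - y‖ ^ 2 ≤ ⟪gradY B.g x y' - gradY B.g x y, y' - y⟫ := by
  have := hB.probG
  have hi := (hB.integrable_gradY_G x y').sub (hB.integrable_gradY_G x y)
  rw [hB.gradY_g hc, hB.gradY_g hc,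
    ← integral_sub (hB.integrable_gradY_G x y') (hB.integrable_gradY_G x y), real_inner_comm]
  have h1 := integral_inner (𝕜 := ℝ) hi (y' - y)
  simp only [Pi.sub_apply] at h1
  rw [← h1]
  calc c.μ * ‖y' - y‖ ^ 2 = ∫ _, c.μ * ‖y' - y‖ ^ 2 ∂B.PG := by simp
    _ ≤ _ := integral_mono (integrable_const _) (hi.const_inner _) fun ζ => by
      simpa [real_inner_comm] using hB.le_inner_gradY_G ζ x y y'

lemma le_inner_hessYY_G (hB : B.Assumptions c s) (ζ : ΞG) (x : Euc p) (y u : Euc q) :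
    c.μ * ‖u‖ ^ 2 ≤ ⟪hessYY (B.G ζ) x y u, u⟫ := by
  refine le_inner_of_hasFDerivAt_of_monotone (hB.le_inner_gradY_G ζ x y) ?_ u
  exact ((contDiff_gradY (hB.smoothG ζ)).comp
    (contDiff_prodMk_right x)).differentiable one_ne_zero y |>.hasFDerivAt

lemma hasFDerivAt_gradY_g_right (hB : B.Assumptions c s) (hc : c.Admissible) (x : Euc p)
    (y : Euc q) : HasFDerivAt (fun y' => gradY B.g x y') (hessYY B.g x y) y := by
  have := (hB.hasFDerivAt_gradY_g hc (x, y)).differentiableAt.comp (f := fun y' => (x, y')) y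
    (hasFDerivAt_prodMk_right x y).differentiableAt
  exact this.hasFDerivAt

lemma le_inner_hessYY_g (hB : B.Assumptions c s) (hc : c.Admissible) (x : Euc p) (y u : Euc q) :
    c.μ * ‖u‖ ^ 2 ≤ ⟪hessYY B.g x y u, u⟫ :=
  le_inner_of_hasFDerivAt_of_monotone (hB.le_inner_gradY_g hc x y)
    (hB.hasFDerivAt_gradY_g_right hc x y) u

/-- Symmetry is averaged from the samples, so no joint `C²` regularity of `g` has to be established.
-/
lemma hessYY_g_symm (hB : B.Assumptions c s) (hc : c.Admissible) (x : Euc p) (y u w : Euc q) :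
    ⟪hessYY B.g x y u, w⟫ = ⟪u, hessYY B.g x y w⟫ := by
  have hH := hB.integrable_hessYY_G x y
  rw [hB.hessYY_g hc, ContinuousLinearMap.integral_apply hH, ContinuousLinearMap.integral_apply hH,
    real_inner_comm, ← integral_inner (hH.apply_continuousLinearMap u),
    ← integral_inner (hH.apply_continuousLinearMap w)]
  refine integral_congr_ae (Filter.Eventually.of_forall fun ζ => ?_)
  simp only
  rw [real_inner_comm, hessYY_symm (hB.smoothG ζ)]

lemma norm_sub_smul_hessYY_g_le (hB : B.Assumptions c s) (hc : c.Admissible) {η : ℝ}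
    (hη : 0 ≤ η) (hηL : η * c.L ≤ 1) (x : Euc p) (y u : Euc q) :
    ‖u - η • hessYY B.g x y u‖ ≤ (1 - η * c.μ) * ‖u‖ :=
  norm_sub_smul_apply_le hc.μ_le hη hηL (hB.hessYY_g_symm hc x y) (hB.le_inner_hessYY_g hc x y)
    (fun u => (hessYY B.g x y).le_of_opNorm_le (hB.norm_hessYY_g_le hc x y) u) u

lemma norm_sub_smul_hessYY_G_le (hB : B.Assumptions c s) (hc : c.Admissible) {η : ℝ}
    (hη : 0 ≤ η) (hηL : η * c.L ≤ 1) (ζ : ΞG) (x : Euc p) (y u : Euc q) :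
    ‖u - η • hessYY (B.G ζ) x y u‖ ≤ (1 - η * c.μ) * ‖u‖ :=
  norm_sub_smul_apply_le hc.μ_le hη hηL (hessYY_symm (hB.smoothG ζ) x y)
    (hB.le_inner_hessYY_G ζ x y)
    (fun u => (hessYY (B.G ζ) x y).le_of_opNorm_le (hB.norm_hessYY_G_le hc ζ x y) u) u

/-- Gradient steps on `g(x, ·)` contract. -/
lemma norm_gradient_step_sub_le (hB : B.Assumptions c s) (hc : c.Admissible) {β : ℝ}
    (hβ : 0 ≤ β) (hβL : β * c.L ≤ 1) (x : Euc p) (y y' : Euc q) :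
    ‖(y' - β • gradY B.g x y') - (y - β • gradY B.g x y)‖ ≤ (1 - β * c.μ) * ‖y' - y‖ := by
  -- The step map has derivative `I - β∇²_y g`, of norm at most `1 - βμ` everywhere; the mean value
  -- inequality does the rest.
  have hd : ∀ w, HasFDerivAt (fun y' => y' - β • gradY B.g x y')
      (ContinuousLinearMap.id ℝ _ - β • hessYY B.g x w) w := fun w =>
    (hasFDerivAt_id w).sub ((hB.hasFDerivAt_gradY_g_right hc x w).const_smul β)
  refine convex_univ.norm_image_sub_le_of_norm_fderiv_le (𝕜 := ℝ)
    (fun w _ => (hd w).differentiableAt) (fun w _ => ?_) (Set.mem_univ y) (Set.mem_univ y')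
  rw [(hd w).fderiv]
  have : β * c.μ ≤ 1 := (mul_le_mul_of_nonneg_left hc.μ_le hβ).trans hβL
  exact ContinuousLinearMap.opNorm_le_bound _ (by linarith) fun u => by
    simpa using hB.norm_sub_smul_hessYY_g_le hc hβ hβL x w u

end Bilevel.Assumptions

namespace Bilevel.Assumptions

open scoped RealInnerProductSpace

variable {p q : ℕ} {ΞF ΞG : Type*} [MeasurableSpace ΞF] [MeasurableSpace ΞG]
  {B : Bilevel p q ΞF ΞG} {c : Consts} {s : Noise}

/-! ### The lower-level solution -/

lemma isMinimizer_of_gradY_eq_zero (hB : B.Assumptions c s) (hc : c.Admissible) {x : Euc p}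
    {y : Euc q} (h : gradY B.g x y = 0) (y' : Euc q) : B.g x y ≤ B.g x y' := by
  set w := y' - y
  have hder : ∀ t : ℝ, HasDerivAt (fun t : ℝ => B.g x (y + t • w))
      ⟪gradY B.g x (y + t • w), w⟫ t := by
    intro t
    rw [gradY, inner_gradient_left]
    exact hasDerivAt_comp_line y w t (hB.differentiable_g hc x _).hasFDerivAt
  have hmono : MonotoneOn (fun t : ℝ => B.g x (y + t • w)) (Set.Icc 0 1) := by
    refine monotoneOn_of_deriv_nonneg (convex_Icc 0 1)
      (fun t _ => (hder t).continuousAt.continuousWithinAt)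
      (fun t _ => (hder t).differentiableAt.differentiableWithinAt) fun t ht => ?_
    rw [interior_Icc] at ht
    rw [(hder t).deriv]
    have h1 := hB.le_inner_gradY_g hc x y (y + t • w)
    rw [h, sub_zero, add_sub_cancel_left, inner_smul_right] at h1
    have h2 : 0 ≤ t * ⟪gradY B.g x (y + t • w), w⟫ :=
      le_trans (mul_nonneg hc.μ_pos.le (sq_nonneg _)) h1
    exact nonneg_of_mul_nonneg_right h2 ht.1
  have := hmono (by simp) (by simp) zero_le_one
  simpa [w] using this

/-- The gradient step of length `1/L` is a contraction with factor `1 - μ/L`, and its Banach fixed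
point is a critical point. This supplies the existence that the choice operator in `yStar` depends
on. -/
lemma exists_gradY_eq_zero (hB : B.Assumptions c s) (hc : c.Admissible) (x : Euc p) :
    ∃ y, gradY B.g x y = 0 := by
  have hL := hc.L_pos
  have hκ : 0 < c.L⁻¹ * c.μ := mul_pos (inv_pos.2 hL) hc.μ_pos
  have hκ1 : c.L⁻¹ * c.μ ≤ 1 := by
    rw [inv_mul_eq_div]; exact div_le_one_of_le₀ hc.μ_le hL.le
  have hctr : ContractingWith (1 - c.L⁻¹ * c.μ).toNNReal
      fun y => y - c.L⁻¹ • gradY B.g x y := by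
    refine ⟨by rw [Real.toNNReal_lt_one]; linarith, LipschitzWith.of_dist_le' fun y' y => ?_⟩
    rw [dist_eq_norm, dist_eq_norm]
    exact hB.norm_gradient_step_sub_le hc (inv_nonneg.2 hL.le) (inv_mul_cancel₀ hL.ne').le x y y'
  refine ⟨hctr.fixedPoint, ?_⟩
  have h := hctr.fixedPoint_isFixedPt
  have h1 := sub_eq_self.1 h
  exact (smul_eq_zero.1 h1).resolve_left (inv_ne_zero hL.ne')

lemma yStar_isMinimizer (hB : B.Assumptions c s) (hc : c.Admissible) (x : Euc p) (y' : Euc q) :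
    B.g x (B.yStar x) ≤ B.g x y' := by
  obtain ⟨y, hy⟩ := hB.exists_gradY_eq_zero hc x
  exact Classical.epsilon_spec (p := fun y => ∀ y', B.g x y ≤ B.g x y')
    ⟨y, hB.isMinimizer_of_gradY_eq_zero hc hy⟩ y'

lemma gradY_g_yStar (hB : B.Assumptions c s) (hc : c.Admissible) (x : Euc p) :
    gradY B.g x (B.yStar x) = 0 := by
  have h : IsLocalMin (B.g x) (B.yStar x) :=
    Filter.Eventually.of_forall (hB.yStar_isMinimizer hc x)
  rw [gradY, gradient, h.fderiv_eq_zero, map_zero]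

lemma norm_sub_le_norm_gradY_g (hB : B.Assumptions c s) (hc : c.Admissible) (x : Euc p)
    (y y' : Euc q) : c.μ * ‖y' - y‖ ≤ ‖gradY B.g x y' - gradY B.g x y‖ := by
  rcases eq_or_ne (y' - y) 0 with h | h
  · rw [h]; simp
  refine le_of_mul_le_mul_right (a := ‖y' - y‖) ?_ (norm_pos_iff.2 h)
  calc c.μ * ‖y' - y‖ * ‖y' - y‖ = c.μ * ‖y' - y‖ ^ 2 := by ring
    _ ≤ _ := (hB.le_inner_gradY_g hc x y y').trans (real_inner_le_norm _ _)

/-- Strong monotonicity of `∇_y g(x, ·)` between `y*(x')` and `y*(x)`: the gradient vanishes at the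
latter, and at the former it differs from `∇_y g(x', y*(x')) = 0` by at most `L‖x - x'‖`. -/
lemma norm_yStar_sub_le (hB : B.Assumptions c s) (hc : c.Admissible) (x x' : Euc p) :
    ‖B.yStar x - B.yStar x'‖ ≤ c.L / c.μ * ‖x - x'‖ := by
  have h1 := hB.norm_sub_le_norm_gradY_g hc x (B.yStar x') (B.yStar x)
  have h2 := hB.lipGradYg hc x' x (B.yStar x') (B.yStar x')
  rw [hB.gradY_g_yStar hc, zero_sub, norm_neg] at h1
  rw [hB.gradY_g_yStar hc, zero_sub, norm_neg, sub_self, norm_zero, add_zero,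
    norm_sub_rev x' x] at h2
  rw [div_mul_eq_mul_div, le_div_iff₀ hc.μ_pos, mul_comm]
  exact h1.trans h2

/-! ### The solution of the linear system -/

lemma hessYY_g_vSol (hB : B.Assumptions c s) (hc : c.Admissible) (x : Euc p) (y : Euc q) :
    hessYY B.g x y (B.vSol x y) = gradY B.f x y :=
  apply_inverse_of_le_inner hc.μ_pos (hB.le_inner_hessYY_g hc x y) _

lemma norm_le_norm_hessYY_g (hB : B.Assumptions c s) (hc : c.Admissible) (x : Euc p)
    (y u : Euc q) : c.μ * ‖u‖ ≤ ‖hessYY B.g x y u‖ :=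
  norm_le_of_le_inner (hB.le_inner_hessYY_g hc x y) u

lemma norm_vSol_le (hB : B.Assumptions c s) (hc : c.Admissible) (x : Euc p) (y : Euc q) :
    ‖B.vSol x y‖ ≤ c.M / c.μ := by
  have h := hB.norm_le_norm_hessYY_g hc x y (B.vSol x y)
  rw [hB.hessYY_g_vSol hc] at h
  rw [le_div_iff₀ hc.μ_pos, mul_comm]
  exact h.trans (hB.norm_gradY_f_le hc x y)

lemma norm_vSol_sub_le (hB : B.Assumptions c s) (hc : c.Admissible) (x x' : Euc p)
    (y y' : Euc q) : ‖B.vSol x y - B.vSol x' y'‖ ≤ c.C1 * (‖x - x'‖ + ‖y - y'‖) := by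
  have hμ := hc.μ_pos
  set d := ‖x - x'‖ + ‖y - y'‖
  have h := hB.norm_le_norm_hessYY_g hc x y (B.vSol x y - B.vSol x' y')
  -- Subtracting the two linear systems puts the change of the Hessian on `v(x', y')`, which has
  -- norm at most `M/μ`. Dividing by `μ` gives exactly `C₁`.
  have e : hessYY B.g x y (B.vSol x y - B.vSol x' y')
      = (gradY B.f x y - gradY B.f x' y')
        - (hessYY B.g x y - hessYY B.g x' y') (B.vSol x' y') := by
    rw [map_sub, hB.hessYY_g_vSol hc, sub_apply, hB.hessYY_g_vSol hc]
    abel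
  have h1 := hB.lipGradYf hc x x' y y'
  have h2 : ‖(hessYY B.g x y - hessYY B.g x' y') (B.vSol x' y')‖ ≤ c.ρ * d * (c.M / c.μ) :=
    ((hessYY B.g x y - hessYY B.g x' y').le_opNorm _).trans
      (mul_le_mul (hB.lipHessg hc x x' y y') (hB.norm_vSol_le hc x' y') (norm_nonneg _)
        (mul_nonneg hc.ρ_nonneg (by positivity)))
  rw [e] at h
  have h3 := norm_sub_le (gradY B.f x y - gradY B.f x' y')
    ((hessYY B.g x y - hessYY B.g x' y') (B.vSol x' y'))
  have h4 : c.μ * ‖B.vSol x y - B.vSol x' y'‖ ≤ c.L * d + c.ρ * d * (c.M / c.μ) := by linarith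
  have h5 : c.C1 * d = (c.L * d + c.ρ * d * (c.M / c.μ)) / c.μ := by
    rw [Consts.C1]; field_simp; ring
  rw [h5, le_div_iff₀ hμ, mul_comm]
  exact h4

lemma C1_nonneg (hc : c.Admissible) : 0 ≤ c.C1 := by
  have h1 := hc.μ_pos
  have h2 := hc.L_pos
  have h3 := hc.M_nonneg
  have h4 := hc.ρ_nonneg
  unfold Consts.C1; positivity

lemma norm_vSol_yStar_sub_le (hB : B.Assumptions c s) (hc : c.Admissible) (x x' : Euc p) :
    ‖B.vSol x (B.yStar x) - B.vSol x' (B.yStar x')‖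
      ≤ c.C1 * (1 + c.L / c.μ) * ‖x - x'‖ := by
  calc _ ≤ c.C1 * (‖x - x'‖ + ‖B.yStar x - B.yStar x'‖) := hB.norm_vSol_sub_le hc _ _ _ _
    _ ≤ c.C1 * (‖x - x'‖ + c.L / c.μ * ‖x - x'‖) := by
      have := C1_nonneg hc
      gcongr
      exact hB.norm_yStar_sub_le hc x x'
    _ = _ := by ring

/-! ### The upper-level objective -/

/-- The mean of the hypergradient estimate. -/
def _root_.Bilevel.hyperGradMean (B : Bilevel p q ΞF ΞG) (x : Euc p) (y v : Euc q) : Euc p :=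
  gradX B.f x y - jacXY B.g x y v

/-- Implicit differentiation gives `Dy* = -H⁻¹A`, where `A` is the `x`-Jacobian of `∇_y g`; the
chain rule then produces `∇_y f` paired with `H⁻¹A u`. -/
lemma hasGradientAt_Phi (hB : B.Assumptions c s) (hc : c.Admissible) (x : Euc p) :
    HasGradientAt B.Phi (B.hyperGradMean x (B.yStar x) (B.vSol x (B.yStar x))) x := by
  set y := B.yStar x with hy
  set A := ContinuousLinearMap.adjoint (jacXY B.g x y) with hA
  set Hinv := (hessYY B.g x y).inverse
  have hH : ∀ w, hessYY B.g x y (Hinv w) = w :=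
    apply_inverse_of_le_inner hc.μ_pos (hB.le_inner_hessYY_g hc x y)
  have hY : HasFDerivAt B.yStar (-(Hinv.comp A)) x :=
    hasFDerivAt_of_implicit hc.μ_pos (hB.hasFDerivAt_gradY_g hc (x, y))
      (fun x' => hB.norm_yStar_sub_le hc x' x) (hB.gradY_g_yStar hc)
      (hB.norm_le_norm_hessYY_g hc x y) (fun u => by simp [hH, hA])
  have hf := (hB.integrable_and_hasFDerivAt_f hc (x, y)).2
  have hPhi := HasFDerivAt.comp (f := fun x' => (x', B.yStar x')) x hf ((hasFDerivAt_id x).prodMk hY)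
  rw [hasGradientAt_iff_hasFDerivAt]
  refine hPhi.congr_fderiv ?_
  ext1 u
  rw [ContinuousLinearMap.comp_apply, apply_eq_inner_gradX_add_inner_gradY hf]
  -- Writing `∇_y f = H v` and moving the symmetric `H` across cancels the inverse; this is where
  -- the auxiliary variable `v` comes from.
  have h1 : ⟪gradY B.f x y, Hinv (A u)⟫ = ⟪jacXY B.g x y (B.vSol x y), u⟫ := by
    rw [← hB.hessYY_g_vSol hc, hB.hessYY_g_symm hc, hH, hA,
      ContinuousLinearMap.adjoint_inner_right]
  simp [Bilevel.hyperGradMean, h1]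
  ring

lemma differentiable_Phi (hB : B.Assumptions c s) (hc : c.Admissible) : Differentiable ℝ B.Phi :=
  fun x => (hB.hasGradientAt_Phi hc x).differentiableAt

lemma gradient_Phi (hB : B.Assumptions c s) (hc : c.Admissible) (x : Euc p) :
    gradient B.Phi x = B.hyperGradMean x (B.yStar x) (B.vSol x (B.yStar x)) :=
  (hB.hasGradientAt_Phi hc x).gradient

lemma norm_jacXY_g_apply_le (hB : B.Assumptions c s) (hc : c.Admissible) (x : Euc p)
    (y v : Euc q) : ‖jacXY B.g x y v‖ ≤ c.L * ‖v‖ :=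
  (jacXY B.g x y).le_of_opNorm_le (hB.norm_jacXY_g_le hc x y) v

/-- A uniform bound, so that `‖∇Φ‖²` is integrable along the run without moment assumptions on the
iterates. -/
lemma norm_gradient_Phi_le (hB : B.Assumptions c s) (hc : c.Admissible) (x : Euc p) :
    ‖gradient B.Phi x‖ ≤ c.M + c.L * (c.M / c.μ) := by
  rw [hB.gradient_Phi hc, Bilevel.hyperGradMean]
  refine (norm_sub_le _ _).trans (add_le_add (hB.norm_gradX_f_le hc _ _) ?_)
  exact (hB.norm_jacXY_g_apply_le hc _ _ _).trans
    (mul_le_mul_of_nonneg_left (hB.norm_vSol_le hc _ _) hc.L_pos.le)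

/-- The splitting puts the Jacobian difference on `v` and the difference `v - v'` on a Jacobian of
norm at most `L`, so only `v` has to be bounded. Both uses take for `v` the exact solution. -/
lemma norm_hyperGradMean_sub_le (hB : B.Assumptions c s) (hc : c.Admissible) (x x' : Euc p)
    (y y' v v' : Euc q) (hv : ‖v‖ ≤ c.M / c.μ) :
    ‖B.hyperGradMean x y v - B.hyperGradMean x' y' v'‖
      ≤ c.C1bar * (‖x - x'‖ + ‖y - y'‖) + c.L * ‖v - v'‖ := by
  set d := ‖x - x'‖ + ‖y - y'‖
  have e : B.hyperGradMean x y v - B.hyperGradMean x' y' v'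
      = (gradX B.f x y - gradX B.f x' y')
        - ((jacXY B.g x y - jacXY B.g x' y') v + jacXY B.g x' y' (v - v')) := by
    rw [Bilevel.hyperGradMean, Bilevel.hyperGradMean, sub_apply, map_sub]; abel
  rw [e]
  have h1 : ‖(jacXY B.g x y - jacXY B.g x' y') v‖ ≤ c.τ * d * (c.M / c.μ) :=
    ((jacXY B.g x y - jacXY B.g x' y').le_opNorm _).trans
      (mul_le_mul (hB.lipJacg hc x x' y y') hv (norm_nonneg _)
        (mul_nonneg hc.τ_nonneg (by positivity)))
  have h2 := hB.norm_jacXY_g_apply_le hc x' y' (v - v')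
  calc _ ≤ ‖gradX B.f x y - gradX B.f x' y'‖ + (‖(jacXY B.g x y - jacXY B.g x' y') v‖
        + ‖jacXY B.g x' y' (v - v')‖) :=
        (norm_sub_le _ _).trans (add_le_add le_rfl (norm_add_le _ _))
    _ ≤ c.L * d + (c.τ * d * (c.M / c.μ) + c.L * ‖v - v'‖) :=
        add_le_add (hB.lipGradXf hc x x' y y') (add_le_add h1 h2)
    _ = _ := by rw [Consts.C1bar]; ring

lemma C1bar_nonneg (hc : c.Admissible) : 0 ≤ c.C1bar := by
  have h1 := hc.μ_pos
  have h2 := hc.L_pos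
  have h3 := hc.M_nonneg
  have h4 := hc.τ_nonneg
  unfold Consts.C1bar; positivity

lemma norm_gradient_Phi_sub_le (hB : B.Assumptions c s) (hc : c.Admissible) (x x' : Euc p) :
    ‖gradient B.Phi x - gradient B.Phi x'‖ ≤ c.LPhi * ‖x - x'‖ := by
  rw [hB.gradient_Phi hc, hB.gradient_Phi hc]
  have hμ := hc.μ_pos
  calc _ ≤ c.C1bar * (‖x - x'‖ + ‖B.yStar x - B.yStar x'‖)
        + c.L * ‖B.vSol x (B.yStar x) - B.vSol x' (B.yStar x')‖ :=
        hB.norm_hyperGradMean_sub_le hc _ _ _ _ _ _ (hB.norm_vSol_le hc _ _)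
    _ ≤ c.C1bar * (‖x - x'‖ + c.L / c.μ * ‖x - x'‖)
        + c.L * (c.C1 * (1 + c.L / c.μ) * ‖x - x'‖) := by
      have h1 := C1bar_nonneg hc
      have h2 := hc.L_pos.le
      gcongr
      · exact hB.norm_yStar_sub_le hc x x'
      · exact hB.norm_vSol_yStar_sub_le hc x x'
    -- The product `(1 + κ)(C̄₁ + L C₁)`, expanded, is `L_Φ`.
    _ = _ := by
      rw [Consts.C1bar, Consts.C1, Consts.LPhi]
      field_simp
      ring

lemma Phi_add_le (hB : B.Assumptions c s) (hc : c.Admissible) (x d : Euc p) :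
    B.Phi (x + d) ≤ B.Phi x + ⟪gradient B.Phi x, d⟫ + c.LPhi / 2 * ‖d‖ ^ 2 :=
  le_add_inner_gradient_add_of_lipschitz (hB.differentiable_Phi hc)
    (hB.norm_gradient_Phi_sub_le hc) x d

lemma continuous_of_norm_sub_le {V W : Type*} [NormedAddCommGroup V] [NormedAddCommGroup W]
    {h : V → W} {K : ℝ} (hK : ∀ x x', ‖h x - h x'‖ ≤ K * ‖x - x'‖) : Continuous h :=
  (LipschitzWith.of_dist_le' (K := K) fun x x' => by
    simpa [dist_eq_norm] using hK x x').continuous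

lemma continuous_yStar (hB : B.Assumptions c s) (hc : c.Admissible) : Continuous B.yStar :=
  continuous_of_norm_sub_le (hB.norm_yStar_sub_le hc)

lemma continuous_vSol (hB : B.Assumptions c s) (hc : c.Admissible) :
    Continuous fun z : Euc p × Euc q => B.vSol z.1 z.2 :=
  continuous_of_norm_sub_le (K := c.C1 * 2) fun z z' =>
    (hB.norm_vSol_sub_le hc _ _ _ _).trans <| by
      rw [mul_assoc]
      exact mul_le_mul_of_nonneg_left (norm_sub_add_norm_sub_le z z') (C1_nonneg hc)

lemma continuous_gradient_Phi (hB : B.Assumptions c s) (hc : c.Admissible) :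
    Continuous (gradient B.Phi) :=
  continuous_of_norm_sub_le (hB.norm_gradient_Phi_sub_le hc)

end Bilevel.Assumptions

/-! ### Measurability of derivatives in the sample. -/

section Measurability

open scoped RealInnerProductSpace

lemma measurable_of_measurable_inner {Ξ V : Type*} [MeasurableSpace Ξ] [NormedAddCommGroup V]
    [InnerProductSpace ℝ V] [FiniteDimensional ℝ V] [MeasurableSpace V] [BorelSpace V] {f : Ξ → V}
    (h : ∀ u, Measurable fun ξ => ⟪u, f ξ⟫) : Measurable f := by
  have e : f = fun ξ => ∑ i, ⟪stdOrthonormalBasis ℝ V i, f ξ⟫ • stdOrthonormalBasis ℝ V i := by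
    ext1 ξ
    exact ((stdOrthonormalBasis ℝ V).sum_repr' (f ξ)).symm
  rw [e]
  exact Finset.measurable_sum _ fun i _ => (h _).smul_const _

/-- Only function values are assumed measurable in the sample. A directional derivative is the
pointwise limit of the quotients `n (φ(y + u/n) - φ(y))`. -/
lemma measurable_hasFDerivAt_apply {Ξ V W : Type*} [MeasurableSpace Ξ] [NormedAddCommGroup V]
    [NormedSpace ℝ V] [NormedAddCommGroup W] [NormedSpace ℝ W] [MeasurableSpace W] [BorelSpace W]
    [SecondCountableTopology W] {φ : Ξ → V → W} {φ' : Ξ → V →L[ℝ] W} {y : V}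
    (hφ : ∀ y, Measurable fun ξ => φ ξ y) (hd : ∀ ξ, HasFDerivAt (φ ξ) (φ' ξ) y) (u : V) :
    Measurable fun ξ => φ' ξ u := by
  refine measurable_of_tendsto_metrizable
    (f := fun (n : ℕ) ξ => (n : ℝ) • (φ ξ (y + (n : ℝ)⁻¹ • u) - φ ξ y)) (fun n => ?_) ?_
  · exact ((hφ _).sub (hφ _)).const_smul (n : ℝ)
  · rw [tendsto_pi_nhds]
    intro ξ
    exact ((hd ξ).lim_real u).comp tendsto_natCast_atTop_atTop

lemma measurable_gradient {Ξ V : Type*} [MeasurableSpace Ξ] [NormedAddCommGroup V]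
    [InnerProductSpace ℝ V] [FiniteDimensional ℝ V] [MeasurableSpace V] [BorelSpace V]
    {φ : Ξ → V → ℝ} {y : V} (hφ : ∀ y, Measurable fun ξ => φ ξ y)
    (hd : ∀ ξ, DifferentiableAt ℝ (φ ξ) y) : Measurable fun ξ => gradient (φ ξ) y := by
  refine measurable_of_measurable_inner fun u => ?_
  have := measurable_hasFDerivAt_apply hφ (fun ξ => (hd ξ).hasFDerivAt) u
  have e : (fun ξ => ⟪u, gradient (φ ξ) y⟫) = fun ξ => fderiv ℝ (φ ξ) y u := by
    ext1 ξ
    rw [real_inner_comm, inner_gradient_left]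
  rwa [e]

end Measurability

/-! ### One step of the algorithm as a measurable random map, and its noise. -/

/-- Independent families `ξ`, `ζ` of independent samples with the laws of the problem. -/
structure IsSampling {p q : ℕ} {ΞF ΞG Ω : Type*} [MeasurableSpace ΞF] [MeasurableSpace ΞG]
    [MeasurableSpace Ω] (P : Measure Ω) (B : Bilevel p q ΞF ΞG) (ξ : ℕ → Ω → ΞF)
    (ζ : ℕ → Ω → ΞG) : Prop where
  meas_ξ : ∀ i, Measurable (ξ i)
  meas_ζ : ∀ i, Measurable (ζ i)
  law_ξ : ∀ i, P.map (ξ i) = B.PF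
  law_ζ : ∀ i, P.map (ζ i) = B.PG
  iIndep_ξ : iIndepFun ξ P
  iIndep_ζ : iIndepFun ζ P
  indep : IndepFun (fun ω i => ξ i ω) (fun ω i => ζ i ω) P

namespace Bilevel

variable {p q : ℕ} {ΞF ΞG : Type*} [MeasurableSpace ΞF] [MeasurableSpace ΞG]

/-- The hypergradient estimate as a function of the iterate `(x, y, v)` and the batches. -/
def updX (B : Bilevel p q ΞF ΞG) (a : Params) (z : Euc p × Euc q × Euc q)
    (e : (ℕ → ΞF) × (ℕ → ΞG)) : Euc p :=
  batchMean a.Df (fun i => gradX (B.F (e.1 i)) z.1 z.2.1)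
    - batchMean a.Dg (fun i => jacXY (B.G (e.2 i)) z.1 z.2.1 z.2.2)

/-- The lower-level step as a function of the iterate `(x, y, v)` and the batches. -/
def updY (B : Bilevel p q ΞF ΞG) (a : Params) (z : Euc p × Euc q × Euc q)
    (e : (ℕ → ΞF) × (ℕ → ΞG)) : Euc q :=
  z.2.1 - a.β • batchMean a.S (fun i => gradY (B.G (e.2 i)) z.1 z.2.1)

/-- The linear-system step as a function of the iterate `(x, y, v)` and the batches. -/
def updV (B : Bilevel p q ΞF ΞG) (a : Params) (z : Euc p × Euc q × Euc q)
    (e : (ℕ → ΞF) × (ℕ → ΞG)) : Euc q :=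
  z.2.2 - a.η • batchMean a.D (fun i => hessYY (B.G (e.2 i)) z.1 z.2.1 z.2.2)
    + a.η • batchMean a.Df (fun i => gradY (B.F (e.1 i)) z.1 z.2.1)

end Bilevel

namespace Bilevel.Assumptions

open scoped RealInnerProductSpace

variable {p q : ℕ} {ΞF ΞG : Type*} [MeasurableSpace ΞF] [MeasurableSpace ΞG]
  {B : Bilevel p q ΞF ΞG} {c : Consts} {s : Noise}

/-! ### Measurability of the sample gradients -/

lemma measurable_gradX_F (hB : B.Assumptions c s) (x : Euc p) (y : Euc q) :
    Measurable fun ξ => gradX (B.F ξ) x y :=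
  measurable_gradient (φ := fun ξ x' => B.F ξ x' y) (fun x' => hB.measF x' y) fun ξ =>
    ((hB.smoothF ξ).comp (contDiff_prodMk_left y)).differentiable one_ne_zero x

lemma measurable_gradY_F (hB : B.Assumptions c s) (x : Euc p) (y : Euc q) :
    Measurable fun ξ => gradY (B.F ξ) x y :=
  measurable_gradient (φ := fun ξ y' => B.F ξ x y') (fun y' => hB.measF x y') fun ξ =>
    ((hB.smoothF ξ).comp (contDiff_prodMk_right x)).differentiable one_ne_zero y

lemma measurable_gradY_G (hB : B.Assumptions c s) (x : Euc p) (y : Euc q) :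
    Measurable fun ζ => gradY (B.G ζ) x y :=
  measurable_gradient (φ := fun ζ y' => B.G ζ x y') (fun y' => hB.measG x y') fun ζ =>
    hB.differentiable_G ζ x y

lemma measurable_hessYY_G (hB : B.Assumptions c s) (x : Euc p) (y v : Euc q) :
    Measurable fun ζ => hessYY (B.G ζ) x y v :=
  measurable_hasFDerivAt_apply (φ := fun ζ y' => gradY (B.G ζ) x y')
    (fun y' => hB.measurable_gradY_G x y') (fun ζ => ((contDiff_gradY (hB.smoothG ζ)).comp
      (contDiff_prodMk_right x)).differentiable one_ne_zero y |>.hasFDerivAt) v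

lemma measurable_jacXY_G (hB : B.Assumptions c s) (x : Euc p) (y v : Euc q) :
    Measurable fun ζ => jacXY (B.G ζ) x y v := by
  refine measurable_of_measurable_inner fun u => ?_
  have h := measurable_hasFDerivAt_apply (φ := fun ζ x' => gradY (B.G ζ) x' y)
    (fun x' => hB.measurable_gradY_G x' y) (fun ζ => ((contDiff_gradY (hB.smoothG ζ)).comp
      (contDiff_prodMk_left y)).differentiable one_ne_zero x |>.hasFDerivAt) u
  have e : (fun ζ => ⟪u, jacXY (B.G ζ) x y v⟫)
      = fun ζ => ⟪fderiv ℝ (fun x' => gradY (B.G ζ) x' y) x u, v⟫ := by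
    ext1 ζ
    rw [jacXY, ContinuousLinearMap.adjoint_inner_right]
  rw [e]
  exact h.inner measurable_const

lemma continuous_pair_of_norm_sub_le {W : Type*} [NormedAddCommGroup W] {h : Euc p → Euc q → W}
    {K : ℝ} (hK0 : 0 ≤ K) (hK : ∀ x x' y y', ‖h x y - h x' y'‖ ≤ K * (‖x - x'‖ + ‖y - y'‖)) :
    Continuous fun z : Euc p × Euc q => h z.1 z.2 :=
  continuous_of_norm_sub_le (K := K * 2) fun z z' => (hK _ _ _ _).trans <| by
    rw [mul_assoc]
    exact mul_le_mul_of_nonneg_left (norm_sub_add_norm_sub_le z z') hK0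

/-- A Carathéodory function: continuous in the iterate by the Lipschitz assumption and measurable in
the sample, hence jointly measurable. The other sample derivatives are treated alike. -/
lemma measurable_uncurry_gradX_F (hB : B.Assumptions c s) (hc : c.Admissible) :
    Measurable fun w : (Euc p × Euc q) × ΞF => gradX (B.F w.2) w.1.1 w.1.2 :=
  measurable_uncurry_of_continuous_of_measurable (u := fun (z : Euc p × Euc q) ξ => gradX (B.F ξ) z.1 z.2)
    (fun ξ => continuous_pair_of_norm_sub_le hc.L_pos.le (hB.lipGradXF ξ))
    fun z => hB.measurable_gradX_F z.1 z.2

lemma measurable_uncurry_gradY_F (hB : B.Assumptions c s) (hc : c.Admissible) :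
    Measurable fun w : (Euc p × Euc q) × ΞF => gradY (B.F w.2) w.1.1 w.1.2 :=
  measurable_uncurry_of_continuous_of_measurable (u := fun (z : Euc p × Euc q) ξ => gradY (B.F ξ) z.1 z.2)
    (fun ξ => continuous_pair_of_norm_sub_le hc.L_pos.le (hB.lipGradYF ξ))
    fun z => hB.measurable_gradY_F z.1 z.2

lemma measurable_uncurry_gradY_G (hB : B.Assumptions c s) (hc : c.Admissible) :
    Measurable fun w : (Euc p × Euc q) × ΞG => gradY (B.G w.2) w.1.1 w.1.2 :=
  measurable_uncurry_of_continuous_of_measurable (u := fun (z : Euc p × Euc q) ζ => gradY (B.G ζ) z.1 z.2)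
    (fun ζ => continuous_pair_of_norm_sub_le hc.L_pos.le (hB.lipGradYG ζ))
    fun z => hB.measurable_gradY_G z.1 z.2

lemma continuous_triple {W : Type*} [NormedAddCommGroup W] [NormedSpace ℝ W]
    {T : Euc p → Euc q → Euc q →L[ℝ] W} (h : Continuous fun z : Euc p × Euc q => T z.1 z.2) :
    Continuous fun z : Euc p × Euc q × Euc q => T z.1 z.2.1 z.2.2 :=
  (h.comp (continuous_fst.prodMk (continuous_fst.comp continuous_snd))).clm_apply
    (continuous_snd.comp continuous_snd)

lemma measurable_uncurry_jacXY_G (hB : B.Assumptions c s) (hc : c.Admissible) :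
    Measurable fun w : (Euc p × Euc q × Euc q) × ΞG =>
      jacXY (B.G w.2) w.1.1 w.1.2.1 w.1.2.2 :=
  measurable_uncurry_of_continuous_of_measurable
    (u := fun (z : Euc p × Euc q × Euc q) ζ => jacXY (B.G ζ) z.1 z.2.1 z.2.2)
    (fun ζ => continuous_triple (continuous_pair_of_norm_sub_le hc.τ_nonneg (hB.lipJacG ζ)))
    fun z => hB.measurable_jacXY_G z.1 z.2.1 z.2.2

lemma measurable_uncurry_hessYY_G (hB : B.Assumptions c s) (hc : c.Admissible) :
    Measurable fun w : (Euc p × Euc q × Euc q) × ΞG =>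
      hessYY (B.G w.2) w.1.1 w.1.2.1 w.1.2.2 :=
  measurable_uncurry_of_continuous_of_measurable
    (u := fun (z : Euc p × Euc q × Euc q) ζ => hessYY (B.G ζ) z.1 z.2.1 z.2.2)
    (fun ζ => continuous_triple (continuous_pair_of_norm_sub_le hc.ρ_nonneg (hB.lipHessG ζ)))
    fun z => hB.measurable_hessYY_G z.1 z.2.1 z.2.2

lemma measurable_updX (hB : B.Assumptions c s) (hc : c.Admissible) (a : Params) :
    Measurable fun w : (Euc p × Euc q × Euc q) × (ℕ → ΞF) × (ℕ → ΞG) => B.updX a w.1 w.2 := by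
  refine (measurable_batchMean _ fun i => ?_).sub (measurable_batchMean _ fun i => ?_)
  · exact (hB.measurable_uncurry_gradX_F hc).comp (f := fun w : (Euc p × Euc q × Euc q) ×
      (ℕ → ΞF) × (ℕ → ΞG) => ((w.1.1, w.1.2.1), w.2.1 i)) (by fun_prop)
  · exact (hB.measurable_uncurry_jacXY_G hc).comp (f := fun w : (Euc p × Euc q × Euc q) ×
      (ℕ → ΞF) × (ℕ → ΞG) => (w.1, w.2.2 i)) (by fun_prop)

lemma measurable_updY (hB : B.Assumptions c s) (hc : c.Admissible) (a : Params) :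
    Measurable fun w : (Euc p × Euc q × Euc q) × (ℕ → ΞF) × (ℕ → ΞG) => B.updY a w.1 w.2 := by
  refine (by fun_prop : Measurable fun w : (Euc p × Euc q × Euc q) × (ℕ → ΞF) × (ℕ → ΞG) =>
    w.1.2.1).sub ((measurable_batchMean _ fun i => ?_).const_smul a.β)
  exact (hB.measurable_uncurry_gradY_G hc).comp (f := fun w : (Euc p × Euc q × Euc q) ×
      (ℕ → ΞF) × (ℕ → ΞG) => ((w.1.1, w.1.2.1), w.2.2 i)) (by fun_prop)

lemma measurable_updV (hB : B.Assumptions c s) (hc : c.Admissible) (a : Params) :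
    Measurable fun w : (Euc p × Euc q × Euc q) × (ℕ → ΞF) × (ℕ → ΞG) => B.updV a w.1 w.2 := by
  refine ((by fun_prop : Measurable fun w : (Euc p × Euc q × Euc q) × (ℕ → ΞF) × (ℕ → ΞG) =>
    w.1.2.2).sub ((measurable_batchMean _ fun i => ?_).const_smul a.η)).add
      ((measurable_batchMean _ fun i => ?_).const_smul a.η)
  · exact (hB.measurable_uncurry_hessYY_G hc).comp (f := fun w : (Euc p × Euc q × Euc q) ×
      (ℕ → ΞF) × (ℕ → ΞG) => (w.1, w.2.2 i)) (by fun_prop)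
  · exact (hB.measurable_uncurry_gradY_F hc).comp (f := fun w : (Euc p × Euc q × Euc q) ×
      (ℕ → ΞF) × (ℕ → ΞG) => ((w.1.1, w.1.2.1), w.2.1 i)) (by fun_prop)

/-! ### Sample noise -/

lemma isNoise_gradX_F (hB : B.Assumptions c s) (hc : c.Admissible) (x : Euc p) (y : Euc q) :
    IsNoise B.PF (fun ξ => gradX (B.F ξ) x y - gradX B.f x y) (s.σf ^ 2) := by
  have := hB.probF
  refine ⟨(hB.varGradXF x y).1, ?_, (hB.varGradXF x y).2⟩
  rw [integral_sub (hB.integrable_gradX_F x y) (integrable_const _), ← hB.gradX_f hc]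
  simp

lemma isNoise_gradY_F (hB : B.Assumptions c s) (hc : c.Admissible) (x : Euc p) (y : Euc q) :
    IsNoise B.PF (fun ξ => gradY (B.F ξ) x y - gradY B.f x y) (s.σf ^ 2) := by
  have := hB.probF
  refine ⟨(hB.varGradYF x y).1, ?_, (hB.varGradYF x y).2⟩
  rw [integral_sub (hB.integrable_gradY_F x y) (integrable_const _), ← hB.gradY_f hc]
  simp

lemma isNoise_gradY_G (hB : B.Assumptions c s) (hc : c.Admissible) (x : Euc p) (y : Euc q) :
    IsNoise B.PG (fun ζ => gradY (B.G ζ) x y - gradY B.g x y) (s.σg ^ 2) := by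
  have := hB.probG
  refine ⟨(hB.varGradYG x y).1, ?_, (hB.varGradYG x y).2⟩
  rw [integral_sub (hB.integrable_gradY_G x y) (integrable_const _), ← hB.gradY_g hc]
  simp

/-- The variance is controlled in operator norm, so applying the matrix to `v` costs `‖v‖²`. With
`‖v‖ ≤ M/μ` this is the source of the factors `M²/μ²` in front of `σ_{g,1}²` and `σ_{g,2}²`. -/
lemma isNoise_clm_apply {Ξ V W : Type*} [MeasurableSpace Ξ] [NormedAddCommGroup V]
    [InnerProductSpace ℝ V] [NormedAddCommGroup W] [InnerProductSpace ℝ W] [CompleteSpace W]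
    {Q : Measure Ξ} [IsProbabilityMeasure Q] {T : Ξ → V →L[ℝ] W} {T₀ : V →L[ℝ] W} {σ K : ℝ}
    (h : SecondMomentLE Q (fun ζ => T ζ - T₀) σ) (hT : T₀ = ∫ ζ, T ζ ∂Q) (v : V)
    (hv : ‖v‖ ≤ K) : IsNoise Q (fun ζ => T ζ v - T₀ v) (K ^ 2 * σ ^ 2) := by
  have hi := h.integrable
  have hle : ∀ ζ, ‖T ζ v - T₀ v‖ ≤ ‖v‖ * ‖T ζ - T₀‖ := fun ζ => by
    rw [← sub_apply, mul_comm]; exact (T ζ - T₀).le_opNorm v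
  have hL2 : MemLp (fun ζ => T ζ v - T₀ v) 2 Q :=
    h.1.of_le_mul (c := ‖v‖) ((hi.apply_continuousLinearMap v).1.sub
      aestronglyMeasurable_const) (Filter.Eventually.of_forall hle)
  refine ⟨hL2, ?_, ?_⟩
  · rw [integral_sub (hi.apply_continuousLinearMap v) (integrable_const _),
      ← ContinuousLinearMap.integral_apply hi, ← hT]
    simp
  · calc ∫ ζ, ‖T ζ v - T₀ v‖ ^ 2 ∂Q ≤ ∫ ζ, ‖v‖ ^ 2 * ‖T ζ - T₀‖ ^ 2 ∂Q :=
        integral_mono (hL2.integrable_norm_pow two_ne_zero)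
          ((h.1.integrable_norm_pow two_ne_zero).const_mul _) fun ζ => by
            simp only
            rw [← mul_pow]
            exact pow_le_pow_left₀ (norm_nonneg _) (hle ζ) 2
      _ = ‖v‖ ^ 2 * ∫ ζ, ‖T ζ - T₀‖ ^ 2 ∂Q := integral_const_mul _ _
      _ ≤ K ^ 2 * σ ^ 2 := by
        gcongr
        exact h.2

lemma isNoise_jacXY_G (hB : B.Assumptions c s) (hc : c.Admissible) (x : Euc p) (y v : Euc q)
    {K : ℝ} (hv : ‖v‖ ≤ K) :
    IsNoise B.PG (fun ζ => jacXY (B.G ζ) x y v - jacXY B.g x y v) (K ^ 2 * s.σg1 ^ 2) :=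
  have := hB.probG
  isNoise_clm_apply (hB.varJacG x y) (hB.jacXY_g hc x y) v hv

lemma isNoise_hessYY_G (hB : B.Assumptions c s) (hc : c.Admissible) (x : Euc p) (y v : Euc q)
    {K : ℝ} (hv : ‖v‖ ≤ K) :
    IsNoise B.PG (fun ζ => hessYY (B.G ζ) x y v - hessYY B.g x y v) (K ^ 2 * s.σg2 ^ 2) :=
  have := hB.probG
  isNoise_clm_apply (hB.varHessG x y) (hB.hessYY_g hc x y) v hv

variable {Ω : Type*} [MeasurableSpace Ω] {P : Measure Ω} [IsProbabilityMeasure P]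
  {ξ : ℕ → Ω → ΞF} {ζ : ℕ → Ω → ΞG} {a : Params}

lemma isNoise_updX (hB : B.Assumptions c s) (hc : c.Admissible) (hS : IsSampling P B ξ ζ)
    (hDf : 0 < a.Df) (hDg : 0 < a.Dg) (z : Euc p × Euc q × Euc q) {K : ℝ} (hv : ‖z.2.2‖ ≤ K) :
    IsNoise P (fun ω => B.updX a z (fun i => ξ i ω, fun i => ζ i ω)
        - B.hyperGradMean z.1 z.2.1 z.2.2)
      (s.σf ^ 2 / a.Df + K ^ 2 * s.σg1 ^ 2 / a.Dg) := by
  have h1 := (hB.isNoise_gradX_F hc z.1 z.2.1).batchMean_sub (hB.measurable_gradX_F _ _)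
    hS.meas_ξ hS.law_ξ hS.iIndep_ξ hDf
  have h2 := (hB.isNoise_jacXY_G hc z.1 z.2.1 z.2.2 hv).batchMean_sub (hB.measurable_jacXY_G _ _ _)
    hS.meas_ζ hS.law_ζ hS.iIndep_ζ hDg
  have hφ : Measurable fun e : ℕ → ΞF =>
      batchMean a.Df (fun i => gradX (B.F (e i)) z.1 z.2.1) - gradX B.f z.1 z.2.1 :=
    (measurable_batchMean _ fun i => (hB.measurable_gradX_F _ _).comp
      (measurable_pi_apply i)).sub_const _
  have hψ₀ : Measurable fun e : ℕ → ΞG =>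
      batchMean a.Dg (fun i => jacXY (B.G (e i)) z.1 z.2.1 z.2.2) - jacXY B.g z.1 z.2.1 z.2.2 :=
    (measurable_batchMean _ fun i => (hB.measurable_jacXY_G _ _ _).comp
      (measurable_pi_apply i)).sub_const _
  have hψ : Measurable fun e : ℕ → ΞG => (-1 : ℝ) •
      (batchMean a.Dg (fun i => jacXY (B.G (e i)) z.1 z.2.1 z.2.2) - jacXY B.g z.1 z.2.1 z.2.2) :=
    hψ₀.const_smul (-1 : ℝ)
  -- The `F`-batch and the `G`-batch are independent, so the two contributions to the variance
  -- simply add.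
  have hind := hS.indep.comp hφ hψ
  have h3 := h1.add (h2.const_smul (-1)) hind
  have e : (fun ω => B.updX a z (fun i => ξ i ω, fun i => ζ i ω)
      - B.hyperGradMean z.1 z.2.1 z.2.2) = fun ω =>
      (batchMean a.Df (fun i => gradX (B.F (ξ i ω)) z.1 z.2.1) - gradX B.f z.1 z.2.1)
      + (-1 : ℝ) • (batchMean a.Dg (fun i => jacXY (B.G (ζ i ω)) z.1 z.2.1 z.2.2)
        - jacXY B.g z.1 z.2.1 z.2.2) := by
    ext1 ω
    rw [Bilevel.updX, Bilevel.hyperGradMean, neg_one_smul]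
    abel
  rw [e]
  exact h3.mono (by norm_num)

lemma isNoise_updY (hB : B.Assumptions c s) (hc : c.Admissible) (hS : IsSampling P B ξ ζ)
    (hS' : 0 < a.S) (z : Euc p × Euc q × Euc q) :
    IsNoise P (fun ω => B.updY a z (fun i => ξ i ω, fun i => ζ i ω)
        - (z.2.1 - a.β • gradY B.g z.1 z.2.1)) (a.β ^ 2 * (s.σg ^ 2 / a.S)) := by
  have h1 := ((hB.isNoise_gradY_G hc z.1 z.2.1).batchMean_sub (hB.measurable_gradY_G _ _)
    hS.meas_ζ hS.law_ζ hS.iIndep_ζ hS').const_smul (-a.β)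
  have e : (fun ω => B.updY a z (fun i => ξ i ω, fun i => ζ i ω)
      - (z.2.1 - a.β • gradY B.g z.1 z.2.1)) = fun ω =>
      (-a.β) • (batchMean a.S (fun i => gradY (B.G (ζ i ω)) z.1 z.2.1) - gradY B.g z.1 z.2.1) := by
    ext1 ω
    rw [Bilevel.updY, neg_smul, smul_sub]
    abel
  rw [e]
  exact h1.mono (by rw [neg_sq])

lemma isNoise_updV (hB : B.Assumptions c s) (hc : c.Admissible) (hS : IsSampling P B ξ ζ)
    (hDf : 0 < a.Df) (hD : 0 < a.D) (z : Euc p × Euc q × Euc q) {K : ℝ} (hv : ‖z.2.2‖ ≤ K) :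
    IsNoise P (fun ω => B.updV a z (fun i => ξ i ω, fun i => ζ i ω)
        - (z.2.2 - a.η • hessYY B.g z.1 z.2.1 z.2.2 + a.η • gradY B.f z.1 z.2.1))
      (a.η ^ 2 * (s.σf ^ 2 / a.Df + K ^ 2 * s.σg2 ^ 2 / a.D)) := by
  have h1 := (hB.isNoise_gradY_F hc z.1 z.2.1).batchMean_sub (hB.measurable_gradY_F _ _)
    hS.meas_ξ hS.law_ξ hS.iIndep_ξ hDf
  have h2 := (hB.isNoise_hessYY_G hc z.1 z.2.1 z.2.2 hv).batchMean_sub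
    (hB.measurable_hessYY_G _ _ _) hS.meas_ζ hS.law_ζ hS.iIndep_ζ hD
  have hφ : Measurable fun e : ℕ → ΞF =>
      batchMean a.Df (fun i => gradY (B.F (e i)) z.1 z.2.1) - gradY B.f z.1 z.2.1 :=
    (measurable_batchMean _ fun i => (hB.measurable_gradY_F _ _).comp
      (measurable_pi_apply i)).sub_const _
  have hψ₀ : Measurable fun e : ℕ → ΞG =>
      batchMean a.D (fun i => hessYY (B.G (e i)) z.1 z.2.1 z.2.2) - hessYY B.g z.1 z.2.1 z.2.2 :=
    (measurable_batchMean _ fun i => (hB.measurable_hessYY_G _ _ _).comp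
      (measurable_pi_apply i)).sub_const _
  have hψ : Measurable fun e : ℕ → ΞG => (-1 : ℝ) •
      (batchMean a.D (fun i => hessYY (B.G (e i)) z.1 z.2.1 z.2.2) - hessYY B.g z.1 z.2.1 z.2.2) :=
    hψ₀.const_smul (-1 : ℝ)
  have hind := hS.indep.comp hφ hψ
  have h3 := (h1.add (h2.const_smul (-1)) hind).const_smul a.η
  have e : (fun ω => B.updV a z (fun i => ξ i ω, fun i => ζ i ω)
      - (z.2.2 - a.η • hessYY B.g z.1 z.2.1 z.2.2 + a.η • gradY B.f z.1 z.2.1)) = fun ω =>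
      a.η • ((batchMean a.Df (fun i => gradY (B.F (ξ i ω)) z.1 z.2.1) - gradY B.f z.1 z.2.1)
      + (-1 : ℝ) • (batchMean a.D (fun i => hessYY (B.G (ζ i ω)) z.1 z.2.1 z.2.2)
        - hessYY B.g z.1 z.2.1 z.2.2)) := by
    ext1 ω
    rw [Bilevel.updV, neg_one_smul, smul_add, smul_neg, smul_sub, smul_sub]
    abel
  rw [e]
  exact h3.mono (by norm_num)

end Bilevel.Assumptions

/-! ### Mean-square effect of a single step. -/

lemma norm_batchMean_le {V : Type*} [NormedAddCommGroup V] [NormedSpace ℝ V] {n : ℕ} (hn : 0 < n)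
    {u : ℕ → V} {K : ℝ} (h : ∀ i, ‖u i‖ ≤ K) : ‖batchMean n u‖ ≤ K := by
  have hn' : (0 : ℝ) < n := by positivity
  rw [batchMean, norm_smul, norm_inv, Real.norm_natCast, inv_mul_le_iff₀ hn']
  calc ‖∑ i ∈ Finset.range n, u i‖ ≤ ∑ i ∈ Finset.range n, ‖u i‖ := norm_sum_le _ _
    _ ≤ ∑ _i ∈ Finset.range n, K := Finset.sum_le_sum fun i _ => h i
    _ = n * K := by simp

namespace Bilevel.Assumptions

open scoped RealInnerProductSpace

variable {p q : ℕ} {ΞF ΞG : Type*} [MeasurableSpace ΞF] [MeasurableSpace ΞG]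
  {B : Bilevel p q ΞF ΞG} {c : Consts} {s : Noise} {a : Params}

/-- The linear-system step preserves the ball of radius `M / μ`. -/
lemma norm_updV_le (hB : B.Assumptions c s) (hc : c.Admissible) (hDf : 0 < a.Df) (hD : 0 < a.D)
    (hη : 0 ≤ a.η) (hηL : a.η * c.L ≤ 1) (z : Euc p × Euc q × Euc q)
    (e : (ℕ → ΞF) × (ℕ → ΞG)) (hv : ‖z.2.2‖ ≤ c.M / c.μ) : ‖B.updV a z e‖ ≤ c.M / c.μ := by
  have hμ := hc.μ_pos
  have hημ : a.η * c.μ ≤ 1 := (mul_le_mul_of_nonneg_left hc.μ_le hη).trans hηL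
  -- The step is an average of sample maps `I - ηH` applied to `v`, plus a term of norm at most
  -- `ηM`. Strong convexity of each sample makes every map contract, and `M/μ` is the fixed point of
  -- `r ↦ (1 - ημ) r + ηM`.
  have e1 : B.updV a z e
      = batchMean a.D (fun i => z.2.2 - a.η • hessYY (B.G (e.2 i)) z.1 z.2.1 z.2.2)
        + a.η • batchMean a.Df (fun i => gradY (B.F (e.1 i)) z.1 z.2.1) := by
    have hD' : (a.D : ℝ) ≠ 0 := by positivity
    simp only [Bilevel.updV, batchMean, Finset.sum_sub_distrib, ← Finset.smul_sum, smul_sub]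
    congr 1
    simp [← Nat.cast_smul_eq_nsmul ℝ, smul_smul, hD', mul_comm]
  rw [e1]
  have h1 : ‖batchMean a.D (fun i => z.2.2 - a.η • hessYY (B.G (e.2 i)) z.1 z.2.1 z.2.2)‖
      ≤ (1 - a.η * c.μ) * (c.M / c.μ) := norm_batchMean_le hD fun i =>
    (hB.norm_sub_smul_hessYY_G_le hc hη hηL _ _ _ _).trans
      (mul_le_mul_of_nonneg_left hv (by linarith))
  have h2 : ‖a.η • batchMean a.Df (fun i => gradY (B.F (e.1 i)) z.1 z.2.1)‖ ≤ a.η * c.M := by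
    rw [norm_smul, Real.norm_of_nonneg hη]
    exact mul_le_mul_of_nonneg_left (norm_batchMean_le hDf fun i => hB.norm_gradY_F_le hc _ _ _) hη
  calc _ ≤ (1 - a.η * c.μ) * (c.M / c.μ) + a.η * c.M := (norm_add_le _ _).trans (add_le_add h1 h2)
    _ = c.M / c.μ := by field_simp; ring

variable {Ω : Type*} [MeasurableSpace Ω] {P : Measure Ω} [IsProbabilityMeasure P]
  {ξ : ℕ → Ω → ΞF} {ζ : ℕ → Ω → ΞG} {X : Ω → Euc p × Euc q × Euc q}

/-- Mean-square contraction of a lower-level step from a random iterate `X = (x, y, v)`. -/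
lemma integral_updY_le (hB : B.Assumptions c s) (hc : c.Admissible) (hS : IsSampling P B ξ ζ)
    (hX : Measurable X) (hind : IndepFun X (fun ω => (fun i => ξ i ω, fun i => ζ i ω)) P)
    (hS' : 0 < a.S) (hβ : a.β = 1 / (2 * c.L))
    (hint : Integrable (fun ω => ‖(X ω).2.1 - B.yStar (X ω).1‖ ^ 2) P) :
    Integrable (fun ω => ‖B.updY a (X ω) (fun i => ξ i ω, fun i => ζ i ω)
      - B.yStar (X ω).1‖ ^ 2) P ∧
    ∫ ω, ‖B.updY a (X ω) (fun i => ξ i ω, fun i => ζ i ω) - B.yStar (X ω).1‖ ^ 2 ∂P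
      ≤ c.L / (c.μ + c.L) * ∫ ω, ‖(X ω).2.1 - B.yStar (X ω).1‖ ^ 2 ∂P
        + a.β ^ 2 * (s.σg ^ 2 / a.S) := by
  have hμ := hc.μ_pos
  have hL := hc.L_pos
  have hE : Measurable fun ω => ((fun i => ξ i ω, fun i => ζ i ω) : (ℕ → ΞF) × (ℕ → ΞG)) :=
    (measurable_pi_lambda _ hS.meas_ξ).prodMk (measurable_pi_lambda _ hS.meas_ζ)
  have hw : Integrable (fun ω => c.L / (c.μ + c.L) * ‖(X ω).2.1 - B.yStar (X ω).1‖ ^ 2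
      + a.β ^ 2 * (s.σg ^ 2 / a.S)) P := (hint.const_mul _).add (integrable_const _)
  have key := hind.integral_le hX hE (φ := fun w => ‖B.updY a w.1 w.2 - B.yStar w.1.1‖ ^ 2)
    (((hB.measurable_updY hc a).sub ((hB.continuous_yStar hc).measurable.comp (by fun_prop))).norm.pow_const 2)
    (fun _ => sq_nonneg _) hw (Filter.Eventually.of_forall fun ω => ?_)
  · refine ⟨key.1, key.2.trans (le_of_eq ?_)⟩
    rw [integral_add (hint.const_mul _) (integrable_const _), integral_const_mul]
    simp
  · have hN := hB.isNoise_updY hc hS hS' (X ω)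
    set b := (X ω).2.1 - a.β • gradY B.g (X ω).1 (X ω).2.1 - B.yStar (X ω).1
    have hb : ‖b‖ ^ 2 ≤ c.L / (c.μ + c.L) * ‖(X ω).2.1 - B.yStar (X ω).1‖ ^ 2 := by
      have h1 := hB.norm_gradient_step_sub_le hc (β := a.β) (by rw [hβ]; positivity)
        (by rw [hβ]; field_simp; norm_num) (X ω).1 (B.yStar (X ω).1) (X ω).2.1
      rw [hB.gradY_g_yStar hc, smul_zero, sub_zero] at h1
      have h2 : (1 - a.β * c.μ) ^ 2 ≤ c.L / (c.μ + c.L) := by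
        rw [hβ, le_div_iff₀ (by positivity)]
        -- With `t = μ/L` this reads `(1 - t/2)²(1 + t) = 1 - t²(3/4 - t/4)`, which is at most `1`
        -- for `t ≤ 1`.
        have e : (1 - 1 / (2 * c.L) * c.μ) ^ 2 * (c.μ + c.L)
            = c.L - c.μ ^ 2 / c.L * (3 / 4 - c.μ / c.L / 4) := by field_simp; ring
        have h3 : c.μ / c.L ≤ 1 := div_le_one_of_le₀ hc.μ_le hL.le
        have h4 : 0 ≤ c.μ ^ 2 / c.L * (3 / 4 - c.μ / c.L / 4) :=
          mul_nonneg (by positivity) (by linarith)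
        linarith
      calc ‖b‖ ^ 2 ≤ ((1 - a.β * c.μ) * ‖(X ω).2.1 - B.yStar (X ω).1‖) ^ 2 :=
            pow_le_pow_left₀ (norm_nonneg _) h1 2
        _ = (1 - a.β * c.μ) ^ 2 * ‖(X ω).2.1 - B.yStar (X ω).1‖ ^ 2 := by ring
        _ ≤ _ := by gcongr
    have h := hN.norm_sub_sq_le (B.yStar (X ω).1)
    exact ⟨h.1, h.2.trans (add_le_add hb le_rfl)⟩

/-- Mean-square contraction of a linear-system step from a random iterate `X = (x, y, v)`. -/
lemma integral_updV_le (hB : B.Assumptions c s) (hc : c.Admissible) (hS : IsSampling P B ξ ζ)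
    (hX : Measurable X) (hind : IndepFun X (fun ω => (fun i => ξ i ω, fun i => ζ i ω)) P)
    (hDf : 0 < a.Df) (hD : 0 < a.D) (hη : 0 ≤ a.η) (hηL : a.η * c.L ≤ 1)
    (hv : ∀ᵐ ω ∂P, ‖(X ω).2.2‖ ≤ c.M / c.μ)
    (hint : Integrable (fun ω => ‖(X ω).2.2 - B.vSol (X ω).1 (X ω).2.1‖ ^ 2) P) :
    Integrable (fun ω => ‖B.updV a (X ω) (fun i => ξ i ω, fun i => ζ i ω)
      - B.vSol (X ω).1 (X ω).2.1‖ ^ 2) P ∧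
    ∫ ω, ‖B.updV a (X ω) (fun i => ξ i ω, fun i => ζ i ω) - B.vSol (X ω).1 (X ω).2.1‖ ^ 2 ∂P
      ≤ (1 - a.η * c.μ) ^ 2 * ∫ ω, ‖(X ω).2.2 - B.vSol (X ω).1 (X ω).2.1‖ ^ 2 ∂P
        + a.η ^ 2 * (s.σf ^ 2 / a.Df + (c.M / c.μ) ^ 2 * s.σg2 ^ 2 / a.D) := by
  set N := a.η ^ 2 * (s.σf ^ 2 / a.Df + (c.M / c.μ) ^ 2 * s.σg2 ^ 2 / a.D)
  have hE : Measurable fun ω => ((fun i => ξ i ω, fun i => ζ i ω) : (ℕ → ΞF) × (ℕ → ΞG)) :=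
    (measurable_pi_lambda _ hS.meas_ξ).prodMk (measurable_pi_lambda _ hS.meas_ζ)
  have hw : Integrable (fun ω => (1 - a.η * c.μ) ^ 2
      * ‖(X ω).2.2 - B.vSol (X ω).1 (X ω).2.1‖ ^ 2 + N) P :=
    (hint.const_mul _).add (integrable_const _)
  have key := hind.integral_le hX hE
    (φ := fun w => ‖B.updV a w.1 w.2 - B.vSol w.1.1 w.1.2.1‖ ^ 2)
    (((hB.measurable_updV hc a).sub ((hB.continuous_vSol hc).measurable.comp
      (f := fun w : (Euc p × Euc q × Euc q) × (ℕ → ΞF) × (ℕ → ΞG) => (w.1.1, w.1.2.1))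
      (by fun_prop))).norm.pow_const 2)
    (fun _ => sq_nonneg _) hw (hv.mono fun ω hvω => ?_)
  · refine ⟨key.1, key.2.trans (le_of_eq ?_)⟩
    rw [integral_add (hint.const_mul _) (integrable_const _), integral_const_mul]
    simp
  · have hN := hB.isNoise_updV hc hS hDf hD (X ω) hvω
    set w := B.vSol (X ω).1 (X ω).2.1
    set m := (X ω).2.2 - a.η • hessYY B.g (X ω).1 (X ω).2.1 (X ω).2.2
      + a.η • gradY B.f (X ω).1 (X ω).2.1
    -- The mean step is affine with fixed point `vSol`, so it multiplies the error by `I - η∇²_y g`.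
    have hm : m - w = ((X ω).2.2 - w) - a.η • hessYY B.g (X ω).1 (X ω).2.1 ((X ω).2.2 - w) := by
      simp only [m, w, map_sub, hB.hessYY_g_vSol hc, smul_sub]; abel
    have hb : ‖m - w‖ ^ 2 ≤ (1 - a.η * c.μ) ^ 2 * ‖(X ω).2.2 - w‖ ^ 2 := by
      rw [hm, ← mul_pow]
      exact pow_le_pow_left₀ (norm_nonneg _) (hB.norm_sub_smul_hessYY_g_le hc hη hηL _ _ _) 2
    have h := hN.norm_sub_sq_le w
    exact ⟨h.1, h.2.trans (add_le_add hb le_rfl)⟩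

/-- Squared error of the mean hypergradient estimate. -/
lemma norm_gradient_Phi_sub_hyperGradMean_sq_le (hB : B.Assumptions c s) (hc : c.Admissible)
    (x : Euc p) (y v : Euc q) :
    ‖gradient B.Phi x - B.hyperGradMean x y v‖ ^ 2 ≤ 2 * (c.C1bar ^ 2 * ‖y - B.yStar x‖ ^ 2
      + c.L ^ 2 * ‖v - B.vSol x (B.yStar x)‖ ^ 2) := by
  have h := hB.norm_hyperGradMean_sub_le hc x x (B.yStar x) y _ v
    (hB.norm_vSol_le hc x (B.yStar x))
  rw [← hB.gradient_Phi hc, sub_self, norm_zero, zero_add, norm_sub_rev (B.yStar x),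
    norm_sub_rev (B.vSol _ _)] at h
  calc _ ≤ (c.C1bar * ‖y - B.yStar x‖ + c.L * ‖v - B.vSol x (B.yStar x)‖) ^ 2 :=
        pow_le_pow_left₀ (norm_nonneg _) h 2
    _ ≤ _ := by
      nlinarith [sq_nonneg (c.C1bar * ‖y - B.yStar x‖ - c.L * ‖v - B.vSol x (B.yStar x)‖)]

/-- Expected descent of an upper-level step from a fixed iterate `z = (x, y, v)`. -/
lemma integral_Phi_updX_le (hB : B.Assumptions c s) (hc : c.Admissible)
    (hS : IsSampling P B ξ ζ) (hDf : 0 < a.Df) (hDg : 0 < a.Dg) {m c₀ : ℝ}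
    (hm : ∀ x, m ≤ B.Phi x) (hc₀ : 0 ≤ c₀) (hα : 0 ≤ a.α)
    (hα' : (c.LPhi / 2 + c₀) * a.α ≤ 1 / 2) (z : Euc p × Euc q × Euc q)
    (hv : ‖z.2.2‖ ≤ c.M / c.μ) :
    Integrable (fun ω => B.Phi (z.1 - a.α • B.updX a z (fun i => ξ i ω, fun i => ζ i ω)) - m
      + c₀ * ‖a.α • B.updX a z (fun i => ξ i ω, fun i => ζ i ω)‖ ^ 2) P ∧
    ∫ ω, (B.Phi (z.1 - a.α • B.updX a z (fun i => ξ i ω, fun i => ζ i ω)) - m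
      + c₀ * ‖a.α • B.updX a z (fun i => ξ i ω, fun i => ζ i ω)‖ ^ 2) ∂P
      ≤ B.Phi z.1 - m - a.α / 2 * ‖gradient B.Phi z.1‖ ^ 2
        + a.α * (c.C1bar ^ 2 * ‖z.2.1 - B.yStar z.1‖ ^ 2
          + c.L ^ 2 * ‖z.2.2 - B.vSol z.1 (B.yStar z.1)‖ ^ 2)
        + a.α / 2 * (s.σf ^ 2 / a.Df + (c.M / c.μ) ^ 2 * s.σg1 ^ 2 / a.Dg) := by
  have hN := hB.isNoise_updX hc hS hDf hDg z hv
  have hE : Measurable fun ω => ((fun i => ξ i ω, fun i => ζ i ω) : (ℕ → ΞF) × (ℕ → ΞG)) :=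
    (measurable_pi_lambda _ hS.meas_ξ).prodMk (measurable_pi_lambda _ hS.meas_ζ)
  have hhm : Measurable fun ω => B.updX a z (fun i => ξ i ω, fun i => ζ i ω) :=
    ((hB.measurable_updX hc a).comp (measurable_prodMk_left (x := z))).comp hE
  have h1 := hB.norm_gradient_Phi_sub_hyperGradMean_sq_le hc z.1 z.2.1 z.2.2
  have key := hN.integral_descent_le hhm (hB.Phi_add_le hc z.1)
    (hB.differentiable_Phi hc).continuous.measurable hm hc₀ hα hα'
  refine ⟨key.1, key.2.trans ?_⟩
  have h2 := mul_le_mul_of_nonneg_left h1 (by positivity : 0 ≤ a.α / 2)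
  linarith

/-- Expected descent of an upper-level step from a random iterate `X = (x, y, v)`. -/
lemma integral_Phi_le (hB : B.Assumptions c s) (hc : c.Admissible) (hS : IsSampling P B ξ ζ)
    (hX : Measurable X) (hind : IndepFun X (fun ω => (fun i => ξ i ω, fun i => ζ i ω)) P)
    (hDf : 0 < a.Df) (hDg : 0 < a.Dg) {m c₀ : ℝ}
    (hm : ∀ x, m ≤ B.Phi x) (hc₀ : 0 ≤ c₀) (hα : 0 ≤ a.α)
    (hα' : (c.LPhi / 2 + c₀) * a.α ≤ 1 / 2)
    (hv : ∀ᵐ ω ∂P, ‖(X ω).2.2‖ ≤ c.M / c.μ)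
    (hΦ : Integrable (fun ω => B.Phi (X ω).1) P)
    (hG : Integrable (fun ω => ‖gradient B.Phi (X ω).1‖ ^ 2) P)
    (hy : Integrable (fun ω => ‖(X ω).2.1 - B.yStar (X ω).1‖ ^ 2) P)
    (hr : Integrable (fun ω => ‖(X ω).2.2 - B.vSol (X ω).1 (B.yStar (X ω).1)‖ ^ 2) P) :
    Integrable (fun ω => B.Phi ((X ω).1 - a.α • B.updX a (X ω) (fun i => ξ i ω, fun i => ζ i ω)) - m
      + c₀ * ‖a.α • B.updX a (X ω) (fun i => ξ i ω, fun i => ζ i ω)‖ ^ 2) P ∧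
    ∫ ω, (B.Phi ((X ω).1 - a.α • B.updX a (X ω) (fun i => ξ i ω, fun i => ζ i ω)) - m
      + c₀ * ‖a.α • B.updX a (X ω) (fun i => ξ i ω, fun i => ζ i ω)‖ ^ 2) ∂P
      ≤ ∫ ω, B.Phi (X ω).1 ∂P - m - a.α / 2 * ∫ ω, ‖gradient B.Phi (X ω).1‖ ^ 2 ∂P
        + a.α * (c.C1bar ^ 2 * ∫ ω, ‖(X ω).2.1 - B.yStar (X ω).1‖ ^ 2 ∂P
          + c.L ^ 2 * ∫ ω, ‖(X ω).2.2 - B.vSol (X ω).1 (B.yStar (X ω).1)‖ ^ 2 ∂P)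
        + a.α / 2 * (s.σf ^ 2 / a.Df + (c.M / c.μ) ^ 2 * s.σg1 ^ 2 / a.Dg) := by
  have hE : Measurable fun ω => ((fun i => ξ i ω, fun i => ζ i ω) : (ℕ → ΞF) × (ℕ → ΞG)) :=
    (measurable_pi_lambda _ hS.meas_ξ).prodMk (measurable_pi_lambda _ hS.meas_ζ)
  have hΦm : Measurable B.Phi := (hB.differentiable_Phi hc).continuous.measurable
  have hU : Measurable fun w : (Euc p × Euc q × Euc q) × (ℕ → ΞF) × (ℕ → ΞG) =>
    a.α • B.updX a w.1 w.2 := (hB.measurable_updX hc a).const_smul a.α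
  have i1 : Integrable (fun ω => B.Phi (X ω).1 - m) P := hΦ.sub (integrable_const m)
  have i2 : Integrable (fun ω => B.Phi (X ω).1 - m
      - a.α / 2 * ‖gradient B.Phi (X ω).1‖ ^ 2) P := i1.sub (hG.const_mul _)
  have i3' : Integrable (fun ω => c.C1bar ^ 2 * ‖(X ω).2.1 - B.yStar (X ω).1‖ ^ 2
      + c.L ^ 2 * ‖(X ω).2.2 - B.vSol (X ω).1 (B.yStar (X ω).1)‖ ^ 2) P :=
    (hy.const_mul _).add (hr.const_mul _)
  have i3 : Integrable (fun ω => B.Phi (X ω).1 - m - a.α / 2 * ‖gradient B.Phi (X ω).1‖ ^ 2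
      + a.α * (c.C1bar ^ 2 * ‖(X ω).2.1 - B.yStar (X ω).1‖ ^ 2
        + c.L ^ 2 * ‖(X ω).2.2 - B.vSol (X ω).1 (B.yStar (X ω).1)‖ ^ 2)) P :=
    i2.add (i3'.const_mul _)
  have i4 : Integrable (fun ω => B.Phi (X ω).1 - m - a.α / 2 * ‖gradient B.Phi (X ω).1‖ ^ 2
      + a.α * (c.C1bar ^ 2 * ‖(X ω).2.1 - B.yStar (X ω).1‖ ^ 2
        + c.L ^ 2 * ‖(X ω).2.2 - B.vSol (X ω).1 (B.yStar (X ω).1)‖ ^ 2)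
      + a.α / 2 * (s.σf ^ 2 / a.Df + (c.M / c.μ) ^ 2 * s.σg1 ^ 2 / a.Dg)) P :=
    i3.add (integrable_const _)
  have key := hind.integral_le hX hE (φ := fun w => B.Phi (w.1.1 - a.α • B.updX a w.1 w.2) - m
      + c₀ * ‖a.α • B.updX a w.1 w.2‖ ^ 2)
    (((hΦm.comp (measurable_fst.fst.sub hU)).sub_const m).add
      ((hU.norm.pow_const 2).const_mul c₀))
    (fun w => add_nonneg (sub_nonneg.2 (hm _)) (by positivity)) i4
    (hv.mono fun ω hvω => hB.integral_Phi_updX_le hc hS hDf hDg hm hc₀ hα hα' (X ω) hvω)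
  refine ⟨key.1, key.2.trans (le_of_eq ?_)⟩
  rw [integral_add i3 (integrable_const _), integral_add i2 (i3'.const_mul _),
    integral_sub i1 (hG.const_mul _), integral_sub hΦ (integrable_const m), integral_const_mul,
    integral_const_mul, integral_add (hy.const_mul _) (hr.const_mul _), integral_const_mul,
    integral_const_mul]
  simp

end Bilevel.Assumptions

/-! ### Which draws each stage of the run depends on, and independence of the next batch. -/

/-- The triple `(x, y, v)` of a state. -/
def State.triple {p q : ℕ} (s : State p q) : Euc p × Euc q × Euc q := (s.x, s.y, s.v)

/-- The draw with a given label is used before stage `(b, t, j)` of outer iteration `k`: the initial point,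
the samples of the previous iterations, those of the upper-level step if `b = 1`, of the first
`t` lower-level steps, and of the first `j` linear-system steps. -/
def IsUsedDraw (k b t j : ℕ) : Unit ⊕ FIdx ⊕ GIdx → Prop
  | .inl _ => True
  | .inr (.inl (.outer k' _)) => k' < k + b
  | .inr (.inl (.inner k' j' _)) => k' < k ∨ k' = k ∧ j' < j
  | .inr (.inr (.jac k' _)) => k' < k + b
  | .inr (.inr (.lower k' t' _)) => k' < k ∨ k' = k ∧ t' < t
  | .inr (.inr (.hess k' j' _)) => k' < k ∨ k' = k ∧ j' < j

/-- Labels of the draws used before stage `(b, t, j)` of outer iteration `k`. -/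
def usedDraws (k b t j : ℕ) : Set (Unit ⊕ FIdx ⊕ GIdx) := {i | IsUsedDraw k b t j i}

lemma usedDraws_mono {k b t j b' t' j' : ℕ} (hb : b ≤ b') (ht : t ≤ t') (hj : j ≤ j') :
    usedDraws k b t j ⊆ usedDraws k b' t' j' := by
  rintro (_ | (⟨k', i⟩ | ⟨k', j'', i⟩) | (⟨k', i⟩ | ⟨k', t'', i⟩ | ⟨k', j'', i⟩)) h <;>
    simp only [usedDraws, Set.mem_ofPred_eq, IsUsedDraw] at h ⊢ <;> omega

lemma usedDraws_subset_succ (k t j : ℕ) : usedDraws k 1 t j ⊆ usedDraws (k + 1) 0 0 0 := by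
  rintro (_ | (⟨k', i⟩ | ⟨k', j'', i⟩) | (⟨k', i⟩ | ⟨k', t'', i⟩ | ⟨k', j'', i⟩)) h <;>
    simp only [usedDraws, Set.mem_ofPred_eq, IsUsedDraw] at h ⊢ <;> omega

namespace Draws

variable {p q : ℕ} {ΞF ΞG Ω : Type*} [MeasurableSpace ΞF] [MeasurableSpace ΞG]
  (R : Draws p q ΞF ΞG Ω)

/-- The σ-algebra generated by a set of draws. -/
abbrev sigmaOf (A : Set (Unit ⊕ FIdx ⊕ GIdx)) : MeasurableSpace Ω := ⨆ i ∈ A, R.sigma i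

variable {R}

lemma sigma_le_sigmaOf {A : Set (Unit ⊕ FIdx ⊕ GIdx)} {i : Unit ⊕ FIdx ⊕ GIdx} (hi : i ∈ A) :
    R.sigma i ≤ R.sigmaOf A := le_iSup₂_of_le i hi le_rfl

lemma sigmaOf_mono {A A' : Set (Unit ⊕ FIdx ⊕ GIdx)} (h : A ⊆ A') :
    R.sigmaOf A ≤ R.sigmaOf A' := iSup₂_le fun _ hi => sigma_le_sigmaOf (h hi)

/-- The batches with the given labels. -/
def batches (R : Draws p q ΞF ΞG Ω) (φ : ℕ → FIdx) (ψ : ℕ → GIdx) (ω : Ω) :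
    (ℕ → ΞF) × (ℕ → ΞG) := (fun i => R.ξ (φ i) ω, fun i => R.ζ (ψ i) ω)

lemma measurable_ξ_sigmaOf {A : Set (Unit ⊕ FIdx ⊕ GIdx)} {φ : ℕ → FIdx}
    (hφ : ∀ i, .inr (.inl (φ i)) ∈ A) : Measurable[R.sigmaOf A] fun ω i => R.ξ (φ i) ω :=
  @measurable_pi_lambda _ _ _ (R.sigmaOf A) _ _ fun i =>
    (comap_measurable (R.ξ (φ i))).mono (sigma_le_sigmaOf (hφ i)) le_rfl

lemma measurable_ζ_sigmaOf {A : Set (Unit ⊕ FIdx ⊕ GIdx)} {ψ : ℕ → GIdx}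
    (hψ : ∀ i, .inr (.inr (ψ i)) ∈ A) : Measurable[R.sigmaOf A] fun ω i => R.ζ (ψ i) ω :=
  @measurable_pi_lambda _ _ _ (R.sigmaOf A) _ _ fun i =>
    (comap_measurable (R.ζ (ψ i))).mono (sigma_le_sigmaOf (hψ i)) le_rfl

lemma measurable_batches_sigmaOf {A : Set (Unit ⊕ FIdx ⊕ GIdx)} {φ : ℕ → FIdx} {ψ : ℕ → GIdx}
    (hφ : ∀ i, .inr (.inl (φ i)) ∈ A) (hψ : ∀ i, .inr (.inr (ψ i)) ∈ A) :
    Measurable[R.sigmaOf A] (R.batches φ ψ) :=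
  (measurable_ξ_sigmaOf hφ).prodMk (measurable_ζ_sigmaOf hψ)

namespace Valid

variable [MeasurableSpace Ω] {B : Bilevel p q ΞF ΞG} {c : Consts} {P : Measure Ω}

lemma sigma_le (hR : R.Valid B c P) : ∀ i, R.sigma i ≤ ‹MeasurableSpace Ω›
  | .inl _ => hR.meas_init.comap_le
  | .inr (.inl i) => (hR.meas_ξ i).comap_le
  | .inr (.inr i) => (hR.meas_ζ i).comap_le

lemma sigmaOf_le (hR : R.Valid B c P) (A : Set (Unit ⊕ FIdx ⊕ GIdx)) :
    R.sigmaOf A ≤ ‹MeasurableSpace Ω› := iSup₂_le fun i _ => hR.sigma_le i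

lemma indepFun (hR : R.Valid B c P) {A A' : Set (Unit ⊕ FIdx ⊕ GIdx)} (hA : Disjoint A A')
    {Z E : Type*} [MeasurableSpace Z] [MeasurableSpace E] {X : Ω → Z} {e : Ω → E}
    (hX : Measurable[R.sigmaOf A] X) (he : Measurable[R.sigmaOf A'] e) : IndepFun X e P := by
  rw [IndepFun_iff_Indep]
  exact indep_of_indep_of_le (indep_iSup_of_disjoint hR.sigma_le hR.indep hA)
    hX.comap_le he.comap_le

lemma isSampling (hR : R.Valid B c P) {φ : ℕ → FIdx} {ψ : ℕ → GIdx} (hφ : Function.Injective φ)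
    (hψ : Function.Injective ψ) : IsSampling P B (fun i => R.ξ (φ i)) fun i => R.ζ (ψ i) where
  meas_ξ _ := hR.meas_ξ _
  meas_ζ _ := hR.meas_ζ _
  law_ξ _ := hR.law_ξ _
  law_ζ _ := hR.law_ζ _
  iIndep_ξ := by
    rw [iIndepFun_iff_iIndep]
    exact hR.indep.precomp (g := fun i => .inr (.inl (φ i)))
      (Sum.inr_injective.comp (Sum.inl_injective.comp hφ))
  iIndep_ζ := by
    rw [iIndepFun_iff_iIndep]
    exact hR.indep.precomp (g := fun i => .inr (.inr (ψ i)))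
      (Sum.inr_injective.comp (Sum.inr_injective.comp hψ))
  indep := by
    refine hR.indepFun (A := Set.range fun i => .inr (.inl (φ i)))
      (A' := Set.range fun i => .inr (.inr (ψ i))) ?_
      (measurable_ξ_sigmaOf fun i => ⟨i, rfl⟩) (measurable_ζ_sigmaOf fun i => ⟨i, rfl⟩)
    rw [Set.disjoint_left]
    rintro _ ⟨i, rfl⟩ ⟨j, hj⟩
    simp at hj

/-- A state depending on the draws in `A` is independent of batches with labels outside `A`. -/
lemma indepFun_batches (hR : R.Valid B c P) {A : Set (Unit ⊕ FIdx ⊕ GIdx)} {Z : Type*}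
    [MeasurableSpace Z] {X : Ω → Z} (hX : Measurable[R.sigmaOf A] X) {φ : ℕ → FIdx} {ψ : ℕ → GIdx}
    (hφ : ∀ i, .inr (.inl (φ i)) ∉ A) (hψ : ∀ i, .inr (.inr (ψ i)) ∉ A) :
    IndepFun X (R.batches φ ψ) P :=
  hR.indepFun disjoint_compl_right hX (measurable_batches_sigmaOf hφ hψ)

end Valid

/-! ### The stages of an outer iteration -/

variable (R) (B : Bilevel p q ΞF ΞG) (a : Params)

/-- The state after the upper-level step of outer iteration `k`. -/
def runX (k : ℕ) (ω : Ω) : State p q :=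
  B.stepX a (fun i => R.ξ i ω) (fun i => R.ζ i ω) k (R.run B a k ω)

/-- The state after `t` lower-level steps of outer iteration `k`. -/
def runY (k t : ℕ) (ω : Ω) : State p q := B.loopY a (fun i => R.ζ i ω) k (R.runX B a k ω) t

/-- The state after `j` linear-system steps of outer iteration `k`. -/
def runV (k j : ℕ) (ω : Ω) : State p q :=
  B.loopV a (fun i => R.ξ i ω) (fun i => R.ζ i ω) k (R.runY B a k a.T ω) j

lemma run_succ (k : ℕ) (ω : Ω) : R.run B a (k + 1) ω = R.runV B a k a.J ω := rfl

/-- Batches of the upper-level step. -/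
abbrev batchesX (k : ℕ) : Ω → (ℕ → ΞF) × (ℕ → ΞG) := R.batches (.outer k) (.jac k)

/-- Batches of a lower-level step, together with unused samples of `ξ`. -/
abbrev batchesY (k t : ℕ) : Ω → (ℕ → ΞF) × (ℕ → ΞG) := R.batches (.inner k 0) (.lower k t)

/-- Batches of a linear-system step. -/
abbrev batchesV (k j : ℕ) : Ω → (ℕ → ΞF) × (ℕ → ΞG) := R.batches (.inner k j) (.hess k j)

lemma runX_x (k : ℕ) (ω : Ω) : (R.runX B a k ω).x
    = (R.run B a k ω).x - a.α • B.updX a (R.run B a k ω).triple (R.batchesX k ω) := rfl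

lemma runY_x (k t : ℕ) (ω : Ω) : (R.runY B a k t ω).x = (R.runX B a k ω).x := by
  induction t with
  | zero => rfl
  | succ t ih => exact ih

lemma runY_y_succ (k t : ℕ) (ω : Ω) : (R.runY B a k (t + 1) ω).y
    = B.updY a (R.runY B a k t ω).triple (R.batchesY k t ω) := rfl

lemma runY_v (k t : ℕ) (ω : Ω) : (R.runY B a k t ω).v = (R.run B a k ω).v := by
  induction t with
  | zero => rfl
  | succ t ih => exact ih

lemma runV_x (k j : ℕ) (ω : Ω) : (R.runV B a k j ω).x = (R.runX B a k ω).x := by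
  induction j with
  | zero => exact R.runY_x B a k a.T ω
  | succ j ih => exact ih

lemma runV_y (k j : ℕ) (ω : Ω) : (R.runV B a k j ω).y = (R.runY B a k a.T ω).y := by
  induction j with
  | zero => rfl
  | succ j ih => exact ih

lemma runV_v_zero (k : ℕ) (ω : Ω) : (R.runV B a k 0 ω).v = (R.run B a k ω).v :=
  R.runY_v B a k a.T ω

lemma runV_v_succ (k j : ℕ) (ω : Ω) : (R.runV B a k (j + 1) ω).v
    = B.updV a (R.runV B a k j ω).triple (R.batchesV k j ω) := rfl

variable {R B a}

section Measurability

variable {c : Consts} {s : Noise}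

lemma _root_.Measurable.triple {m : MeasurableSpace Ω} {S : Ω → State p q}
    (hx : Measurable[m] fun ω => (S ω).x) (hy : Measurable[m] fun ω => (S ω).y)
    (hv : Measurable[m] fun ω => (S ω).v) : Measurable[m] fun ω => (S ω).triple :=
  hx.prodMk (hy.prodMk hv)

lemma measurable_runX_of_run (hB : B.Assumptions c s) (hc : c.Admissible) {k : ℕ}
    (h : Measurable[R.sigmaOf (usedDraws k 0 0 0)] fun ω => (R.run B a k ω).triple) :
    Measurable[R.sigmaOf (usedDraws k 1 0 0)] fun ω => (R.runX B a k ω).triple := by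
  have h' := h.mono (sigmaOf_mono (usedDraws_mono zero_le_one le_rfl le_rfl :
    usedDraws k 0 0 0 ⊆ usedDraws k 1 0 0)) le_rfl
  have he : Measurable[R.sigmaOf (usedDraws k 1 0 0)] (R.batchesX k) :=
    measurable_batches_sigmaOf (fun _ => Nat.lt_succ_self k) (fun _ => Nat.lt_succ_self k)
  exact Measurable.triple (h'.fst.sub (((hB.measurable_updX hc a).comp
    (h'.prodMk he)).const_smul a.α)) h'.snd.fst h'.snd.snd

lemma measurable_runY_of_runX (hB : B.Assumptions c s) (hc : c.Admissible) {k : ℕ}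
    (h : Measurable[R.sigmaOf (usedDraws k 1 0 0)] fun ω => (R.runX B a k ω).triple) (t : ℕ) :
    Measurable[R.sigmaOf (usedDraws k 1 t 0)] fun ω => (R.runY B a k t ω).triple := by
  induction t with
  | zero => exact h
  | succ t ih =>
    have h' := ih.mono (sigmaOf_mono (usedDraws_mono le_rfl t.le_succ le_rfl :
      usedDraws k 1 t 0 ⊆ usedDraws k 1 (t + 1) 0)) le_rfl
    have he : Measurable[R.sigmaOf (usedDraws k 1 (t + 1) 0)] fun ω i => R.ζ (.lower k t i) ω :=
      measurable_ζ_sigmaOf fun _ => Or.inr ⟨rfl, Nat.lt_succ_self t⟩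
    -- `updY` formally takes a `ξ`-batch too, whose labels `.inner k 0` lie outside the draws
    -- allowed here; the step is therefore written as a function of the `ζ`-batch alone.
    have hu : Measurable fun w : (Euc p × Euc q × Euc q) × (ℕ → ΞG) =>
        w.1.2.1 - a.β • batchMean a.S (fun i => gradY (B.G (w.2 i)) w.1.1 w.1.2.1) := by
      refine (by fun_prop : Measurable fun w : (Euc p × Euc q × Euc q) × (ℕ → ΞG) =>
        w.1.2.1).sub ((measurable_batchMean _ fun i => ?_).const_smul a.β)
      exact (hB.measurable_uncurry_gradY_G hc).comp (f := fun w : (Euc p × Euc q × Euc q) ×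
        (ℕ → ΞG) => ((w.1.1, w.1.2.1), w.2 i)) (by fun_prop)
    exact Measurable.triple h'.fst (hu.comp (h'.prodMk he)) h'.snd.snd

lemma measurable_runV_of_runY (hB : B.Assumptions c s) (hc : c.Admissible) {k : ℕ}
    (h : Measurable[R.sigmaOf (usedDraws k 1 a.T 0)] fun ω => (R.runY B a k a.T ω).triple)
    (j : ℕ) : Measurable[R.sigmaOf (usedDraws k 1 a.T j)] fun ω => (R.runV B a k j ω).triple := by
  induction j with
  | zero => exact h
  | succ j ih =>
    have h' := ih.mono (sigmaOf_mono (usedDraws_mono le_rfl le_rfl j.le_succ :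
      usedDraws k 1 a.T j ⊆ usedDraws k 1 a.T (j + 1))) le_rfl
    have he : Measurable[R.sigmaOf (usedDraws k 1 a.T (j + 1))] (R.batchesV k j) :=
      measurable_batches_sigmaOf (fun _ => Or.inr ⟨rfl, Nat.lt_succ_self j⟩)
        (fun _ => Or.inr ⟨rfl, Nat.lt_succ_self j⟩)
    exact Measurable.triple h'.fst h'.snd.fst ((hB.measurable_updV hc a).comp (h'.prodMk he))

lemma measurable_run_sigmaOf (hB : B.Assumptions c s) (hc : c.Admissible) (k : ℕ) :
    Measurable[R.sigmaOf (usedDraws k 0 0 0)] fun ω => (R.run B a k ω).triple := by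
  induction k with
  | zero =>
    exact (comap_measurable fun ω => (R.x₀ ω, R.y₀ ω, R.v₀ ω)).mono
      (sigma_le_sigmaOf (i := .inl ()) trivial) le_rfl
  | succ k ih =>
    exact (measurable_runV_of_runY hB hc (measurable_runY_of_runX hB hc
      (measurable_runX_of_run hB hc ih) a.T) a.J).mono
      (sigmaOf_mono (usedDraws_subset_succ k a.T a.J)) le_rfl

lemma measurable_runX_sigmaOf (hB : B.Assumptions c s) (hc : c.Admissible) (k : ℕ) :
    Measurable[R.sigmaOf (usedDraws k 1 0 0)] fun ω => (R.runX B a k ω).triple :=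
  measurable_runX_of_run hB hc (measurable_run_sigmaOf hB hc k)

lemma measurable_runY_sigmaOf (hB : B.Assumptions c s) (hc : c.Admissible) (k t : ℕ) :
    Measurable[R.sigmaOf (usedDraws k 1 t 0)] fun ω => (R.runY B a k t ω).triple :=
  measurable_runY_of_runX hB hc (measurable_runX_sigmaOf hB hc k) t

lemma measurable_runV_sigmaOf (hB : B.Assumptions c s) (hc : c.Admissible) (k j : ℕ) :
    Measurable[R.sigmaOf (usedDraws k 1 a.T j)] fun ω => (R.runV B a k j ω).triple :=
  measurable_runV_of_runY hB hc (measurable_runY_sigmaOf hB hc k a.T) j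

end Measurability

end Draws

/-! ### Lyapunov analysis of one outer iteration and of the whole run. -/

/-- The weight of `‖x⁺ - x‖²` in the Lyapunov analysis. -/
def Consts.stepWeight (c : Consts) (ρ₁ ρ₂ : ℝ) : ℝ :=
  ρ₁ / 2 * (c.L ^ 2 / c.μ ^ 2) + 4 * ρ₂ * c.C22 1

/-- The conditions on the parameters under which the Lyapunov function decreases. -/
structure Params.Suitable (a : Params) (c : Consts) (ρ₁ ρ₂ : ℝ) : Prop where
  Df_pos : 0 < a.Df
  Dg_pos : 0 < a.Dg
  S_pos : 0 < a.S
  D_pos : 0 < a.D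
  β_eq : a.β = 1 / (2 * c.L)
  η_pos : 0 < a.η
  η_le : a.η * c.L ≤ 1
  α_pos : 0 < a.α
  ρ₁_pos : 0 < ρ₁
  ρ₂_pos : 0 < ρ₂
  α_smooth : (c.LPhi / 2 + c.stepWeight ρ₁ ρ₂) * a.α ≤ 1 / 2
  α_y : a.α * c.C1bar ^ 2 ≤ ρ₁ / 4
  α_v : a.α * c.L ^ 2 ≤ ρ₂ / 4
  T_large : (c.L / (c.μ + c.L)) ^ a.T * (ρ₁ + c.C24 1 * ρ₂) ≤ ρ₁ / 8
  J_large : (1 - a.η * c.μ) ^ a.J ≤ 1 / 16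

/-- The noise floor of the lower-level loop. -/
def noiseY (c : Consts) (s : Noise) (a : Params) : ℝ :=
  a.β * (c.μ + c.L) / (2 * c.μ * c.L) * (s.σg ^ 2 / a.S)

/-- The noise floor of the linear-system loop. -/
def noiseV (c : Consts) (s : Noise) (a : Params) : ℝ :=
  a.η / c.μ * (s.σf ^ 2 / a.Df + (c.M / c.μ) ^ 2 * s.σg2 ^ 2 / a.D)

/-- The variance of the hypergradient estimate. -/
def noiseX (c : Consts) (s : Noise) (a : Params) : ℝ :=
  s.σf ^ 2 / a.Df + (c.M / c.μ) ^ 2 * s.σg1 ^ 2 / a.Dg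

lemma integrable_norm_sub_sq_of_norm_le {Ω V : Type*} [MeasurableSpace Ω] {P : Measure Ω}
    [IsFiniteMeasure P] [NormedAddCommGroup V] [MeasurableSpace V] [BorelSpace V]
    [SecondCountableTopology V] {X Y : Ω → V} {K : ℝ} (hX : Measurable X) (hY : Measurable Y)
    (hXK : ∀ᵐ ω ∂P, ‖X ω‖ ≤ K) (hYK : ∀ ω, ‖Y ω‖ ≤ K) :
    Integrable (fun ω => ‖X ω - Y ω‖ ^ 2) P := by
  refine Integrable.of_bound ((hX.sub hY).norm.pow_const 2).aestronglyMeasurable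
    ((K + K) ^ 2) (hXK.mono fun ω h => ?_)
  rw [Real.norm_of_nonneg (sq_nonneg _)]
  exact pow_le_pow_left₀ (norm_nonneg _) ((norm_sub_le _ _).trans (add_le_add h (hYK ω))) 2

/-- A sequence with `uₙ₊₁ ≤ r uₙ + b` stays below `rⁿ u₀ + N` when `r N + b ≤ N`. -/
lemma le_pow_mul_add_of_le_mul_add {u : ℕ → ℝ} {r b N : ℝ} (hr : 0 ≤ r) (hN0 : 0 ≤ N)
    (hN : r * N + b ≤ N) (h : ∀ n, u (n + 1) ≤ r * u n + b) (n : ℕ) :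
    u n ≤ r ^ n * u 0 + N := by
  induction n with
  | zero => simpa using hN0
  | succ n ih =>
    have := mul_le_mul_of_nonneg_left ih hr
    rw [pow_succ]
    linarith [h n]

namespace Draws.Valid

variable {p q : ℕ} {ΞF ΞG Ω : Type*} [MeasurableSpace ΞF] [MeasurableSpace ΞG]
  {B : Bilevel p q ΞF ΞG}
  {R : Draws p q ΞF ΞG Ω} {c : Consts} {s : Noise} {a : Params} {ρ₁ ρ₂ : ℝ}

/-- Pathwise invariance of the ball of radius `M/μ`. It supplies integrability of every `v`-error
and the bound on `v` required by the matrix noise. -/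
lemma norm_runV_v_le (hB : B.Assumptions c s) (hc : c.Admissible) (ha : a.Suitable c ρ₁ ρ₂)
    {k : ℕ} {ω : Ω} (h : ‖(R.run B a k ω).v‖ ≤ c.M / c.μ) (j : ℕ) :
    ‖(R.runV B a k j ω).v‖ ≤ c.M / c.μ := by
  induction j with
  | zero => rwa [runV_v_zero]
  | succ j ih =>
    rw [runV_v_succ]
    exact hB.norm_updV_le hc ha.Df_pos ha.D_pos ha.η_pos.le ha.η_le _ _ ih

variable [MeasurableSpace Ω] {P : Measure Ω}

lemma measurable_run (hR : R.Valid B c P) (hB : B.Assumptions c s) (hc : c.Admissible) (k : ℕ) :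
    Measurable fun ω => (R.run B a k ω).triple :=
  (measurable_run_sigmaOf hB hc k).mono (hR.sigmaOf_le _) le_rfl

lemma measurable_runX (hR : R.Valid B c P) (hB : B.Assumptions c s) (hc : c.Admissible) (k : ℕ) :
    Measurable fun ω => (R.runX B a k ω).triple :=
  (measurable_runX_sigmaOf hB hc k).mono (hR.sigmaOf_le _) le_rfl

lemma measurable_runY (hR : R.Valid B c P) (hB : B.Assumptions c s) (hc : c.Admissible)
    (k t : ℕ) : Measurable fun ω => (R.runY B a k t ω).triple :=
  (measurable_runY_sigmaOf hB hc k t).mono (hR.sigmaOf_le _) le_rfl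

lemma measurable_runV (hR : R.Valid B c P) (hB : B.Assumptions c s) (hc : c.Admissible)
    (k j : ℕ) : Measurable fun ω => (R.runV B a k j ω).triple :=
  (measurable_runV_sigmaOf hB hc k j).mono (hR.sigmaOf_le _) le_rfl

lemma ae_norm_run_v_le (hR : R.Valid B c P) (hB : B.Assumptions c s) (hc : c.Admissible)
    (ha : a.Suitable c ρ₁ ρ₂) (k : ℕ) : ∀ᵐ ω ∂P, ‖(R.run B a k ω).v‖ ≤ c.M / c.μ := by
  filter_upwards [hR.bound_v₀] with ω hω
  induction k with
  | zero => exact hω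
  | succ k ih => exact norm_runV_v_le hB hc ha ih a.J

variable [IsProbabilityMeasure P]

lemma integrable_norm_v_sub_vSol (hB : B.Assumptions c s) (hc : c.Admissible) {X : Ω → Euc p}
    {Y V : Ω → Euc q} (hX : Measurable X) (hY : Measurable Y) (hV : Measurable V)
    (h : ∀ᵐ ω ∂P, ‖V ω‖ ≤ c.M / c.μ) :
    Integrable (fun ω => ‖V ω - B.vSol (X ω) (Y ω)‖ ^ 2) P := by
  have hm : Measurable fun ω => B.vSol (X ω) (Y ω) :=
    (hB.continuous_vSol hc).measurable.comp (f := fun ω => (X ω, Y ω)) (hX.prodMk hY)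
  exact integrable_norm_sub_sq_of_norm_le hV hm h fun _ => hB.norm_vSol_le hc _ _

/-- The lower-level loop. -/
lemma integral_runY_le (hR : R.Valid B c P) (hB : B.Assumptions c s) (hc : c.Admissible)
    (ha : a.Suitable c ρ₁ ρ₂) (k : ℕ)
    (h : Integrable (fun ω => ‖(R.run B a k ω).y - B.yStar (R.runX B a k ω).x‖ ^ 2) P) (t : ℕ) :
    Integrable (fun ω => ‖(R.runY B a k t ω).y - B.yStar (R.runX B a k ω).x‖ ^ 2) P ∧
    ∫ ω, ‖(R.runY B a k t ω).y - B.yStar (R.runX B a k ω).x‖ ^ 2 ∂P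
      ≤ (c.L / (c.μ + c.L)) ^ t
          * ∫ ω, ‖(R.run B a k ω).y - B.yStar (R.runX B a k ω).x‖ ^ 2 ∂P + noiseY c s a := by
  have hμ := hc.μ_pos
  have hL := hc.L_pos
  have hstep : ∀ t,
      Integrable (fun ω => ‖(R.runY B a k t ω).y - B.yStar (R.runX B a k ω).x‖ ^ 2) P →
      Integrable (fun ω => ‖(R.runY B a k (t + 1) ω).y - B.yStar (R.runX B a k ω).x‖ ^ 2) P ∧
      ∫ ω, ‖(R.runY B a k (t + 1) ω).y - B.yStar (R.runX B a k ω).x‖ ^ 2 ∂P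
        ≤ c.L / (c.μ + c.L) * ∫ ω, ‖(R.runY B a k t ω).y - B.yStar (R.runX B a k ω).x‖ ^ 2 ∂P
          + a.β ^ 2 * (s.σg ^ 2 / a.S) := by
    intro t ht
    -- The `y`-step reads no `ξ`; the labels `.inner k 0` only fill the slot. They are not drawn
    -- until the linear-system loop, so independence of the current state holds for them as well.
    have hS := hR.isSampling (φ := .inner k 0) (ψ := .lower k t)
      (fun i j h => by simpa using h) (fun i j h => by simpa using h)
    have hind := hR.indepFun_batches (measurable_runY_sigmaOf (a := a) hB hc k t)
      (φ := .inner k 0) (ψ := .lower k t)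
      (fun i => by simp [usedDraws, IsUsedDraw]) (fun i => by simp [usedDraws, IsUsedDraw])
    have := hB.integral_updY_le hc hS (hR.measurable_runY hB hc k t) hind ha.S_pos ha.β_eq
    simp only [State.triple, runY_x] at this
    simpa only [runY_y_succ, State.triple, runY_x, batches] using this ht
  have hint : ∀ t,
      Integrable (fun ω => ‖(R.runY B a k t ω).y - B.yStar (R.runX B a k ω).x‖ ^ 2) P := by
    intro t
    induction t with
    | zero => exact h
    | succ t ih => exact (hstep t ih).1
  refine ⟨hint t, ?_⟩
  have hβ : 0 ≤ a.β := by rw [ha.β_eq]; positivity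
  -- `noiseY` is the exact fixed point of `u ↦ r u + b`, hence the equality to be checked.
  refine le_pow_mul_add_of_le_mul_add (r := c.L / (c.μ + c.L)) (N := noiseY c s a)
    (u := fun t => ∫ ω, ‖(R.runY B a k t ω).y - B.yStar (R.runX B a k ω).x‖ ^ 2 ∂P)
    (by positivity) (by unfold noiseY; positivity) (le_of_eq ?_) (fun t => (hstep t (hint t)).2) t
  have hS : (a.S : ℝ) ≠ 0 := by have := ha.S_pos; positivity
  rw [noiseY, ha.β_eq]
  field_simp
  ring

/-- The linear-system loop. -/
lemma integral_runV_le (hR : R.Valid B c P) (hB : B.Assumptions c s) (hc : c.Admissible)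
    (ha : a.Suitable c ρ₁ ρ₂) (k j : ℕ) :
    ∫ ω, ‖(R.runV B a k j ω).v - B.vSol (R.runX B a k ω).x (R.runY B a k a.T ω).y‖ ^ 2 ∂P
      ≤ ((1 - a.η * c.μ) ^ 2) ^ j * ∫ ω, ‖(R.run B a k ω).v
          - B.vSol (R.runX B a k ω).x (R.runY B a k a.T ω).y‖ ^ 2 ∂P + noiseV c s a := by
  have hμ := hc.μ_pos
  have hL := hc.L_pos
  have hη := ha.η_pos
  have hημ : a.η * c.μ ≤ 1 := (mul_le_mul_of_nonneg_left hc.μ_le hη.le).trans ha.η_le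
  have hvb : ∀ j, ∀ᵐ ω ∂P, ‖(R.runV B a k j ω).v‖ ≤ c.M / c.μ := fun j =>
    (hR.ae_norm_run_v_le hB hc ha k).mono fun ω hω => norm_runV_v_le hB hc ha hω j
  -- The target is the solution of the system at the current `y`, which stays fixed during the loop;
  -- its distance to the solution at `y*` is charged later to the `y`-error through `C₁`.
  have hstep : ∀ j,
      ∫ ω, ‖(R.runV B a k (j + 1) ω).v - B.vSol (R.runX B a k ω).x (R.runY B a k a.T ω).y‖ ^ 2 ∂P
        ≤ (1 - a.η * c.μ) ^ 2 * ∫ ω, ‖(R.runV B a k j ω).v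
          - B.vSol (R.runX B a k ω).x (R.runY B a k a.T ω).y‖ ^ 2 ∂P
          + a.η ^ 2 * (s.σf ^ 2 / a.Df + (c.M / c.μ) ^ 2 * s.σg2 ^ 2 / a.D) := by
    intro j
    have hS := hR.isSampling (φ := .inner k j) (ψ := .hess k j)
      (fun i j h => by simpa using h) (fun i j h => by simpa using h)
    have hind := hR.indepFun_batches (measurable_runV_sigmaOf (a := a) hB hc k j)
      (φ := .inner k j) (ψ := .hess k j)
      (fun i => by simp [usedDraws, IsUsedDraw]) (fun i => by simp [usedDraws, IsUsedDraw])
    have hm := hR.measurable_runV (a := a) hB hc k j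
    have := hB.integral_updV_le hc hS hm hind ha.Df_pos ha.D_pos hη.le ha.η_le (hvb j)
      (integrable_norm_v_sub_vSol hB hc hm.fst hm.snd.fst hm.snd.snd (hvb j))
    simp only [State.triple, runV_x, runV_y] at this
    simpa only [runV_v_succ, State.triple, runV_x, runV_y, batches] using this.2
  have := le_pow_mul_add_of_le_mul_add (u := fun j => ∫ ω, ‖(R.runV B a k j ω).v
    - B.vSol (R.runX B a k ω).x (R.runY B a k a.T ω).y‖ ^ 2 ∂P) (sq_nonneg (1 - a.η * c.μ))
    (N := noiseV c s a) (by unfold noiseV; positivity) ?_ hstep j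
  · simpa only [runV_v_zero] using this
  · set W := s.σf ^ 2 / a.Df + (c.M / c.μ) ^ 2 * s.σg2 ^ 2 / a.D with hW
    have hW0 : 0 ≤ W := by positivity
    -- Here the noise floor is only a supersolution: one factor `1 - ημ` of the squared contraction
    -- is given away, leaving a nonnegative surplus.
    have e : (1 - a.η * c.μ) ^ 2 * noiseV c s a + a.η ^ 2 * W
        = noiseV c s a - a.η ^ 2 * (1 - a.η * c.μ) * W := by
      rw [noiseV, ← hW]; field_simp; ring
    rw [e]
    have : 0 ≤ a.η ^ 2 * (1 - a.η * c.μ) * W :=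
      mul_nonneg (mul_nonneg (sq_nonneg _) (by linarith)) hW0
    linarith

end Draws.Valid

/-- The arithmetic of one iteration. The letters `e, r` are the mean squared errors of `y` and `v`,
with primes after the iteration; `y₀` is the error against the new `y*` before the lower loop; `w₀,
w'` are the errors against the system at the new `y`, before and after the linear loop. `A, D` are
the contraction factors of the loops, `dx` is the mean squared step and `G` the mean of `‖∇Φ‖²`.
Besides noise, the right side collects `ρ₁/2 · e` and `ρ₂/2 · r`, half of each weight. The multiple
of `dx` is at most `stepWeight`, and the `v`-error brings in `5/2 · ρ₂ C₁² e'`, well below the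
reserve `C₂₄ρ₂ e'`. -/
lemma lyapunov_decrease {c : Consts} (hμ : 0 < c.μ) {ρ₁ ρ₂ α A D m EΦ EΦ' G e e' r r' y₀ w₀ w' dx
    Nx Ny Nv : ℝ} (hρ₁ : 0 ≤ ρ₁) (hρ₂ : 0 ≤ ρ₂)
    (he : 0 ≤ e) (hr : 0 ≤ r) (he' : 0 ≤ e') (hdx : 0 ≤ dx) (hw₀ : 0 ≤ w₀) (hy₀ : 0 ≤ y₀)
    (hA : A * (ρ₁ + c.C24 1 * ρ₂) ≤ ρ₁ / 8) (hD : D ≤ 1 / 16)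
    (hαy : α * c.C1bar ^ 2 ≤ ρ₁ / 4) (hαv : α * c.L ^ 2 ≤ ρ₂ / 4)
    (h1 : EΦ' - m + c.stepWeight ρ₁ ρ₂ * dx
      ≤ EΦ - m - α / 2 * G + α * (c.C1bar ^ 2 * e + c.L ^ 2 * r) + α / 2 * Nx)
    (h2 : e' ≤ A * y₀ + Ny) (h3 : y₀ ≤ 2 * e + 2 * (c.L / c.μ) ^ 2 * dx)
    (h4 : r' ≤ 2 * w' + 2 * c.C1 ^ 2 * e') (h5 : w' ≤ D * w₀ + Nv)
    (h6 : w₀ ≤ 2 * r + 2 * c.C1 ^ 2 * (2 * e' + 2 * (1 + c.L / c.μ) ^ 2 * dx)) :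
    EΦ' + ρ₁ * e' + ρ₂ * r' + α / 2 * G ≤ EΦ + ρ₁ * e + ρ₂ * r
      + (α / 2 * Nx + (ρ₁ + c.C24 1 * ρ₂) * Ny + 2 * ρ₂ * Nv) := by
  set κ := c.L / c.μ
  set Q := c.C1 ^ 2
  have hQ : 0 ≤ Q := sq_nonneg _
  have hC24 : c.C24 1 = 34 * Q := by
    simp only [Consts.C24, Q]
    ring
  have hw : c.stepWeight ρ₁ ρ₂ = ρ₁ / 2 * κ ^ 2 + 8 * ρ₂ * ((2 + 8 * κ ^ 2) * Q) := by
    rw [Consts.stepWeight, Consts.C22]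
    simp only [κ, Q, div_pow]
    field_simp
    ring
  have k1 : α * (c.C1bar ^ 2 * e + c.L ^ 2 * r) ≤ ρ₁ / 4 * e + ρ₂ / 4 * r := by
    have := mul_le_mul_of_nonneg_right hαy he
    have := mul_le_mul_of_nonneg_right hαv hr
    linarith
  -- The `y`-error is weighted by `ρ₁ + C₂₄ρ₂`, not by `ρ₁`: the surplus pays for the part of the
  -- new `v`-error caused by `y ≠ y*`. This is why the condition on `T` involves `C₂₄`.
  have k2 : (ρ₁ + c.C24 1 * ρ₂) * e'
      ≤ ρ₁ / 8 * (2 * e + 2 * κ ^ 2 * dx) + (ρ₁ + c.C24 1 * ρ₂) * Ny := by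
    have hpos : 0 ≤ ρ₁ + c.C24 1 * ρ₂ := by rw [hC24]; positivity
    have a1 := mul_le_mul_of_nonneg_left h2 hpos
    have a2 := mul_le_mul_of_nonneg_right hA hy₀
    have a3 := mul_le_mul_of_nonneg_left h3 (by positivity : 0 ≤ ρ₁ / 8)
    linarith
  have k3 : w' ≤ 1 / 16 * (2 * r + 2 * Q * (2 * e' + 2 * (1 + κ) ^ 2 * dx)) + Nv := by
    have a1 := mul_le_mul_of_nonneg_right hD hw₀
    linarith
  have k4 : ρ₂ * r' ≤ ρ₂ * (2 * (1 / 16 * (2 * r + 2 * Q * (2 * e' + 2 * (1 + κ) ^ 2 * dx)) + Nv)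
      + 2 * Q * e') := mul_le_mul_of_nonneg_left (by linarith) hρ₂
  have k5 : ρ₂ * Q * ((1 + κ) ^ 2 * dx) ≤ ρ₂ * Q * ((2 + 2 * κ ^ 2) * dx) := by
    gcongr
    nlinarith [sq_nonneg (1 - κ)]
  rw [hw] at h1
  rw [hC24] at k2 ⊢
  have p1 : 0 ≤ ρ₁ * κ ^ 2 * dx := by positivity
  have p2 : 0 ≤ ρ₂ * Q * dx := by positivity
  have p3 : 0 ≤ ρ₂ * Q * κ ^ 2 * dx := by positivity
  have p4 : 0 ≤ ρ₂ * Q * e' := by positivity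
  have p5 : 0 ≤ ρ₁ * e := by positivity
  have p6 : 0 ≤ ρ₂ * r := by positivity
  linarith

namespace Draws.Valid

variable {p q : ℕ} {ΞF ΞG Ω : Type*} [MeasurableSpace ΞF] [MeasurableSpace ΞG]
  [MeasurableSpace Ω] {P : Measure Ω} [IsProbabilityMeasure P] {B : Bilevel p q ΞF ΞG}
  {R : Draws p q ΞF ΞG Ω} {c : Consts} {s : Noise} {a : Params} {ρ₁ ρ₂ : ℝ}

lemma integrable_gradient_Phi (hR : R.Valid B c P) (hB : B.Assumptions c s) (hc : c.Admissible)
    (k : ℕ) : Integrable (fun ω => ‖gradient B.Phi (R.run B a k ω).x‖ ^ 2) P := by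
  have hm : Measurable fun ω => gradient B.Phi (R.run B a k ω).x :=
    (hB.continuous_gradient_Phi hc).measurable.comp (hR.measurable_run hB hc k).fst
  refine Integrable.of_bound (hm.norm.pow_const 2).aestronglyMeasurable
    ((c.M + c.L * (c.M / c.μ)) ^ 2) (Filter.Eventually.of_forall fun ω => ?_)
  rw [Real.norm_of_nonneg (sq_nonneg _)]
  exact pow_le_pow_left₀ (norm_nonneg _) (hB.norm_gradient_Phi_le hc _) 2

lemma integrable_run_v (hR : R.Valid B c P) (hB : B.Assumptions c s) (hc : c.Admissible)
    (ha : a.Suitable c ρ₁ ρ₂) (k : ℕ) : Integrable (fun ω => ‖(R.run B a k ω).v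
      - B.vSol (R.run B a k ω).x (B.yStar (R.run B a k ω).x)‖ ^ 2) P := by
  have hm := hR.measurable_run (a := a) hB hc k
  have hy : Measurable fun ω => B.yStar (R.run B a k ω).x :=
    (hB.continuous_yStar hc).measurable.comp hm.fst
  exact integrable_norm_v_sub_vSol hB hc hm.fst hy hm.snd.snd (hR.ae_norm_run_v_le hB hc ha k)

/-- Per-iteration noise in the decrease of the Lyapunov function. -/
def _root_.iterNoise (c : Consts) (s : Noise) (a : Params) (ρ₁ ρ₂ : ℝ) : ℝ :=
  a.α / 2 * noiseX c s a + (ρ₁ + c.C24 1 * ρ₂) * noiseY c s a + 2 * ρ₂ * noiseV c s a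

lemma add_sq_le (u w : ℝ) : (u + w) ^ 2 ≤ 2 * u ^ 2 + 2 * w ^ 2 := by
  nlinarith [sq_nonneg (u - w)]

/-- Expected decrease of the Lyapunov function in one outer iteration. -/
lemma outer_iteration (hR : R.Valid B c P) (hB : B.Assumptions c s) (hc : c.Admissible)
    (ha : a.Suitable c ρ₁ ρ₂) (hbdd : BddBelow (Set.range B.Phi)) (k : ℕ)
    (hΦ : Integrable (fun ω => B.Phi (R.run B a k ω).x) P)
    (he : Integrable (fun ω => ‖(R.run B a k ω).y - B.yStar (R.run B a k ω).x‖ ^ 2) P) :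
    Integrable (fun ω => B.Phi (R.run B a (k + 1) ω).x) P ∧
    Integrable (fun ω => ‖(R.run B a (k + 1) ω).y - B.yStar (R.run B a (k + 1) ω).x‖ ^ 2) P ∧
    ∫ ω, B.Phi (R.run B a (k + 1) ω).x ∂P
      + ρ₁ * ∫ ω, ‖(R.run B a (k + 1) ω).y - B.yStar (R.run B a (k + 1) ω).x‖ ^ 2 ∂P
      + ρ₂ * ∫ ω, ‖(R.run B a (k + 1) ω).v
        - B.vSol (R.run B a (k + 1) ω).x (B.yStar (R.run B a (k + 1) ω).x)‖ ^ 2 ∂P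
      + a.α / 2 * ∫ ω, ‖gradient B.Phi (R.run B a k ω).x‖ ^ 2 ∂P
    ≤ ∫ ω, B.Phi (R.run B a k ω).x ∂P
      + ρ₁ * ∫ ω, ‖(R.run B a k ω).y - B.yStar (R.run B a k ω).x‖ ^ 2 ∂P
      + ρ₂ * ∫ ω, ‖(R.run B a k ω).v
        - B.vSol (R.run B a k ω).x (B.yStar (R.run B a k ω).x)‖ ^ 2 ∂P
      + iterNoise c s a ρ₁ ρ₂ := by
  have hμ := hc.μ_pos
  have hL := hc.L_pos
  set m := ⨅ x, B.Phi x
  have hm : ∀ x, m ≤ B.Phi x := fun x => ciInf_le hbdd x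
  have hG := hR.integrable_gradient_Phi (a := a) hB hc k
  have hr := hR.integrable_run_v hB hc ha k
  have hr' := hR.integrable_run_v hB hc ha (k + 1)
  have hrun := hR.measurable_run (a := a) hB hc k
  have hv := hR.ae_norm_run_v_le hB hc ha k
  have hCw : 0 ≤ c.C22 1 := by unfold Consts.C22; positivity
  have hw0 : 0 < c.stepWeight ρ₁ ρ₂ := by
    have h1 := ha.ρ₁_pos
    have h2 := ha.ρ₂_pos
    unfold Consts.stepWeight; positivity
  -- the upper-level step
  have hS := hR.isSampling (φ := .outer k) (ψ := .jac k)
    (fun i j h => by simpa using h) (fun i j h => by simpa using h)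
  have hind := hR.indepFun_batches (measurable_run_sigmaOf (a := a) hB hc k)
    (φ := .outer k) (ψ := .jac k)
    (fun i => by simp [usedDraws, IsUsedDraw]) (fun i => by simp [usedDraws, IsUsedDraw])
  have hX := hB.integral_Phi_le hc hS hrun hind ha.Df_pos ha.Dg_pos hm hw0.le ha.α_pos.le
    ha.α_smooth hv hΦ hG he hr
  have hxd : ∀ ω, ‖a.α • B.updX a (R.run B a k ω).triple
      (fun i => R.ξ (.outer k i) ω, fun i => R.ζ (.jac k i) ω)‖
        = ‖(R.runX B a k ω).x - (R.run B a k ω).x‖ := fun ω => by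
    rw [runX_x, sub_sub_cancel_left, norm_neg]; rfl
  simp only [hxd] at hX
  have hX' : Integrable (fun ω => B.Phi (R.runX B a k ω).x - m
      + c.stepWeight ρ₁ ρ₂ * ‖(R.runX B a k ω).x - (R.run B a k ω).x‖ ^ 2) P := hX.1
  have hXle := hX.2
  have hmX := hR.measurable_runX (a := a) hB hc k
  have hΦm : Measurable B.Phi := (hB.differentiable_Phi hc).continuous.measurable
  -- So far only a sum of two nonnegative terms is known to be integrable. Each term is dominated by
  -- the sum; recovering `dx` uses that the weight is strictly positive.
  have hΦ'm : Integrable (fun ω => B.Phi (R.runX B a k ω).x - m) P := by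
    refine hX'.mono' ((hΦm.comp hmX.fst).sub_const m).aestronglyMeasurable
      (Filter.Eventually.of_forall fun ω => ?_)
    rw [Real.norm_of_nonneg (sub_nonneg.2 (hm _))]
    have : 0 ≤ c.stepWeight ρ₁ ρ₂ * ‖(R.runX B a k ω).x - (R.run B a k ω).x‖ ^ 2 := by positivity
    linarith
  have hdx : Integrable (fun ω => ‖(R.runX B a k ω).x - (R.run B a k ω).x‖ ^ 2) P := by
    have := (hX'.sub hΦ'm).const_mul (c.stepWeight ρ₁ ρ₂)⁻¹
    refine this.congr (Filter.Eventually.of_forall fun ω => ?_)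
    simp only [Pi.sub_apply]
    field_simp
    ring
  have hΦ' : Integrable (fun ω => B.Phi (R.runX B a k ω).x) P :=
    (hΦ'm.add (integrable_const m)).congr (Filter.Eventually.of_forall fun ω => by simp)
  have hXeq : ∫ ω, (B.Phi (R.runX B a k ω).x - m
      + c.stepWeight ρ₁ ρ₂ * ‖(R.runX B a k ω).x - (R.run B a k ω).x‖ ^ 2) ∂P
      = ∫ ω, B.Phi (R.runX B a k ω).x ∂P - m
        + c.stepWeight ρ₁ ρ₂ * ∫ ω, ‖(R.runX B a k ω).x - (R.run B a k ω).x‖ ^ 2 ∂P := by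
    rw [integral_add hΦ'm (hdx.const_mul _), integral_sub hΦ' (integrable_const m),
      integral_const_mul]
    simp
  -- the lower-level loop
  have hyX : Measurable fun ω => B.yStar (R.runX B a k ω).x :=
    (hB.continuous_yStar hc).measurable.comp hmX.fst
  have hy0le : ∀ ω, ‖(R.run B a k ω).y - B.yStar (R.runX B a k ω).x‖ ^ 2
      ≤ 2 * ‖(R.run B a k ω).y - B.yStar (R.run B a k ω).x‖ ^ 2
        + 2 * (c.L / c.μ) ^ 2 * ‖(R.runX B a k ω).x - (R.run B a k ω).x‖ ^ 2 := fun ω => by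
    have h1 := hB.norm_yStar_sub_le hc (R.run B a k ω).x (R.runX B a k ω).x
    have h2 := norm_sub_le_norm_sub_add_norm_sub (R.run B a k ω).y
      (B.yStar (R.run B a k ω).x) (B.yStar (R.runX B a k ω).x)
    rw [norm_sub_rev (R.run B a k ω).x] at h1
    calc _ ≤ (‖(R.run B a k ω).y - B.yStar (R.run B a k ω).x‖
          + c.L / c.μ * ‖(R.runX B a k ω).x - (R.run B a k ω).x‖) ^ 2 :=
          pow_le_pow_left₀ (norm_nonneg _) (by linarith) 2
      _ ≤ _ := (add_sq_le _ _).trans (le_of_eq (by ring))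
  have hy0i : Integrable (fun ω => 2 * ‖(R.run B a k ω).y - B.yStar (R.run B a k ω).x‖ ^ 2
        + 2 * (c.L / c.μ) ^ 2 * ‖(R.runX B a k ω).x - (R.run B a k ω).x‖ ^ 2) P :=
    (he.const_mul 2).add (hdx.const_mul _)
  have hy0 : Integrable (fun ω => ‖(R.run B a k ω).y - B.yStar (R.runX B a k ω).x‖ ^ 2) P := by
    refine hy0i.mono' ((hrun.snd.fst.sub hyX).norm.pow_const 2).aestronglyMeasurable
      (Filter.Eventually.of_forall fun ω => ?_)
    rw [Real.norm_of_nonneg (sq_nonneg _)]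
    exact hy0le ω
  have h3 := integral_mono hy0 hy0i hy0le
  rw [integral_add (he.const_mul 2) (hdx.const_mul _), integral_const_mul,
    integral_const_mul] at h3
  obtain ⟨he', h2⟩ := hR.integral_runY_le hB hc ha k hy0 a.T
  -- the linear-system loop
  have h5 := hR.integral_runV_le hB hc ha k a.J
  have hmY := hR.measurable_runY (a := a) hB hc k a.T
  have hmV := hR.measurable_runV (a := a) hB hc k a.J
  have hw₀ : Integrable (fun ω => ‖(R.run B a k ω).v
      - B.vSol (R.runX B a k ω).x (R.runY B a k a.T ω).y‖ ^ 2) P :=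
    integrable_norm_v_sub_vSol hB hc hmX.fst hmY.snd.fst hrun.snd.snd hv
  have hw' : Integrable (fun ω => ‖(R.runV B a k a.J ω).v
      - B.vSol (R.runX B a k ω).x (R.runY B a k a.T ω).y‖ ^ 2) P :=
    integrable_norm_v_sub_vSol hB hc hmX.fst hmY.snd.fst hmV.snd.snd
      (hv.mono fun ω hω => norm_runV_v_le hB hc ha hω a.J)
  simp only [run_succ, runV_x, runV_y] at hr' ⊢
  have h4 : ∫ ω, ‖(R.runV B a k a.J ω).v
        - B.vSol (R.runX B a k ω).x (B.yStar (R.runX B a k ω).x)‖ ^ 2 ∂P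
      ≤ 2 * ∫ ω, ‖(R.runV B a k a.J ω).v
          - B.vSol (R.runX B a k ω).x (R.runY B a k a.T ω).y‖ ^ 2 ∂P
        + 2 * c.C1 ^ 2
          * ∫ ω, ‖(R.runY B a k a.T ω).y - B.yStar (R.runX B a k ω).x‖ ^ 2 ∂P := by
    rw [← integral_const_mul, ← integral_const_mul,
      ← integral_add (hw'.const_mul _) (he'.const_mul _)]
    refine integral_mono hr' ((hw'.const_mul _).add (he'.const_mul _)) fun ω => ?_
    have h1 := hB.norm_vSol_sub_le hc (R.runX B a k ω).x (R.runX B a k ω).x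
      (R.runY B a k a.T ω).y (B.yStar (R.runX B a k ω).x)
    rw [sub_self, norm_zero, zero_add] at h1
    have h2 := norm_sub_le_norm_sub_add_norm_sub (R.runV B a k a.J ω).v
      (B.vSol (R.runX B a k ω).x (R.runY B a k a.T ω).y)
      (B.vSol (R.runX B a k ω).x (B.yStar (R.runX B a k ω).x))
    calc _ ≤ (‖(R.runV B a k a.J ω).v - B.vSol (R.runX B a k ω).x (R.runY B a k a.T ω).y‖
          + c.C1 * ‖(R.runY B a k a.T ω).y - B.yStar (R.runX B a k ω).x‖) ^ 2 :=
          pow_le_pow_left₀ (norm_nonneg _) (by linarith) 2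
      _ ≤ _ := (add_sq_le _ _).trans (le_of_eq (by ring))
  have h6 : ∫ ω, ‖(R.run B a k ω).v
        - B.vSol (R.runX B a k ω).x (R.runY B a k a.T ω).y‖ ^ 2 ∂P
      ≤ 2 * ∫ ω, ‖(R.run B a k ω).v
          - B.vSol (R.run B a k ω).x (B.yStar (R.run B a k ω).x)‖ ^ 2 ∂P
        + 2 * c.C1 ^ 2
          * (2 * ∫ ω, ‖(R.runY B a k a.T ω).y - B.yStar (R.runX B a k ω).x‖ ^ 2 ∂P
          + 2 * (1 + c.L / c.μ) ^ 2
            * ∫ ω, ‖(R.runX B a k ω).x - (R.run B a k ω).x‖ ^ 2 ∂P) := by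
    have i1 : Integrable (fun ω => 2 * ‖(R.runY B a k a.T ω).y - B.yStar (R.runX B a k ω).x‖ ^ 2
        + 2 * (1 + c.L / c.μ) ^ 2 * ‖(R.runX B a k ω).x - (R.run B a k ω).x‖ ^ 2) P :=
      (he'.const_mul 2).add (hdx.const_mul (2 * (1 + c.L / c.μ) ^ 2))
    rw [← integral_const_mul, ← integral_const_mul, ← integral_const_mul,
      ← integral_add (he'.const_mul _) (hdx.const_mul _), ← integral_const_mul,
      ← integral_add (hr.const_mul _) (i1.const_mul _)]
    refine integral_mono hw₀ ((hr.const_mul _).add (i1.const_mul _)) fun ω => ?_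
    have h1 := hB.norm_vSol_sub_le hc (R.run B a k ω).x (R.runX B a k ω).x
      (B.yStar (R.run B a k ω).x) (R.runY B a k a.T ω).y
    have h2 := norm_sub_le_norm_sub_add_norm_sub (R.run B a k ω).v
      (B.vSol (R.run B a k ω).x (B.yStar (R.run B a k ω).x))
      (B.vSol (R.runX B a k ω).x (R.runY B a k a.T ω).y)
    have h3 := norm_sub_le_norm_sub_add_norm_sub (B.yStar (R.run B a k ω).x)
      (B.yStar (R.runX B a k ω).x) (R.runY B a k a.T ω).y
    have h4 := hB.norm_yStar_sub_le hc (R.run B a k ω).x (R.runX B a k ω).x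
    rw [norm_sub_rev (R.run B a k ω).x] at h1 h4
    rw [norm_sub_rev (B.yStar (R.runX B a k ω).x)] at h3
    have hC := Bilevel.Assumptions.C1_nonneg hc
    set E' := ‖(R.runY B a k a.T ω).y - B.yStar (R.runX B a k ω).x‖
    set d := ‖(R.runX B a k ω).x - (R.run B a k ω).x‖
    have h5 : c.C1 * (d + ‖B.yStar (R.run B a k ω).x - (R.runY B a k a.T ω).y‖)
        ≤ c.C1 * (E' + (1 + c.L / c.μ) * d) := mul_le_mul_of_nonneg_left (by linarith) hC
    calc _ ≤ (‖(R.run B a k ω).v - B.vSol (R.run B a k ω).x (B.yStar (R.run B a k ω).x)‖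
          + c.C1 * (E' + (1 + c.L / c.μ) * d)) ^ 2 :=
          pow_le_pow_left₀ (norm_nonneg _) (by linarith) 2
      _ ≤ 2 * ‖(R.run B a k ω).v - B.vSol (R.run B a k ω).x (B.yStar (R.run B a k ω).x)‖ ^ 2
          + 2 * c.C1 ^ 2 * (E' + (1 + c.L / c.μ) * d) ^ 2 :=
          (add_sq_le _ _).trans (le_of_eq (by ring))
      _ ≤ 2 * ‖(R.run B a k ω).v - B.vSol (R.run B a k ω).x (B.yStar (R.run B a k ω).x)‖ ^ 2
          + 2 * c.C1 ^ 2 * (2 * E' ^ 2 + 2 * ((1 + c.L / c.μ) * d) ^ 2) := by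
          gcongr; exact add_sq_le _ _
      _ = _ := by simp only [E', d]; ring
  have hημ : a.η * c.μ ≤ 1 := (mul_le_mul_of_nonneg_left hc.μ_le ha.η_pos.le).trans ha.η_le
  -- The mean-square factor is the square of the one controlled by `J`, so there is slack.
  have hD : ((1 - a.η * c.μ) ^ 2) ^ a.J ≤ 1 / 16 := by
    have h0 : 0 ≤ (1 - a.η * c.μ) ^ a.J := pow_nonneg (by linarith) _
    have h1 : ((1 - a.η * c.μ) ^ 2) ^ a.J = ((1 - a.η * c.μ) ^ a.J) ^ 2 :=
      pow_right_comm _ _ _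
    rw [h1]
    nlinarith [ha.J_large]
  refine ⟨hΦ', he', ?_⟩
  refine lyapunov_decrease hμ (m := m) ha.ρ₁_pos.le ha.ρ₂_pos.le
    (integral_nonneg fun _ => sq_nonneg _) (integral_nonneg fun _ => sq_nonneg _)
    (integral_nonneg fun _ => sq_nonneg _) (integral_nonneg fun _ => sq_nonneg _)
    (integral_nonneg fun _ => sq_nonneg _) (integral_nonneg fun _ => sq_nonneg _)
    ha.T_large hD ha.α_y ha.α_v ?_ h2 h3 h4 h5 h6
  rw [← hXeq]
  exact hXle

/-- Summed decrease of the Lyapunov function over `K` outer iterations. -/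
lemma sum_gradient_Phi_le (hR : R.Valid B c P) (hB : B.Assumptions c s) (hc : c.Admissible)
    (ha : a.Suitable c ρ₁ ρ₂) (hbdd : BddBelow (Set.range B.Phi)) (K : ℕ) :
    a.α / 2 * ∑ k ∈ Finset.range K, ∫ ω, ‖gradient B.Phi (R.run B a k ω).x‖ ^ 2 ∂P
      ≤ R.initialGap B ρ₁ ρ₂ P + K * iterNoise c s a ρ₁ ρ₂ := by
  have hint : ∀ k, Integrable (fun ω => B.Phi (R.run B a k ω).x) P ∧
      Integrable (fun ω => ‖(R.run B a k ω).y - B.yStar (R.run B a k ω).x‖ ^ 2) P := by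
    intro k
    induction k with
    | zero => exact ⟨hR.int_Phi, hR.int_y₀⟩
    | succ k ih =>
      have := hR.outer_iteration hB hc ha hbdd k ih.1 ih.2
      exact ⟨this.1, this.2.1⟩
  set H : ℕ → ℝ := fun k => ∫ ω, B.Phi (R.run B a k ω).x ∂P
      + ρ₁ * ∫ ω, ‖(R.run B a k ω).y - B.yStar (R.run B a k ω).x‖ ^ 2 ∂P
      + ρ₂ * ∫ ω, ‖(R.run B a k ω).v
        - B.vSol (R.run B a k ω).x (B.yStar (R.run B a k ω).x)‖ ^ 2 ∂P with hH
  have hsum : H K + a.α / 2 * ∑ k ∈ Finset.range K,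
      ∫ ω, ‖gradient B.Phi (R.run B a k ω).x‖ ^ 2 ∂P ≤ H 0 + K * iterNoise c s a ρ₁ ρ₂ := by
    induction K with
    | zero => simp
    | succ K ih =>
      have := (hR.outer_iteration hB hc ha hbdd K (hint K).1 (hint K).2).2.2
      rw [Finset.sum_range_succ, mul_add]
      push_cast
      simp only [hH] at ih ⊢
      linarith
  -- The error terms of the final Lyapunov value are nonnegative and are dropped.
  have hinf : (⨅ x, B.Phi x) ≤ H K := by
    have h1 : (⨅ x, B.Phi x) ≤ ∫ ω, B.Phi (R.run B a K ω).x ∂P := by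
      have := integral_mono (integrable_const (⨅ x, B.Phi x)) (hint K).1
        fun ω => ciInf_le hbdd (R.run B a K ω).x
      simpa using this
    have h2 : 0 ≤ ρ₁ * ∫ ω, ‖(R.run B a K ω).y - B.yStar (R.run B a K ω).x‖ ^ 2 ∂P :=
      mul_nonneg ha.ρ₁_pos.le (integral_nonneg fun _ => sq_nonneg _)
    have h3 : 0 ≤ ρ₂ * ∫ ω, ‖(R.run B a K ω).v
        - B.vSol (R.run B a K ω).x (B.yStar (R.run B a K ω).x)‖ ^ 2 ∂P :=
      mul_nonneg ha.ρ₂_pos.le (integral_nonneg fun _ => sq_nonneg _)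
    simp only [hH]
    linarith
  have h0 : H 0 = ∫ ω, B.lyapunov ρ₁ ρ₂ (R.x₀ ω) (R.y₀ ω) (R.v₀ ω) ∂P := by
    have i1 := (hint 0).1
    have i2 := (hint 0).2.const_mul ρ₁
    have i3 := (hR.integrable_run_v hB hc ha 0).const_mul ρ₂
    have i12 : Integrable (fun ω => B.Phi (R.run B a 0 ω).x
        + ρ₁ * ‖(R.run B a 0 ω).y - B.yStar (R.run B a 0 ω).x‖ ^ 2) P := i1.add i2
    simp only [hH]
    rw [← integral_const_mul, ← integral_const_mul, ← integral_add i1 i2,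
      ← integral_add i12 i3]
    rfl
  rw [Draws.initialGap, ← h0]
  linarith

/-- The empty sum, `K = 0`. Nonnegativity allows replacing the coefficient of the gap by a larger
one. -/
lemma initialGap_nonneg (hR : R.Valid B c P) (hB : B.Assumptions c s) (hc : c.Admissible)
    (ha : a.Suitable c ρ₁ ρ₂) (hbdd : BddBelow (Set.range B.Phi)) :
    0 ≤ R.initialGap B ρ₁ ρ₂ P := by
  simpa using hR.sum_gradient_Phi_le hB hc ha hbdd 0

end Draws.Valid

/-! ### Size of the constants as functions of the condition number. -/

lemma Real.pow_le_of_log_div_log_le {r A : ℝ} {n : ℕ} (hr : 0 < r) (hr1 : r < 1) (hA : 0 < A)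
    (h : Real.log A / Real.log r ≤ n) : r ^ n ≤ A := by
  rw [← Real.log_le_log_iff (pow_pos hr n) hA, Real.log_pow]
  exact (div_le_iff_of_neg (Real.log_neg hr hr1)).1 h

namespace Consts.Admissible

variable {c : Consts} {ρ₂ η : ℝ}

lemma one_le_κ (hc : c.Admissible) : 1 ≤ c.κ := (one_le_div hc.μ_pos).2 hc.μ_le

lemma rho1_eq (c : Consts) (ρ₂ : ℝ) : c.rho1 1 ρ₂ = 48 * ρ₂ * c.C1 ^ 2 := by
  simp only [Consts.rho1, Consts.C23]
  ring

lemma C24_eq (c : Consts) : c.C24 1 = 34 * c.C1 ^ 2 := by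
  simp only [Consts.C24]
  ring

lemma L31_eq (c : Consts) (ρ₂ : ℝ) :
    c.L31 1 ρ₂ = c.LPhi / 2 + c.stepWeight (c.rho1 1 ρ₂) ρ₂ := by
  simp only [Consts.L31, Consts.stepWeight]
  ring

lemma κ_le_C1 (hc : c.Admissible) : c.κ ≤ c.C1 := by
  have := hc.μ_pos
  have := hc.M_nonneg
  have := hc.ρ_nonneg
  rw [Consts.κ, Consts.C1]
  exact le_add_of_nonneg_left (by positivity)

lemma C1_pos (hc : c.Admissible) : 0 < c.C1 := by
  linarith [hc.one_le_κ, hc.κ_le_C1]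

lemma C1bar_pos (hc : c.Admissible) : 0 < c.C1bar := by
  have := hc.μ_pos
  have := hc.M_nonneg
  have := hc.τ_nonneg
  have := hc.L_pos
  rw [Consts.C1bar]
  positivity

lemma L31_pos (hc : c.Admissible) (hρ₂ : 0 < ρ₂) : 0 < c.L31 1 ρ₂ := by
  have := hc.μ_pos
  have := hc.M_nonneg
  have := hc.τ_nonneg
  have := hc.ρ_nonneg
  have := hc.L_pos
  have := hc.C1_pos
  rw [Consts.L31, rho1_eq, Consts.LPhi, Consts.C22]
  positivity

/-- Both weights are multiples of `ρ₂C₁²`, namely `48` and `34`, so the ratio is `48/(8·82)` and the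
bound on `T` depends on `κ` alone. -/
lemma rho1_div (hc : c.Admissible) (hρ₂ : 0 < ρ₂) :
    c.rho1 1 ρ₂ / (8 * (c.rho1 1 ρ₂ + c.C24 1 * ρ₂)) = 3 / 41 := by
  have := hc.C1_pos
  rw [rho1_eq, C24_eq]
  field_simp
  norm_num

/-- The prescribed step sizes and iteration counts make the Lyapunov function decrease. -/
lemma suitable (hc : c.Admissible) {T J Df Dg S D : ℕ} (hρ₂ : 0 < ρ₂) (hη : 0 < η)
    (hηL : η < 1 / c.L) (hT : c.Tmin 1 ρ₂ ≤ T) (hJ : c.Jmin 1 η ≤ J)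
    (hDf : 0 < Df) (hDg : 0 < Dg) (hS : 0 < S) (hD : 0 < D) :
    Params.Suitable ⟨c.alpha 1 ρ₂, 1 / (2 * c.L), η, T, J, Df, Dg, S, D⟩ c (c.rho1 1 ρ₂) ρ₂ := by
  have hμ := hc.μ_pos
  have hL := hc.L_pos
  have hC1 := hc.C1_pos
  have hCb := hc.C1bar_pos
  have h31 := hc.L31_pos hρ₂
  have hηL' : η * c.L < 1 := (lt_div_iff₀ hL).1 hηL
  have hημ : η * c.μ < 1 := (mul_le_mul_of_nonneg_left hc.μ_le hη.le).trans_lt hηL'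
  have hρ₁ : 0 < c.rho1 1 ρ₂ := by rw [rho1_eq]; positivity
  have hC23 : 0 < c.C23 1 := by rw [Consts.C23]; positivity
  have a1 : c.alpha 1 ρ₂ ≤ 1 / (2 * c.L31 1 ρ₂) := min_le_left _ _
  have a2 : c.alpha 1 ρ₂ ≤ ρ₂ * (1 + 1) * c.C23 1 / (2 * c.C1bar ^ 2) :=
    (min_le_right _ _).trans (min_le_left _ _)
  have a3 : c.alpha 1 ρ₂ ≤ ρ₂ / (4 * c.L ^ 2) := (min_le_right _ _).trans (min_le_right _ _)
  refine ⟨hDf, hDg, hS, hD, rfl, hη, hηL'.le, ?_, hρ₁, hρ₂, ?_, ?_, ?_, ?_, ?_⟩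
  · exact lt_min (by positivity) (lt_min (by positivity) (by positivity))
  · rw [← L31_eq]
    rw [le_div_iff₀ (by positivity)] at a1
    linarith
  · rw [le_div_iff₀ (by positivity)] at a2
    simp only [Consts.rho1]
    linarith
  · rw [le_div_iff₀ (by positivity)] at a3
    linarith
  · have h := Real.pow_le_of_log_div_log_le (r := c.L / (c.μ + c.L)) (by positivity)
      ((div_lt_one (by positivity)).2 (by linarith)) (by rw [hc.rho1_div hρ₂]; norm_num) hT
    rw [le_div_iff₀ (by rw [rho1_eq, C24_eq]; positivity)] at h
    simp only
    linarith
  · have hημ0 : 0 < η * c.μ := by positivity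
    refine (Real.pow_le_of_log_div_log_le (r := 1 - η * c.μ) (by linarith) (by linarith)
      (by norm_num) hJ).trans (by norm_num)

/-- From `log(L/(μ+L)) ≤ -1/(2κ)` and `log(3/41) ≥ 1 - 41/3 = -38/3` the quotient is at most
`76κ/3`, rounded up to `28κ`. -/
lemma Tmin_le (hc : c.Admissible) (hρ₂ : 0 < ρ₂) : c.Tmin 1 ρ₂ ≤ 28 * c.κ := by
  have hμ := hc.μ_pos
  have hL := hc.L_pos
  have hκ := hc.one_le_κ
  have h1 : Real.log (c.L / (c.μ + c.L)) ≤ -(1 / (2 * c.κ)) := by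
    have := Real.log_le_sub_one_of_pos (x := c.L / (c.μ + c.L)) (by positivity)
    refine this.trans ?_
    have h2 : c.L / (c.μ + c.L) - 1 = -(c.μ / (c.μ + c.L)) := by field_simp; ring
    rw [h2, neg_le_neg_iff, Consts.κ, div_le_div_iff₀ (by positivity) (by positivity)]
    have : c.μ * (2 * (c.L / c.μ)) = 2 * c.L := by field_simp
    linarith [hc.μ_le]
  have h3 : -(38 / 3) ≤ Real.log (3 / 41) := by
    have := Real.one_sub_inv_le_log_of_pos (x := 3 / 41) (by norm_num)
    norm_num at this ⊢
    exact this
  rw [Consts.Tmin, hc.rho1_div hρ₂, div_le_iff_of_neg (h1.trans_lt (by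
    rw [neg_lt_zero]; positivity))]
  have h4 := mul_le_mul_of_nonneg_left h1 (by positivity : 0 ≤ 28 * c.κ)
  have h5 : 28 * c.κ * -(1 / (2 * c.κ)) = -14 := by field_simp; norm_num
  linarith

lemma Jmin_le (hc : c.Admissible) {θ : ℝ} (hθ : 0 < θ) (hθ1 : θ < 1) :
    c.Jmin 1 (θ / c.L) ≤ 15 / θ * c.κ := by
  have hμ := hc.μ_pos
  have hL := hc.L_pos
  have hκ := hc.one_le_κ
  have h0 : θ / c.L * c.μ = θ / c.κ := by rw [Consts.κ]; field_simp
  have h1 : θ / c.κ < 1 := (div_lt_one (by positivity)).2 (by linarith)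
  have h2 : Real.log (1 - θ / c.κ) ≤ -(θ / c.κ) := by
    have := Real.log_le_sub_one_of_pos (x := 1 - θ / c.κ) (by linarith)
    linarith
  have h3 : -15 ≤ Real.log (1 / (4 * (1 + 1) ^ 2)) := by
    have := Real.one_sub_inv_le_log_of_pos (x := 1 / (4 * (1 + 1) ^ 2)) (by norm_num)
    refine le_trans ?_ this
    norm_num
  rw [Consts.Jmin, h0, div_le_iff_of_neg (h2.trans_lt (by rw [neg_lt_zero]; positivity))]
  have h4 := mul_le_mul_of_nonneg_left h2 (by positivity : 0 ≤ 15 / θ * c.κ)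
  have h5 : 15 / θ * c.κ * -(θ / c.κ) = -15 := by field_simp
  linarith

end Consts.Admissible

/-- The growth of the reciprocal step size in the condition number. -/
lemma exists_alpha_const {L M τ ρ b : ℝ}
    (hL : 0 < L) (hM : 0 ≤ M) (hτ : 0 ≤ τ) (hρ : 0 ≤ ρ) (hb : 0 < b) :
    ∃ A E : ℝ, 0 < A ∧ 0 < E ∧ ∀ μ : ℝ, 0 < μ → μ ≤ L → ∀ c : Consts, c = ⟨μ, L, M, τ, ρ⟩ →
      ∀ ρ₂ : ℝ, ρ₂ = b / c.κ ^ 3 →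
      0 < c.alpha 1 ρ₂ ∧ 1 / c.alpha 1 ρ₂ ≤ A * c.κ ^ 3 ∧ ρ₂ * c.C1 ^ 2 ≤ E * c.κ := by
  -- `μ = L/κ` turns the constants into polynomials in `κ ≥ 1`, and raising every power to the top
  -- one gives `C₁ ≤ a1 κ²`, `C̄₁ ≤ a2 κ`, `L_Φ ≤ a3 κ³`. `A` adds up bounds for the reciprocals of
  -- the three entries of the minimum defining `α`, divided by `κ³`.
  set a1 : ℝ := M * ρ / L ^ 2 + 1 with ha1
  set a2 : ℝ := L + M * τ / L with ha2
  set a3 : ℝ := L + (2 * L ^ 2 + τ * M) / L + (ρ * L * M + L ^ 3 + τ * M * L) / L ^ 2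
    + ρ * L ^ 2 * M / L ^ 3 with ha3
  set A : ℝ := a3 + 208 * b * a1 ^ 2 + a2 ^ 2 / (12 * b) + 4 * L ^ 2 / b with hA
  have pa1 : 0 < a1 := by positivity
  have pa2 : 0 < a2 := by positivity
  have pa3 : 0 < a3 := by positivity
  have pA : 0 < A := by positivity
  clear_value A
  refine ⟨A, b * a1 ^ 2, pA, by positivity, ?_⟩
  intro μ hμ hμL c hcc ρ₂ hρ₂
  have hc : c.Admissible := by subst hcc; exact ⟨hμ, hμL, hM, hτ, hρ⟩
  have hk := hc.one_le_κ
  have hkpos : 0 < c.κ := by linarith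
  have hμk : μ = L / c.κ := by subst hcc; simp only [Consts.κ]; field_simp
  have hC1 : c.C1 ≤ a1 * c.κ ^ 2 := by
    have h1 : c.C1 = M * ρ / L ^ 2 * c.κ ^ 2 + c.κ := by
      subst hcc; simp only [Consts.C1, Consts.κ]; field_simp
    rw [h1, ha1]
    nlinarith
  have hC1k := hc.κ_le_C1
  have hCb : c.C1bar ≤ a2 * c.κ := by
    have h1 : c.C1bar = L + M * τ / L * c.κ := by
      subst hcc; simp only [Consts.C1bar, Consts.κ]; field_simp
    rw [h1, ha2]
    nlinarith
  have hLP : c.LPhi ≤ a3 * c.κ ^ 3 := by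
    have h1 : c.LPhi = L + (2 * L ^ 2 + τ * M) / L * c.κ
        + (ρ * L * M + L ^ 3 + τ * M * L) / L ^ 2 * c.κ ^ 2
        + ρ * L ^ 2 * M / L ^ 3 * c.κ ^ 3 := by
      subst hcc; simp only [Consts.LPhi, Consts.κ]; field_simp
    have k1 : c.κ ≤ c.κ ^ 3 := le_self_pow₀ hk (by norm_num)
    have k2 : c.κ ^ 2 ≤ c.κ ^ 3 := pow_le_pow_right₀ hk (by norm_num)
    have k3 : L ≤ L * c.κ ^ 3 := le_mul_of_one_le_right hL.le (one_le_pow₀ hk)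
    rw [h1, ha3, add_mul, add_mul, add_mul]
    gcongr
  have hρ₂pos : 0 < ρ₂ := by rw [hρ₂]; positivity
  have hρ₂k : ρ₂ * c.κ ^ 3 = b := by rw [hρ₂]; field_simp
  have hC1pos := hc.C1_pos
  have hCbpos := hc.C1bar_pos
  have h31pos := hc.L31_pos hρ₂pos
  have hρC : ρ₂ * c.C1 ^ 2 ≤ b * a1 ^ 2 * c.κ := by
    calc ρ₂ * c.C1 ^ 2 ≤ ρ₂ * (a1 * c.κ ^ 2) ^ 2 := by gcongr
      _ = (ρ₂ * c.κ ^ 3) * a1 ^ 2 * c.κ := by ring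
      _ = _ := by rw [hρ₂k]
  have h31 : 2 * c.L31 1 ρ₂ ≤ (a3 + 208 * b * a1 ^ 2) * c.κ ^ 3 := by
    -- The coefficient is at most `208κ²`, and `ρ₂C₁² = O(κ)`: this balance at order `κ³` is what
    -- the choice `ρ₂ = bκ⁻³` achieves.
    have h1 : 2 * c.L31 1 ρ₂ = c.LPhi + (32 + 176 * c.κ ^ 2) * (ρ₂ * c.C1 ^ 2) := by
      rw [Consts.Admissible.L31_eq, Consts.stepWeight, Consts.Admissible.rho1_eq, Consts.C22,
        Consts.κ]
      field_simp
      ring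
    have h2 : (32 + 176 * c.κ ^ 2) * (ρ₂ * c.C1 ^ 2)
        ≤ (208 * c.κ ^ 2) * (b * a1 ^ 2 * c.κ) := by
      gcongr
      nlinarith
    rw [h1]
    linarith
  have hκ3 : 0 < c.κ ^ 3 := by positivity
  have hα : 1 / (A * c.κ ^ 3) ≤ c.alpha 1 ρ₂ := by
    refine le_min ?_ (le_min ?_ ?_)
    · refine one_div_le_one_div_of_le (by positivity) (h31.trans ?_)
      have : 0 < a2 ^ 2 / (12 * b) := by positivity
      have : 0 < 4 * L ^ 2 / b := by positivity
      exact mul_le_mul_of_nonneg_right (by linarith) hκ3.le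
    · rw [div_le_div_iff₀ (by positivity) (by positivity)]
      have h1 : a2 ^ 2 / (12 * b) ≤ A := by
        rw [hA]
        have : 0 < 208 * b * a1 ^ 2 := by positivity
        have : 0 < 4 * L ^ 2 / b := by positivity
        linarith
      have h2 : a2 ^ 2 ≤ 12 * b * A := by
        rw [div_le_iff₀ (by positivity)] at h1; linarith
      have h3 : c.C1bar ^ 2 ≤ a2 ^ 2 * c.κ ^ 2 := by
        rw [← mul_pow]; exact pow_le_pow_left₀ hCbpos.le hCb 2
      -- The lower bound `C₁ ≥ κ` compensates `C̄₁ = O(κ)`, so this entry of the minimum is of order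
      -- `ρ₂`, that is `κ⁻³`.
      have h4 : c.κ ^ 2 ≤ c.C1 ^ 2 := pow_le_pow_left₀ hkpos.le hC1k 2
      have h5 : c.C23 1 = 12 * c.C1 ^ 2 := by rw [Consts.C23]; ring
      calc 1 * (2 * c.C1bar ^ 2) ≤ 2 * (12 * b * A * c.C1 ^ 2) := by
            rw [one_mul]; gcongr; exact h3.trans (by gcongr)
        _ = _ := by rw [h5, ← hρ₂k]; ring
    · have h0 : c.L = L := by subst hcc; rfl
      have h1 : 4 * L ^ 2 / b ≤ A := by
        rw [hA]
        have : 0 < 208 * b * a1 ^ 2 := by positivity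
        have : 0 < a2 ^ 2 / (12 * b) := by positivity
        linarith
      rw [div_le_iff₀ hb] at h1
      rw [h0, div_le_div_iff₀ (by positivity) (by positivity), one_mul]
      calc _ ≤ _ := h1
        _ = _ := by rw [← hρ₂k]; ring
  have hαpos : 0 < c.alpha 1 ρ₂ := lt_of_lt_of_le (by positivity) hα
  refine ⟨hαpos, ?_, hρC⟩
  rw [div_le_iff₀ (by positivity)] at hα ⊢
  linarith

/-- The growth of the constants of the convergence rate in the condition number. -/
lemma exists_rate_const {L M τ ρ b : ℝ}
    (hL : 0 < L) (hM : 0 ≤ M) (hτ : 0 ≤ τ) (hρ : 0 ≤ ρ) (hb : 0 < b) :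
    ∃ C : ℝ, 0 < C ∧ ∀ μ : ℝ, 0 < μ → μ ≤ L → ∀ c : Consts, c = ⟨μ, L, M, τ, ρ⟩ →
      ∀ ρ₂ η : ℝ, ρ₂ = b / c.κ ^ 3 → 0 < η → η < 1 / L →
      2 / c.alpha 1 ρ₂ ≤ C * c.κ ^ 3 ∧
      2 / c.alpha 1 ρ₂ * (c.alpha 1 ρ₂ / 2 + ρ₂ * (1 + 1) * (η / μ)) ≤ C * c.κ ∧
      2 * M ^ 2 / μ ^ 2 ≤ C * c.κ ^ 2 ∧
      1 / c.alpha 1 ρ₂ * (c.rho1 1 ρ₂ + c.C24 1 * ρ₂) * ((μ + L) / (μ * L)) * (1 / (2 * L))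
        ≤ C * c.κ ^ 5 ∧
      2 / c.alpha 1 ρ₂ * ρ₂ * (1 + 1) * η * (M ^ 2 / μ ^ 3) ≤ C * c.κ ^ 3 := by
  obtain ⟨A, E, pA, pE, hAE⟩ := exists_alpha_const hL hM hτ hρ hb
  -- The sum of the five individual coefficients, so that one constant serves every term.
  refine ⟨2 * A + (1 + 4 * b * A / L ^ 2) + 2 * M ^ 2 / L ^ 2 + 82 * A * E / L ^ 2
    + 4 * A * b * M ^ 2 / L ^ 4, by positivity, ?_⟩
  intro μ hμ hμL c hcc ρ₂ η hρ₂ hη hηL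
  obtain ⟨hαpos, hinv, hρC⟩ := hAE μ hμ hμL c hcc ρ₂ hρ₂
  have hc : c.Admissible := by subst hcc; exact ⟨hμ, hμL, hM, hτ, hρ⟩
  have hk := hc.one_le_κ
  have hkpos : 0 < c.κ := by linarith
  have hμk : μ = L / c.κ := by subst hcc; simp only [Consts.κ]; field_simp
  have hρ₂pos : 0 < ρ₂ := by rw [hρ₂]; positivity
  have hρ₂k : ρ₂ * c.κ ^ 3 = b := by rw [hρ₂]; field_simp
  have hC1pos := hc.C1_pos
  set α := c.alpha 1 ρ₂
  have q1 : 0 ≤ 2 * A := by positivity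
  have q2 : 0 ≤ 1 + 4 * b * A / L ^ 2 := by positivity
  have q3 : 0 ≤ 2 * M ^ 2 / L ^ 2 := by positivity
  have q4 : 0 ≤ 82 * A * E / L ^ 2 := by positivity
  have q5 : 0 ≤ 4 * A * b * M ^ 2 / L ^ 4 := by positivity
  have e1 : 2 / α ≤ 2 * A * c.κ ^ 3 := by
    calc 2 / α = 2 * (1 / α) := by ring
      _ ≤ _ := by linarith
  have e2 : 2 / α * (α / 2 + ρ₂ * (1 + 1) * (η / μ)) ≤ (1 + 4 * b * A / L ^ 2) * c.κ := by
    calc _ = 1 + 4 * ρ₂ * (1 / α) * (η / μ) := by field_simp; ring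
      _ ≤ c.κ + 4 * ρ₂ * (A * c.κ ^ 3) * (1 / L / μ) := by gcongr
      _ = c.κ + 4 * (ρ₂ * c.κ ^ 3) * A * (1 / L / μ) := by ring
      _ = _ := by rw [hρ₂k, hμk]; field_simp
  have e3 : 2 * M ^ 2 / μ ^ 2 ≤ 2 * M ^ 2 / L ^ 2 * c.κ ^ 2 := by
    rw [hμk]; exact le_of_eq (by field_simp)
  have e4 : 1 / α * (c.rho1 1 ρ₂ + c.C24 1 * ρ₂) * ((μ + L) / (μ * L)) * (1 / (2 * L))
      ≤ 82 * A * E / L ^ 2 * c.κ ^ 5 := by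
    have h1 : (μ + L) / (μ * L) ≤ 2 * c.κ / L := by
      have : 2 * c.κ / L = 2 / μ := by rw [hμk]; field_simp
      rw [this, div_le_div_iff₀ (by positivity) (by positivity)]
      nlinarith
    have h2 : c.rho1 1 ρ₂ + c.C24 1 * ρ₂ ≤ 82 * (E * c.κ) := by
      rw [Consts.Admissible.rho1_eq, Consts.Admissible.C24_eq]; linarith
    have h3 : 0 ≤ c.rho1 1 ρ₂ + c.C24 1 * ρ₂ := by
      rw [Consts.Admissible.rho1_eq, Consts.Admissible.C24_eq]; positivity
    calc _ ≤ A * c.κ ^ 3 * (82 * (E * c.κ)) * (2 * c.κ / L) * (1 / (2 * L)) := by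
          gcongr
      _ = _ := by field_simp
  have e5 : 2 / α * ρ₂ * (1 + 1) * η * (M ^ 2 / μ ^ 3) ≤ 4 * A * b * M ^ 2 / L ^ 4 * c.κ ^ 3 := by
    calc _ ≤ 2 * A * c.κ ^ 3 * ρ₂ * (1 + 1) * (1 / L) * (M ^ 2 / μ ^ 3) := by gcongr
      _ = 4 * A * (ρ₂ * c.κ ^ 3) * (1 / L) * (M ^ 2 / μ ^ 3) := by ring
      _ = _ := by rw [hρ₂k, hμk]; field_simp
  have hk0 := hkpos.le
  refine ⟨e1.trans ?_, e2.trans ?_, e3.trans ?_, e4.trans ?_, e5.trans ?_⟩ <;>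
    exact mul_le_mul_of_nonneg_right (by linarith) (by positivity)

/-- The coefficients of the convergence rate grow at most like the stated powers of `κ`. -/
structure Consts.RateBound (c : Consts) (ρ₂ η C : ℝ) : Prop where
  gap : 2 / c.alpha 1 ρ₂ ≤ C * c.κ ^ 3
  gradF : 2 / c.alpha 1 ρ₂ * (c.alpha 1 ρ₂ / 2 + ρ₂ * (1 + 1) * (η / c.μ)) ≤ C * c.κ
  jac : 2 * c.M ^ 2 / c.μ ^ 2 ≤ C * c.κ ^ 2
  gradG : 1 / c.alpha 1 ρ₂ * (c.rho1 1 ρ₂ + c.C24 1 * ρ₂) * ((c.μ + c.L) / (c.μ * c.L))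
    * (1 / (2 * c.L)) ≤ C * c.κ ^ 5
  hess : 2 / c.alpha 1 ρ₂ * ρ₂ * (1 + 1) * η * (c.M ^ 2 / c.μ ^ 3) ≤ C * c.κ ^ 3

/-! ### The convergence rate for given parameters. -/

lemma Draws.Valid.convergence_rate {p q : ℕ} {ΞF ΞG Ω : Type*} [MeasurableSpace ΞF]
    [MeasurableSpace ΞG] [MeasurableSpace Ω] {P : Measure Ω} [IsProbabilityMeasure P]
    {B : Bilevel p q ΞF ΞG} {R : Draws p q ΞF ΞG Ω} {c : Consts} {s : Noise}
    (hR : R.Valid B c P) (hB : B.Assumptions c s) (hc : c.Admissible)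
    (hbdd : BddBelow (Set.range B.Phi)) {ρ₂ η C : ℝ} {K T J Df Dg S D : ℕ}
    (hC : c.RateBound ρ₂ η C) (hρ₂ : 0 < ρ₂) (hη : 0 < η) (hηL : η < 1 / c.L)
    (hT : c.Tmin 1 ρ₂ ≤ T) (hJ : c.Jmin 1 η ≤ J)
    (hK : 0 < K) (hDf : 0 < Df) (hDg : 0 < Dg) (hS : 0 < S) (hD : 0 < D) {a : Params}
    (ha : a = ⟨c.alpha 1 ρ₂, 1 / (2 * c.L), η, T, J, Df, Dg, S, D⟩) :
    1 / (K : ℝ) * ∑ k ∈ Finset.range K, ∫ ω, ‖gradient B.Phi (R.run B a k ω).x‖ ^ 2 ∂P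
        ≤ 2 / (K * c.alpha 1 ρ₂) * R.initialGap B (c.rho1 1 ρ₂) ρ₂ P
          + 2 / c.alpha 1 ρ₂ * (c.alpha 1 ρ₂ / 2 + ρ₂ * (1 + 1) * (η / c.μ)) * (s.σf ^ 2 / Df)
          + 2 * c.M ^ 2 / c.μ ^ 2 * (s.σg1 ^ 2 / Dg)
          + 1 / c.alpha 1 ρ₂ * (c.rho1 1 ρ₂ + c.C24 1 * ρ₂) * ((c.μ + c.L) / (c.μ * c.L))
            * (1 / (2 * c.L)) * (s.σg ^ 2 / S)
          + 2 / c.alpha 1 ρ₂ * ρ₂ * (1 + 1) * η * (c.M ^ 2 / c.μ ^ 3) * (s.σg2 ^ 2 / D) ∧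
    1 / (K : ℝ) * ∑ k ∈ Finset.range K, ∫ ω, ‖gradient B.Phi (R.run B a k ω).x‖ ^ 2 ∂P
        ≤ C * (c.κ ^ 3 / K * R.initialGap B (c.rho1 1 ρ₂) ρ₂ P + c.κ * s.σf ^ 2 / Df
          + c.κ ^ 2 * s.σg1 ^ 2 / Dg + c.κ ^ 5 * s.σg ^ 2 / S + c.κ ^ 3 * s.σg2 ^ 2 / D) := by
  have hs : a.Suitable c (c.rho1 1 ρ₂) ρ₂ := by
    rw [ha]; exact hc.suitable hρ₂ hη hηL hT hJ hDf hDg hS hD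
  have hsum := hR.sum_gradient_Phi_le hB hc hs hbdd K
  have hgap := hR.initialGap_nonneg hB hc hs hbdd
  have hα : 0 < c.alpha 1 ρ₂ := by simpa [ha] using hs.α_pos
  have hμ := hc.μ_pos
  have hL := hc.L_pos
  have hK' : (0 : ℝ) < K := by exact_mod_cast hK
  set α := c.alpha 1 ρ₂
  set ρ₁ := c.rho1 1 ρ₂
  set Δ := R.initialGap B ρ₁ ρ₂ P
  set G := ∑ k ∈ Finset.range K, ∫ ω, ‖gradient B.Phi (R.run B a k ω).x‖ ^ 2 ∂P
  -- The summed decrease is multiplied by `2/(Kα)`.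
  have h1 : 1 / (K : ℝ) * G ≤ 2 / (K * α) * Δ + 2 / α * iterNoise c s a ρ₁ ρ₂ := by
    have hαa : a.α = α := by rw [ha]
    rw [hαa] at hsum
    have := mul_le_mul_of_nonneg_left hsum (by positivity : 0 ≤ 2 / (K * α))
    calc 1 / (K : ℝ) * G = 2 / (K * α) * (α / 2 * G) := by field_simp
      _ ≤ _ := this
      _ = _ := by field_simp
  have h2 : 2 / α * iterNoise c s a ρ₁ ρ₂
      = 2 / α * (α / 2 + ρ₂ * (1 + 1) * (η / c.μ)) * (s.σf ^ 2 / Df)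
        + c.M ^ 2 / c.μ ^ 2 * (s.σg1 ^ 2 / Dg)
        + 1 / α * (ρ₁ + c.C24 1 * ρ₂) * ((c.μ + c.L) / (c.μ * c.L))
          * (1 / (2 * c.L)) * (s.σg ^ 2 / S)
        + 2 / α * ρ₂ * (1 + 1) * η * (c.M ^ 2 / c.μ ^ 3) * (s.σg2 ^ 2 / D) := by
    simp only [iterNoise, noiseX, noiseY, noiseV, ha]
    field_simp
    ring
  -- The analysis yields this term without the factor `2` allowed in the statement.
  have h3 : c.M ^ 2 / c.μ ^ 2 * (s.σg1 ^ 2 / Dg) ≤ 2 * c.M ^ 2 / c.μ ^ 2 * (s.σg1 ^ 2 / Dg) := by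
    rw [mul_div_assoc 2]
    have : 0 ≤ c.M ^ 2 / c.μ ^ 2 * (s.σg1 ^ 2 / Dg) := by positivity
    linarith
  refine and_iff_left_of_imp (fun h => h.trans ?_) |>.2 (by linarith)
  have t0 : 2 / (K * α) * Δ ≤ C * (c.κ ^ 3 / K * Δ) := by
    calc 2 / (K * α) * Δ = 2 / α * (Δ / K) := by field_simp
      _ ≤ C * c.κ ^ 3 * (Δ / K) := mul_le_mul_of_nonneg_right hC.gap (by positivity)
      _ = _ := by ring
  have t1 := mul_le_mul_of_nonneg_right hC.gradF (by positivity : 0 ≤ s.σf ^ 2 / (Df : ℝ))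
  have t2 := mul_le_mul_of_nonneg_right hC.jac (by positivity : 0 ≤ s.σg1 ^ 2 / (Dg : ℝ))
  have t3 := mul_le_mul_of_nonneg_right hC.gradG (by positivity : 0 ≤ s.σg ^ 2 / (S : ℝ))
  have t4 := mul_le_mul_of_nonneg_right hC.hess (by positivity : 0 ≤ s.σg2 ^ 2 / (D : ℝ))
  refine (add_le_add (add_le_add (add_le_add (add_le_add t0 t1) t2) t3) t4).trans (le_of_eq ?_)
  ring

/-! ### Evaluation counts -/

namespace Bilevel

variable {p q : ℕ} {ΞF ΞG : Type*} [MeasurableSpace ΞF] [MeasurableSpace ΞG]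
  (B : Bilevel p q ΞF ΞG) (a : Params) (ξ : FIdx → ΞF) (ζ : GIdx → ΞG)

lemma loopY_calls (k : ℕ) (s : State p q) (t : ℕ) :
    (B.loopY a ζ k s t).calls = { s.calls with gradG := s.calls.gradG + t * a.S } := by
  induction t with
  | zero => simp [loopY]
  | succ t ih => simp only [loopY, stepY, ih]; congr 1; ring

lemma loopV_calls (k : ℕ) (s : State p q) (j : ℕ) :
    (B.loopV a ξ ζ k s j).calls = { s.calls with
      gradF := s.calls.gradF + j * a.Df, hvG := s.calls.hvG + j * a.D } := by
  induction j with
  | zero => simp [loopV]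
  | succ j ih => simp only [loopV, stepV, ih]; congr 1 <;> ring

lemma ssgd_calls (x₀ : Euc p) (y₀ v₀ : Euc q) (K : ℕ) :
    (B.ssgd a x₀ y₀ v₀ ξ ζ K).calls
      = ⟨K * (a.Df + a.J * a.Df), K * (a.T * a.S), K * a.Dg, K * (a.J * a.D)⟩ := by
  induction K with
  | zero => simp [ssgd]
  | succ K ih =>
    simp only [ssgd, loopV_calls, loopY_calls, stepX, ih]
    congr 1 <;> ring

end Bilevel

/-! ### A uniformly random iterate -/

/-- Fubini over a finite index set whose points have mass `1/K`; it turns the average over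
iterations into the expectation at a random iterate. -/
lemma integral_prod_uniformOn {Ω : Type*} [MeasurableSpace Ω] {P : Measure Ω}
    [IsProbabilityMeasure P] {K : ℕ} (hK : 0 < K) {f : ℕ → Ω → ℝ} (hm : ∀ k, Measurable (f k))
    (hf : ∀ k, Integrable (f k) P) :
    Integrable (fun z : Ω × Fin K => f z.2 z.1) (P.prod (uniformOn Set.univ)) ∧
    ∫ z : Ω × Fin K, f z.2 z.1 ∂(P.prod (uniformOn Set.univ))
      = 1 / (K : ℝ) * ∑ k ∈ Finset.range K, ∫ ω, f k ω ∂P := by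
  have : NeZero K := ⟨hK.ne'⟩
  have : IsProbabilityMeasure (uniformOn (Set.univ : Set (Fin K))) :=
    isProbabilityMeasure_uniformOn Set.finite_univ Set.univ_nonempty
  have hmeas : Measurable fun z : Ω × Fin K => f z.2 z.1 :=
    measurable_from_prod_countable_left fun k => hm k
  have hint : Integrable (fun z : Ω × Fin K => f z.2 z.1) (P.prod (uniformOn Set.univ)) :=
    (integrable_prod_iff' hmeas.aestronglyMeasurable).2
      ⟨Filter.Eventually.of_forall fun k => hf k, Integrable.of_finite⟩
  refine ⟨hint, ?_⟩
  rw [integral_prod_symm _ hint, integral_fintype Integrable.of_finite, Finset.sum_range,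
    Finset.mul_sum]
  refine Finset.sum_congr rfl fun k _ => ?_
  rw [Measure.real, uniformOn_univ]
  simp

/-! ### Choice of the batch sizes -/

/-- The witness is the ceiling of `(5Ct + 1)κ^i/ε`. The `+1` keeps it positive when `Ct = 0`, and
rounding costs at most another `κ^i/ε ≥ 1`. The target `ε/5` reflects the five terms of the rate. -/
lemma exists_batch_size {κ ε C t : ℝ} (hκ : 1 ≤ κ) (hε : 0 < ε) (hε1 : ε ≤ 1) (hC : 0 ≤ C)
    (ht : 0 ≤ t) (i : ℕ) : ∃ n : ℕ, 0 < n ∧ (n : ℝ) ≤ (5 * C * t + 2) * κ ^ i / ε ∧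
      C * (κ ^ i * t / n) ≤ ε / 5 := by
  have hκi : 1 ≤ κ ^ i := one_le_pow₀ hκ
  have h1 : 1 ≤ κ ^ i / ε := by rw [le_div_iff₀ hε]; linarith
  have hpos : 0 < (5 * C * t + 1) * κ ^ i / ε := by positivity
  have hn : 0 < ⌈(5 * C * t + 1) * κ ^ i / ε⌉₊ := Nat.ceil_pos.2 hpos
  refine ⟨⌈(5 * C * t + 1) * κ ^ i / ε⌉₊, hn, ?_, ?_⟩
  · have := (Nat.ceil_lt_add_one hpos.le).le
    refine this.trans ?_
    have : (5 * C * t + 2) * κ ^ i / ε = (5 * C * t + 1) * κ ^ i / ε + κ ^ i / ε := by ring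
    linarith
  · have h2 := Nat.le_ceil ((5 * C * t + 1) * κ ^ i / ε)
    have hn' : (0 : ℝ) < (⌈(5 * C * t + 1) * κ ^ i / ε⌉₊ : ℝ) := by exact_mod_cast hn
    rw [← mul_div_assoc, div_le_iff₀ hn']
    rw [div_le_iff₀ hε] at h2
    nlinarith

lemma evaluation_bounds {N κ ε K Df Dg S D T J : ℝ} (hN : 1 ≤ N) (hκ : 1 ≤ κ) (hε : 0 < ε)
    (hDf₀ : 0 ≤ Df) (hDg₀ : 0 ≤ Dg) (hS₀ : 0 ≤ S) (hD₀ : 0 ≤ D) (hT₀ : 0 ≤ T) (hJ₀ : 0 ≤ J)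
    (hK : K ≤ N * κ ^ 3 / ε) (hDf : Df ≤ N * κ / ε) (hDg : Dg ≤ N * κ ^ 2 / ε)
    (hS : S ≤ N * κ ^ 5 / ε) (hD : D ≤ N * κ ^ 3 / ε) (hT : T ≤ N * κ) (hJ : J ≤ N * κ) :
    K * (Df + J * Df) ≤ 2 * N ^ 3 * κ ^ 5 / ε ^ 2 ∧ K * (T * S) ≤ N ^ 3 * κ ^ 9 / ε ^ 2 ∧
    K * Dg ≤ N ^ 3 * κ ^ 5 / ε ^ 2 ∧ K * (J * D) ≤ N ^ 3 * κ ^ 7 / ε ^ 2 := by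
  have h1 : 1 ≤ N * κ := one_le_mul_of_one_le_of_one_le hN hκ
  refine ⟨?_, ?_, ?_, ?_⟩
  · calc K * (Df + J * Df) = K * ((1 + J) * Df) := by ring
      -- `1 ≤ Nκ` absorbs the single outer `F`-batch into the `J` inner ones.
      _ ≤ N * κ ^ 3 / ε * ((N * κ + N * κ) * (N * κ / ε)) := by gcongr
      _ = _ := by field_simp; ring
  · calc _ ≤ N * κ ^ 3 / ε * (N * κ * (N * κ ^ 5 / ε)) := by gcongr
      _ = _ := by field_simp
  · calc _ ≤ N * κ ^ 3 / ε * (N * κ ^ 2 / ε) := by gcongr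
      _ = N ^ 2 * κ ^ 5 / ε ^ 2 := by field_simp
      _ ≤ _ := by gcongr; norm_num
  · calc _ ≤ N * κ ^ 3 / ε * (N * κ * (N * κ ^ 3 / ε)) := by gcongr
      _ = _ := by field_simp

lemma natCeil_le_add_one_mul {x u κ : ℝ} (hκ : 1 ≤ κ) (hu : 0 ≤ u) (hx : x ≤ u * κ) :
    (⌈x⌉₊ : ℝ) ≤ (u + 1) * κ := by
  have h1 : (⌈x⌉₊ : ℝ) ≤ (⌈u * κ⌉₊ : ℝ) := by exact_mod_cast Nat.ceil_mono hx
  have h2 := (Nat.ceil_lt_add_one (by positivity : 0 ≤ u * κ)).le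
  linarith

lemma exists_complexity_params {L M τ ρ b C₀ : ℝ} (hM : 0 ≤ M) (hτ : 0 ≤ τ)
    (hρ : 0 ≤ ρ) (hb : 0 < b) (hC₀ : 0 < C₀) (s : Noise) (Δ : ℝ) {θ : ℝ} (hθ : 0 < θ)
    (hθ1 : θ < 1) :
    ∃ C : ℝ, 0 < C ∧ ∀ μ : ℝ, 0 < μ → μ ≤ L → ∀ c : Consts, c = ⟨μ, L, M, τ, ρ⟩ →
      ∀ ρ₂ η : ℝ, ρ₂ = b / c.κ ^ 3 → η = θ / L → ∀ ε : ℝ, 0 < ε → ε ≤ 1 →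
      ∃ K T J Df Dg S D : ℕ,
        (0 < K ∧ 0 < Df ∧ 0 < Dg ∧ 0 < S ∧ 0 < D ∧ c.Tmin 1 ρ₂ ≤ T ∧ c.Jmin 1 η ≤ J ∧
        K ≤ C * c.κ ^ 3 / ε ∧ Df ≤ C * c.κ / ε ∧ Dg ≤ C * c.κ ^ 2 / ε ∧
        S ≤ C * c.κ ^ 5 / ε ∧ D ≤ C * c.κ ^ 3 / ε ∧ T ≤ C * c.κ ∧ J ≤ C * c.κ) ∧
        (∀ δ ≤ Δ, C₀ * (c.κ ^ 3 / K * δ + c.κ * s.σf ^ 2 / Df + c.κ ^ 2 * s.σg1 ^ 2 / Dg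
          + c.κ ^ 5 * s.σg ^ 2 / S + c.κ ^ 3 * s.σg2 ^ 2 / D) ≤ ε) ∧
        ∀ n : Calls, n = ⟨K * (Df + J * Df), K * (T * S), K * Dg, K * (J * D)⟩ →
          (n.gradF : ℝ) ≤ C * c.κ ^ 5 / ε ^ 2 ∧ (n.gradG : ℝ) ≤ C * c.κ ^ 9 / ε ^ 2 ∧
          (n.jvG : ℝ) ≤ C * c.κ ^ 5 / ε ^ 2 ∧ (n.hvG : ℝ) ≤ C * c.κ ^ 7 / ε ^ 2 ∧
          (n.total : ℝ) ≤ C * c.κ ^ 9 / ε ^ 2 := by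
  -- One number above all separate constants: `5C₀t + 2` for `K` and each batch, `29` for `T`, `15/θ
  -- + 1` for `J`. The final `5N³` comes from the total count, with shares `2 + 1 + 1 + 1`.
  set N : ℝ := 5 * C₀ * max Δ 0 + 5 * C₀ * s.σf ^ 2 + 5 * C₀ * s.σg1 ^ 2 + 5 * C₀ * s.σg ^ 2
    + 5 * C₀ * s.σg2 ^ 2 + 15 / θ + 30 with hN
  have hΔ0 : 0 ≤ max Δ 0 := le_max_right _ _
  have n0 : 0 ≤ 5 * C₀ * max Δ 0 := by positivity
  have n1 : 0 ≤ 5 * C₀ * s.σf ^ 2 := by positivity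
  have n2 : 0 ≤ 5 * C₀ * s.σg1 ^ 2 := by positivity
  have n3 : 0 ≤ 5 * C₀ * s.σg ^ 2 := by positivity
  have n4 : 0 ≤ 5 * C₀ * s.σg2 ^ 2 := by positivity
  have n5 : 0 ≤ 15 / θ := by positivity
  have hN1 : 1 ≤ N := by linarith
  have hN0 : 0 < N := by linarith
  have hNN : N ≤ N ^ 3 := le_self_pow₀ hN1 (by norm_num)
  refine ⟨5 * N ^ 3, by positivity, ?_⟩
  intro μ hμ hμL c hcc ρ₂ η hρ₂ hη ε hε hε1
  have hc : c.Admissible := by subst hcc; exact ⟨hμ, hμL, hM, hτ, hρ⟩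
  have hk := hc.one_le_κ
  have hkpos : 0 < c.κ := by linarith
  have hρ₂pos : 0 < ρ₂ := by rw [hρ₂]; positivity
  -- `K` is chosen like a batch size, with the positive part of `Δ` in the role of a variance, since
  -- `Δ` may be negative.
  obtain ⟨K, K0, K1, K2⟩ := exists_batch_size hk hε hε1 hC₀.le hΔ0 3
  obtain ⟨Df, Df0, Df1, Df2⟩ := exists_batch_size hk hε hε1 hC₀.le (sq_nonneg s.σf) 1
  obtain ⟨Dg, Dg0, Dg1, Dg2⟩ := exists_batch_size hk hε hε1 hC₀.le (sq_nonneg s.σg1) 2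
  obtain ⟨S, S0, S1, S2⟩ := exists_batch_size hk hε hε1 hC₀.le (sq_nonneg s.σg) 5
  obtain ⟨D, D0, D1, D2⟩ := exists_batch_size hk hε hε1 hC₀.le (sq_nonneg s.σg2) 3
  rw [pow_one] at Df1 Df2
  have hTle := natCeil_le_add_one_mul hk (by norm_num) (hc.Tmin_le hρ₂pos)
  have hJle := natCeil_le_add_one_mul hk n5 (hc.Jmin_le hθ hθ1)
  have hcL : θ / c.L = η := by subst hcc; exact hη.symm
  rw [hcL] at hJle
  set T := ⌈c.Tmin 1 ρ₂⌉₊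
  set J := ⌈c.Jmin 1 η⌉₊
  have scale : ∀ {x w y : ℝ}, 0 ≤ y → x ≤ w * y / ε → w ≤ N → x ≤ N * y / ε :=
    fun hy hx hw => hx.trans (by gcongr)
  have K1' : (K : ℝ) ≤ N * c.κ ^ 3 / ε := scale (by positivity) K1 (by linarith)
  have Df1' : (Df : ℝ) ≤ N * c.κ / ε := scale (by positivity) Df1 (by linarith)
  have Dg1' : (Dg : ℝ) ≤ N * c.κ ^ 2 / ε := scale (by positivity) Dg1 (by linarith)
  have S1' : (S : ℝ) ≤ N * c.κ ^ 5 / ε := scale (by positivity) S1 (by linarith)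
  have D1' : (D : ℝ) ≤ N * c.κ ^ 3 / ε := scale (by positivity) D1 (by linarith)
  have T1' : (T : ℝ) ≤ N * c.κ := hTle.trans (by gcongr; linarith)
  have J1' : (J : ℝ) ≤ N * c.κ := hJle.trans (by gcongr; linarith)
  have hN5 : N ≤ 5 * N ^ 3 := by linarith [pow_pos hN0 3]
  refine ⟨K, T, J, Df, Dg, S, D, ⟨K0, Df0, Dg0, S0, D0, Nat.le_ceil _, Nat.le_ceil _,
    K1'.trans (by gcongr), Df1'.trans (by gcongr), Dg1'.trans (by gcongr),
    S1'.trans (by gcongr), D1'.trans (by gcongr), T1'.trans (by gcongr),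
    J1'.trans (by gcongr)⟩, fun δ hδ => ?_, ?_⟩
  · have hδ' : C₀ * (c.κ ^ 3 / K * δ) ≤ C₀ * (c.κ ^ 3 * max Δ 0 / K) := by
      rw [div_mul_eq_mul_div]
      have := hδ.trans (le_max_left Δ 0)
      gcongr
    linarith
  · rintro n rfl
    obtain ⟨b1, b2, b3, b4⟩ := evaluation_bounds hN1 hk hε Df.cast_nonneg Dg.cast_nonneg
      S.cast_nonneg D.cast_nonneg T.cast_nonneg J.cast_nonneg K1' Df1' Dg1' S1' D1' T1' J1'
    have hN3 : 0 < N ^ 3 := by positivity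
    have h59 : c.κ ^ 5 ≤ c.κ ^ 9 := pow_le_pow_right₀ hk (by norm_num)
    have h79 : c.κ ^ 7 ≤ c.κ ^ 9 := pow_le_pow_right₀ hk (by norm_num)
    simp only [Calls.total]
    push_cast
    refine ⟨b1.trans ?_, b2.trans ?_, b3.trans ?_, b4.trans ?_, ?_⟩
    · gcongr; norm_num
    · gcongr; linarith
    · gcongr; linarith
    · gcongr; linarith
    · have c1 : 2 * N ^ 3 * c.κ ^ 5 / ε ^ 2 ≤ 2 * N ^ 3 * c.κ ^ 9 / ε ^ 2 := by gcongr
      have c3 : N ^ 3 * c.κ ^ 5 / ε ^ 2 ≤ N ^ 3 * c.κ ^ 9 / ε ^ 2 := by gcongr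
      have c4 : N ^ 3 * c.κ ^ 7 / ε ^ 2 ≤ N ^ 3 * c.κ ^ 9 / ε ^ 2 := by gcongr
      have e : 5 * N ^ 3 * c.κ ^ 9 / ε ^ 2 = 2 * N ^ 3 * c.κ ^ 9 / ε ^ 2
          + N ^ 3 * c.κ ^ 9 / ε ^ 2 + N ^ 3 * c.κ ^ 9 / ε ^ 2 + N ^ 3 * c.κ ^ 9 / ε ^ 2 := by ring
      rw [e]
      linarith

end

theorem theorem2 (L M τ ρ b : ℝ)
    (hL : 0 < L) (hM : 0 ≤ M) (hτ : 0 ≤ τ) (hρ : 0 ≤ ρ) (hb : 0 < b) :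
    -- the convergence rate
    (∃ C : ℝ, 0 < C ∧
      ∀ (μ : ℝ), 0 < μ → μ ≤ L →
      ∀ (c : Consts), c = ⟨μ, L, M, τ, ρ⟩ →
      ∀ (s : Noise) (p q : ℕ) (ΞF : Type*) (ΞG : Type*) (Ω : Type*)
        [MeasurableSpace ΞF] [MeasurableSpace ΞG] [MeasurableSpace Ω]
        (P : Measure Ω) [IsProbabilityMeasure P]
        (B : Bilevel p q ΞF ΞG) (R : Draws p q ΞF ΞG Ω),
      B.Assumptions c s → BddBelow (Set.range B.Phi) → R.Valid B c P →
      ∀ (ρ₂ η : ℝ) (K T J Df Dg S D : ℕ),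
      ρ₂ = b / c.κ ^ 3 → 0 < η → η < 1 / L →
      c.Tmin 1 ρ₂ ≤ T → c.Jmin 1 η ≤ J →
      0 < K → 0 < Df → 0 < Dg → 0 < S → 0 < D →
      ∀ (α β ρ₁ : ℝ) (a : Params),
      α = c.alpha 1 ρ₂ → β = 1 / (2 * L) → ρ₁ = c.rho1 1 ρ₂ →
      a = ⟨α, β, η, T, J, Df, Dg, S, D⟩ →
      Differentiable ℝ B.Phi ∧
      (∀ k < K, Integrable (fun ω => ‖gradient B.Phi (R.run B a k ω).x‖ ^ 2) P) ∧
      1 / (K : ℝ) * ∑ k ∈ Finset.range K, ∫ ω, ‖gradient B.Phi (R.run B a k ω).x‖ ^ 2 ∂P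
        ≤ 2 / (K * α) * R.initialGap B ρ₁ ρ₂ P
          + 2 / α * (α / 2 + ρ₂ * (1 + 1) * (η / μ)) * (s.σf ^ 2 / Df)
          + 2 * M ^ 2 / μ ^ 2 * (s.σg1 ^ 2 / Dg)
          + 1 / α * (ρ₁ + c.C24 1 * ρ₂) * ((μ + L) / (μ * L)) * β * (s.σg ^ 2 / S)
          + 2 / α * ρ₂ * (1 + 1) * η * (M ^ 2 / μ ^ 3) * (s.σg2 ^ 2 / D) ∧
      1 / (K : ℝ) * ∑ k ∈ Finset.range K, ∫ ω, ‖gradient B.Phi (R.run B a k ω).x‖ ^ 2 ∂P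
        ≤ C * (c.κ ^ 3 / K * R.initialGap B ρ₁ ρ₂ P + c.κ * s.σf ^ 2 / Df
          + c.κ ^ 2 * s.σg1 ^ 2 / Dg + c.κ ^ 5 * s.σg ^ 2 / S + c.κ ^ 3 * s.σg2 ^ 2 / D)) ∧
    -- the complexity
    (∀ (s : Noise) (Δ θ : ℝ), 0 < θ → θ < 1 →
      ∃ C : ℝ, 0 < C ∧
      ∀ (μ : ℝ), 0 < μ → μ ≤ L →
      ∀ (c : Consts), c = ⟨μ, L, M, τ, ρ⟩ →
      ∀ (ρ₂ η : ℝ), ρ₂ = b / c.κ ^ 3 → η = θ / L →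
      ∀ (ε : ℝ), 0 < ε → ε ≤ 1 →
      ∃ (K T J Df Dg S D : ℕ),
        0 < K ∧ 0 < Df ∧ 0 < Dg ∧ 0 < S ∧ 0 < D ∧ c.Tmin 1 ρ₂ ≤ T ∧ c.Jmin 1 η ≤ J ∧
        K ≤ C * c.κ ^ 3 / ε ∧ Df ≤ C * c.κ / ε ∧ Dg ≤ C * c.κ ^ 2 / ε ∧
        S ≤ C * c.κ ^ 5 / ε ∧ D ≤ C * c.κ ^ 3 / ε ∧ T ≤ C * c.κ ∧ J ≤ C * c.κ ∧
        ∀ (a : Params), a = ⟨c.alpha 1 ρ₂, 1 / (2 * L), η, T, J, Df, Dg, S, D⟩ →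
        ∀ (p q : ℕ) (ΞF : Type*) (ΞG : Type*) (Ω : Type*)
          [MeasurableSpace ΞF] [MeasurableSpace ΞG] [MeasurableSpace Ω]
          (P : Measure Ω) [IsProbabilityMeasure P]
          (B : Bilevel p q ΞF ΞG) (R : Draws p q ΞF ΞG Ω),
        B.Assumptions c s → BddBelow (Set.range B.Phi) → R.Valid B c P →
        R.initialGap B (c.rho1 1 ρ₂) ρ₂ P ≤ Δ →
        -- a uniformly random one of the first `K` iterates is `ε`-stationary
        Integrable (fun z : Ω × Fin K => ‖gradient B.Phi (R.run B a z.2 z.1).x‖ ^ 2)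
          (P.prod (uniformOn Set.univ)) ∧
        ∫ z : Ω × Fin K, ‖gradient B.Phi (R.run B a z.2 z.1).x‖ ^ 2
          ∂(P.prod (uniformOn Set.univ)) ≤ ε ∧
        ∀ ω, ((R.run B a K ω).calls.gradF : ℝ) ≤ C * c.κ ^ 5 / ε ^ 2 ∧
          ((R.run B a K ω).calls.gradG : ℝ) ≤ C * c.κ ^ 9 / ε ^ 2 ∧
          ((R.run B a K ω).calls.jvG : ℝ) ≤ C * c.κ ^ 5 / ε ^ 2 ∧
          ((R.run B a K ω).calls.hvG : ℝ) ≤ C * c.κ ^ 7 / ε ^ 2 ∧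
          ((R.run B a K ω).calls.total : ℝ) ≤ C * c.κ ^ 9 / ε ^ 2) := by
  -- `C₀` is fixed before `μ`, the problem and the noise levels; the same constant serves the rate
  -- and, through the choice of parameters, the complexity.
  obtain ⟨C₀, hC₀, hrate⟩ := exists_rate_const hL hM hτ hρ hb
  have hadm : ∀ μ : ℝ, 0 < μ → μ ≤ L → (⟨μ, L, M, τ, ρ⟩ : Consts).Admissible :=
    fun μ hμ hμL => ⟨hμ, hμL, hM, hτ, hρ⟩
  have hbound : ∀ μ : ℝ, 0 < μ → μ ≤ L → ∀ c : Consts, c = ⟨μ, L, M, τ, ρ⟩ → ∀ ρ₂ η : ℝ,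
      ρ₂ = b / c.κ ^ 3 → 0 < η → η < 1 / L → c.RateBound ρ₂ η C₀ := by
    intro μ hμ hμL c hc ρ₂ η hρ₂ hη hηL
    obtain ⟨h1, h2, h3, h4, h5⟩ := hrate μ hμ hμL c hc ρ₂ η hρ₂ hη hηL
    subst hc
    exact ⟨h1, h2, h3, h4, h5⟩
  have hρ₂pos : ∀ c : Consts, c.Admissible → ∀ ρ₂ : ℝ, ρ₂ = b / c.κ ^ 3 → 0 < ρ₂ := by
    intro c hc ρ₂ hρ₂
    have := hc.one_le_κ
    rw [hρ₂]
    positivity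
  refine ⟨⟨C₀, hC₀, ?_⟩, ?_⟩
  · intro μ hμ hμL c hcc s p q ΞF ΞG Ω _ _ _ P _ B R hB hbdd hR ρ₂ η K T J Df Dg S D hρ₂ hη hηL
      hT hJ hK hDf hDg hS hD α β ρ₁ a hα hβ hρ₁ ha
    have hRB := hbound μ hμ hμL c hcc ρ₂ η hρ₂ hη hηL
    have hc : c.Admissible := hcc ▸ hadm μ hμ hμL
    have h0 := hρ₂pos c hc ρ₂ hρ₂
    subst hcc hα hβ hρ₁
    have h := hR.convergence_rate hB hc hbdd hRB h0 hη hηL hT hJ hK hDf hDg hS hD ha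
    exact ⟨hB.differentiable_Phi hc, fun k _ => hR.integrable_gradient_Phi hB hc k, h.1, h.2⟩
  · intro s Δ θ hθ hθ1
    obtain ⟨C, hC, hpar⟩ := exists_complexity_params hM hτ hρ hb hC₀ s Δ hθ hθ1
    refine ⟨C, hC, ?_⟩
    intro μ hμ hμL c hcc ρ₂ η hρ₂ hη ε hε hε1
    obtain ⟨K, T, J, Df, Dg, S, D, ⟨hK, hDf, hDg, hS, hD, hT, hJ, hbd⟩, hacc, hcalls⟩ :=
      hpar μ hμ hμL c hcc ρ₂ η hρ₂ hη ε hε hε1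
    refine ⟨K, T, J, Df, Dg, S, D, hK, hDf, hDg, hS, hD, hT, hJ, hbd.1, hbd.2.1, hbd.2.2.1,
      hbd.2.2.2.1, hbd.2.2.2.2.1, hbd.2.2.2.2.2.1, hbd.2.2.2.2.2.2, ?_⟩
    intro a ha p q ΞF ΞG Ω _ _ _ P _ B R hB hbdd hR hgap
    have hη0 : 0 < η := by rw [hη]; positivity
    have hηL : η < 1 / L := by rw [hη]; gcongr
    have hRB := hbound μ hμ hμL c hcc ρ₂ η hρ₂ hη0 hηL
    have hc : c.Admissible := hcc ▸ hadm μ hμ hμL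
    have h0 := hρ₂pos c hc ρ₂ hρ₂
    have hcL : c.L = L := by rw [hcc]
    rw [← hcL] at ha hηL
    have h := (hR.convergence_rate hB hc hbdd hRB h0 hη0 hηL hT hJ hK hDf hDg hS hD ha).2
    have hm : ∀ k, Measurable fun ω => ‖gradient B.Phi (R.run B a k ω).x‖ ^ 2 := fun k =>
      (((hB.continuous_gradient_Phi hc).measurable.comp
        (hR.measurable_run hB hc k).fst).norm.pow_const 2)
    obtain ⟨hint, heq⟩ := integral_prod_uniformOn hK hm
      fun k => hR.integrable_gradient_Phi (a := a) hB hc k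
    -- The counters do not depend on the samples, so the bounds on evaluations hold for every
    -- outcome.
    refine ⟨hint, heq.le.trans (h.trans (hacc _ hgap)), fun ω => hcalls _ ?_⟩
    rw [Draws.run, Bilevel.ssgd_calls, ha]
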